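/- **Setting.** An Orlicz N-function is a continuous even convex $\varphi:\mathbb R\to\mathbb R$, increasing for $x>0$, with $\varphi(0)=0$, $\varphi(x)/x\to0$ as $x\to0$ and $\varphi(x)/x\to\infty$ as $x\to\infty$. Let $\varphi$ be an N-function such that $\lim_{x\to0}\varphi(x)/x^2$ exists in $(0,+\infty]$, let $f$ be its density (the nondecreasing right-continuous $f$ on $[0,\infty)$ with $f(0)=0$, $f(x)\to\infty$ as $x\to\infty$ and $\varphi(u)=\int_0^{|u|}f(v)\,dv$), and let $\varphi^*(x)=\sup_{y}(xy-\varphi(y))$. A real random variable $\xi$ with $\mathbf E\xi=0$ is in $Sub_\varphi(\Omega)$ if for some $a\ge0$, $\mathbf E e^{\lambda\xi}\le e^{\varphi(a\lambda)}$ for all $\lambda\in\mathbb R$; $\tau_\varphi(\xi)$ is the infimum of such $a$. A process $X(t)$, $t\in\mathbb R$, is strictly $Sub_\varphi(\Omega)$ with determinative constant $C_X>0$ if all $X(t)\in Sub_\varphi(\Omega)$, $\sup_t\tau_\varphi(X(t))<\infty$, and $\tau_\varphi(\sum_i\lambda_iX(t_i))\le C_X\bigl(\mathbf E(\sum_i\lambda_iX(t_i))^2\bigr)^{1/2}$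 for all finite real linear combinations. Put $\hat g(y)=\int_{\mathbb R} e^{-iyx}g(x)\,dx$. Let $\phi\in L_2(\mathbb R)$ be an $f$-wavelet: $\hat\phi(0)\ne0$, $\hat\phi$ is continuous at $0$, $\sum_{k\in\mathbb Z}|\hat\phi(y+2\pi k)|^2=1$ a.e., and $\hat\phi(y)=m_0(y/2)\hat\phi(y/2)$ a.e. for some $2\pi$-periodic $m_0\in L_2([0,2\pi])$. Let $\psi$ be the corresponding $m$-wavelet: $\hat\psi(y)=\overline{m_0(y/2+\pi)}\,e^{-iy/2}\,\hat\phi(y/2)$. Assume that $\phi,\psi$ are continuous and that for each $\delta\in\{\phi,\psi\}$ there is a non-increasing $\Phi_\delta:[0,\infty)\to\mathbb R$ with $|\delta(x)|\le\Phi_\delta(|x|)$ a.e. and $\int_{\mathbb R}\Phi_\delta(|x|)\,dx<\infty$. Put $$C_\delta=3\Phi_\delta(0)+4\int_{1/2}^\infty\Phi_\delta(t)\,dt,\qquad C_\delta(S,k)=\int_{k-S-1}^\infty\Phi_\delta(t)\,dt+\int_{k-1}^\infty\Phi_\delta(t)\,dt\quad(k\ge S+1).$$ Let $\phi_{0k}(x)=\phi(x-k)$,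 $\psi_{jk}(x)=2^{j/2}\psi(2^jx-k)$. **Theorem.** Let $X(t)$, $t\in\mathbb R$, be a measurable strictly $Sub_\varphi(\Omega)$ process with determinative constant $C_X$ and continuous covariance function $R(t,s)=\mathbf E X(t)X(s)$. Suppose there are an even function $c$ on $\mathbb R$, non-decreasing on $[0,\infty)$, with $c(0)>1$, a function $A:(0,\infty)\to(0,\infty)$ and $x_0\in\mathbb R$ such that $c(ax)\le c(x)A(a)$ for all $a>0$, $x\ge x_0$, $\int_{\mathbb R}c(x)\Phi_\delta(|x|)\,dx<\infty$ for $\delta=\phi,\psi$, and $|R(t,t)|^{1/2}\le c(t)$ for all $t$. Let $\xi_{0k}=\int_{\mathbb R}X(t)\overline{\phi_{0k}(t)}\,dt$ and $\eta_{jk}=\int_{\mathbb R}X(t)\overline{\psi_{jk}(t)}\,dt$ (mean-square integrals), and for $\mathbf k_n=(k_0',k_0,\dots,k_{n-1})$ let $$X_{n,\mathbf k_n}(t)=\sum_{|k|\le k_0'}\xi_{0k}\phi_{0k}(t)+\sum_{j=0}^{n-1}\sum_{|k|\le k_j}\eta_{jk}\psi_{jk}(t).$$ Let $T>0$, $p\ge1$,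 $\int_0^T(\mathbf E X(t)^2)^{p/2}dt<\infty$, and assume $$\sup_{k\in\mathbb Z}(\mathbf E|\xi_{0k}|^2)^{1/2}\,C_\phi+\sum_{j=0}^\infty\sup_{k\in\mathbb Z}(\mathbf E|\eta_{jk}|^2)^{1/2}\,2^{j/2}C_\psi<\infty .$$ Then $X$ and all $X_{n,\mathbf k_n}$ have almost all trajectories in $L_p([0,T])$, and $X_{n,\mathbf k_n}\to X$ in $L_p([0,T])$ in probability when $\mathbf k_n\to\infty$: if $n\to\infty$, $k_0'=k_0'(n)\to\infty$ and $k_j=k_j(n)\to\infty$ for every $j$, then $\mathbf P\{(\int_0^T|X_{n,\mathbf k_n}(t)-X(t)|^pdt)^{1/p}>\varepsilon\}\to0$ for every $\varepsilon>0$. Furthermore, let $k_0'\ge T+1$, $J=\min\{n,\min\{j\ge 0: k_j<2^jT+1\}\}$ and $$c_n^\infty=C_X^p\,T\Bigl(\sup_k(\mathbf E|\xi_{0k}|^2)^{1/2}C_\phi(T,k_0')+\sum_{j=0}^{J-1}\sup_k(\mathbf E|\eta_{jk}|^2)^{1/2}2^{j/2}C_\psi(2^jT,k_j)+\sum_{j=J}^\infty\sup_k(\mathbf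 E|\eta_{jk}|^2)^{1/2}2^{j/2}C_\psi\Bigr)^p.$$ Then for every $\varepsilon>0$ with $\varepsilon>c_n^\infty\bigl(f(p\,(c_n^\infty/\varepsilon)^{1/p})\bigr)^p$, $$\mathbf P\Bigl\{\int_0^T|X_{n,\mathbf k_n}(t)-X(t)|^p\,dt>\varepsilon\Bigr\}\le2\exp\bigl\{-\varphi^*\bigl((\varepsilon/c_n^\infty)^{1/p}\bigr)\bigr\},$$ where the right-hand side is read as $0$ if $c_n^\infty=0$. -/

import Mathlib

open MeasureTheory Filter Topology
open scoped ENNReal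

noncomputable section

namespace SubGaussWavelet

/-! ### Orlicz N-functions -/

/-- Orlicz N-functions: continuous, even, convex, `φ 0 = 0`, increasing for `x > 0`,
`φ x / x → 0` as `x → 0` and `φ x / x → ∞` as `x → ∞`. -/
structure IsNFunction (φ : ℝ → ℝ) : Prop where
  continuous : Continuous φ
  even : ∀ x, φ (-x) = φ x
  convex : ConvexOn ℝ Set.univ φ
  strictMono : StrictMonoOn φ (Set.Ioi 0)
  zero : φ 0 = 0
  div_tendsto_zero : Tendsto (fun x => φ x / x) (𝓝[≠] 0) (𝓝 0)
  div_tendsto_atTop : Tendsto (fun x => φ x / x) atTop atTop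

/-- Assumption Q: `φ` is an N-function and `φ x / x ^ 2` has a limit in `(0, ∞]` as `x → 0`. -/
def AssumptionQ (φ : ℝ → ℝ) : Prop :=
  IsNFunction φ ∧ ∃ c : ℝ≥0∞, 0 < c ∧
    Tendsto (fun x => ENNReal.ofReal (φ x / x ^ 2)) (𝓝[≠] 0) (𝓝 c)

/-- `f` (only its values on `[0, ∞)` matter) is the density of the N-function `φ`. -/
structure IsDensity (φ f : ℝ → ℝ) : Prop where
  monotoneOn : MonotoneOn f (Set.Ici 0)
  rightContinuous : ∀ x, 0 ≤ x → ContinuousWithinAt f (Set.Ici x) x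
  zero : f 0 = 0
  tendsto_atTop : Tendsto f atTop atTop
  integral_eq : ∀ u, φ u = ∫ v in (0 : ℝ)..|u|, f v

/-- The Young–Fenchel transform. -/
def youngFenchel (φ : ℝ → ℝ) (x : ℝ) : ℝ := ⨆ y : ℝ, (x * y - φ y)

/-! ### φ-sub-Gaussian random variables and processes -/

section Sub

variable {Ω : Type*} [MeasurableSpace Ω]

/-- `E exp(l ξ) ≤ exp(φ(a l))` for all real `l` (expectation taken in `[0, ∞]`). -/
def ExpMomentBound (φ : ℝ → ℝ) (P : Measure Ω) (ξ : Ω → ℝ) (a : ℝ) : Prop :=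
  ∀ l : ℝ, ∫⁻ ω, ENNReal.ofReal (Real.exp (l * ξ ω)) ∂P ≤ ENNReal.ofReal (Real.exp (φ (a * l)))

/-- The zero-mean random variable `ξ` belongs to `Sub_φ(Ω)`. -/
def IsSub (φ : ℝ → ℝ) (P : Measure Ω) (ξ : Ω → ℝ) : Prop :=
  Integrable ξ P ∧ ∫ ω, ξ ω ∂P = 0 ∧ ∃ r : ℝ, 0 ≤ r ∧ ExpMomentBound φ P ξ r

/-- The norm `τ_φ`. -/
def subNorm (φ : ℝ → ℝ) (P : Measure Ω) (ξ : Ω → ℝ) : ℝ :=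
  sInf {a : ℝ | 0 ≤ a ∧ ExpMomentBound φ P ξ a}

/-- The process `X` belongs to `Sub_φ(Ω)`. -/
def IsSubProcess {ι : Type*} (φ : ℝ → ℝ) (P : Measure Ω) (X : ι → Ω → ℝ) : Prop :=
  (∀ t, IsSub φ P (X t)) ∧ BddAbove (Set.range fun t => subNorm φ P (X t))

/-- `X` is a strictly `Sub_φ(Ω)` process with determinative constant `C`. -/
def IsStrictlySub {ι : Type*} (φ : ℝ → ℝ) (P : Measure Ω) (X : ι → Ω → ℝ) (C : ℝ) : Prop :=
  IsSubProcess φ P X ∧ 0 < C ∧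
    ∀ (s : Finset ι) (a : ι → ℝ),
      subNorm φ P (fun ω => ∑ i ∈ s, a i * X i ω) ≤
        C * Real.sqrt (∫ ω, (∑ i ∈ s, a i * X i ω) ^ 2 ∂P)

/-- The covariance function of a centred real process. -/
def cov (P : Measure Ω) (X : ℝ → Ω → ℝ) (t s : ℝ) : ℝ := ∫ ω, X t ω * X s ω ∂P

end Sub

/-! ### Wavelets -/

/-- `ĝ(y) = ∫ e^{-iyx} g(x) dx`. All functions to which this is applied below satisfy
Assumption S, hence are integrable. -/
def fourier (g : ℝ → ℂ) (y : ℝ) : ℂ := ∫ x : ℝ, Complex.exp (-(Complex.I * y * x)) * g x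

/-- `fw` is an f-wavelet with associated `2π`-periodic function `m₀`. -/
structure IsFWavelet (fw m₀ : ℝ → ℂ) : Prop where
  memLp : MemLp fw 2 volume
  fourier_zero : fourier fw 0 ≠ 0
  continuousAt : ContinuousAt (fourier fw) 0
  sum_eq_one : ∀ᵐ y : ℝ, HasSum (fun k : ℤ => ‖fourier fw (y + 2 * Real.pi * k)‖ ^ 2) 1
  mask_memLp : MemLp m₀ 2 (volume.restrict (Set.Icc 0 (2 * Real.pi)))
  mask_periodic : Function.Periodic m₀ (2 * Real.pi)
  refinement : ∀ᵐ y : ℝ, fourier fw y = m₀ (y / 2) * fourier fw (y / 2)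

/-- `mw` is the m-wavelet of the f-wavelet `fw`: it is the inverse Fourier transform of
`conj (m₀ (y/2 + π)) e^{-iy/2} f̂w(y/2)`, i.e. this function is its Fourier transform. -/
def IsMWavelet (fw m₀ mw : ℝ → ℂ) : Prop :=
  Integrable mw volume ∧
  ∀ᵐ y : ℝ, fourier mw y =
    starRingEnd ℂ (m₀ (y / 2 + Real.pi)) * Complex.exp (-(Complex.I * (y / 2))) *
      fourier fw (y / 2)

/-- `g_{jk}(x) = 2^{j/2} g(2^j x - k)`. -/
def dilate (g : ℝ → ℂ) (j : ℕ) (k : ℤ) (x : ℝ) : ℂ :=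
  (((2 : ℝ) ^ ((j : ℝ) / 2) : ℝ) : ℂ) * g (2 ^ j * x - k)

/-- Assumption S for `g` with majorant `Φ` (only the values of `Φ` on `[0, ∞)` matter). -/
structure AssumptionS (g : ℝ → ℂ) (Φ : ℝ → ℝ) : Prop where
  antitoneOn : AntitoneOn Φ (Set.Ici 0)
  bound : ∀ᵐ x : ℝ, ‖g x‖ ≤ Φ |x|
  integrable : Integrable (fun x : ℝ => Φ |x|) volume

/-- `C_δ = 3 Φ(0) + 4 ∫_{1/2}^∞ Φ`. -/
def constC (Φ : ℝ → ℝ) : ℝ := 3 * Φ 0 + 4 * ∫ t in Set.Ioi (1 / 2 : ℝ), Φ t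

/-- `C_δ(T, k) = ∫_{k-T-1}^∞ Φ + ∫_{k-1}^∞ Φ`, meaningful for `k ≥ T + 1`. -/
def tailC (Φ : ℝ → ℝ) (T : ℝ) (k : ℕ) : ℝ :=
  (∫ t in Set.Ioi ((k : ℝ) - T - 1), Φ t) + ∫ t in Set.Ioi ((k : ℝ) - 1), Φ t

/-! ### Wavelet coefficients and approximants -/

section Expansion

variable {Ω : Type*} [MeasurableSpace Ω]

open Classical in
/-- The class in complex `L_2(Ω)` of a real square-integrable random variable. -/
def toL2 (P : Measure Ω) (ξ : Ω → ℝ) : Lp ℂ 2 P :=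
  if h : MemLp (fun ω => (ξ ω : ℂ)) 2 P then h.toLp else 0

/-- The mean-square integral `∫ X(t) conj(g(t)) dt`: the integral, in the Hilbert space
`L_2(Ω)`, of the `L_2(Ω)`-valued function `t ↦ conj(g(t)) X(t)`. -/
def coeff (P : Measure Ω) (X : ℝ → Ω → ℝ) (g : ℝ → ℂ) : Lp ℂ 2 P :=
  ∫ t : ℝ, starRingEnd ℂ (g t) • toL2 P (X t)

/-- `ξ_{0k}`. -/
def xi (P : Measure Ω) (X : ℝ → Ω → ℝ) (fw : ℝ → ℂ) (k : ℤ) : Lp ℂ 2 P :=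
  coeff P X (dilate fw 0 k)

/-- `η_{jk}`. -/
def eta (P : Measure Ω) (X : ℝ → Ω → ℝ) (mw : ℝ → ℂ) (j : ℕ) (k : ℤ) : Lp ℂ 2 P :=
  coeff P X (dilate mw j k)

/-- The approximant `X_{n, k_n}(t)`, where `k_n = (k0, k 0, …, k (n-1))`. -/
def approx (P : Measure Ω) (X : ℝ → Ω → ℝ) (fw mw : ℝ → ℂ) (n k0 : ℕ) (k : ℕ → ℕ)
    (t : ℝ) (ω : Ω) : ℂ :=
  (∑ i ∈ Finset.Icc (-(k0 : ℤ)) (k0 : ℤ), xi P X fw i ω * dilate fw 0 i t) +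
    ∑ j ∈ Finset.range n, ∑ i ∈ Finset.Icc (-(k j : ℤ)) (k j : ℤ),
      eta P X mw j i ω * dilate mw j i t

/-- `sup_k (E|ξ_{0k}|²)^{1/2}`. -/
def supXi (P : Measure Ω) (X : ℝ → Ω → ℝ) (fw : ℝ → ℂ) : ℝ≥0∞ :=
  ⨆ k : ℤ, eLpNorm (xi P X fw k) 2 P

/-- `sup_k (E|η_{jk}|²)^{1/2}`. -/
def supEta (P : Measure Ω) (X : ℝ → Ω → ℝ) (mw : ℝ → ℂ) (j : ℕ) : ℝ≥0∞ :=
  ⨆ k : ℤ, eLpNorm (eta P X mw j k) 2 P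

/-- `J = min{n, min{j : k_j < 2^j T + 1}}` (only `k_0, …, k_{n-1}` matter). -/
def levelJ (T : ℝ) (n : ℕ) (k : ℕ → ℕ) : ℕ :=
  sInf {j : ℕ | j = n ∨ (k j : ℝ) < 2 ^ j * T + 1}

/-- The constant `c_n^∞`. -/
def cInfty (P : Measure Ω) (X : ℝ → Ω → ℝ) (fw mw : ℝ → ℂ) (Φf Φm : ℝ → ℝ)
    (CX p T : ℝ) (n k0 : ℕ) (k : ℕ → ℕ) : ℝ :=
  CX ^ p * T *
    (supXi P X fw * ENNReal.ofReal (tailC Φf T k0)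
      + ∑ j ∈ Finset.range (levelJ T n k),
          supEta P X mw j *
            ENNReal.ofReal ((2 : ℝ) ^ ((j : ℝ) / 2) * tailC Φm (2 ^ j * T) (k j))
      + ∑' j : {j : ℕ // levelJ T n k ≤ j},
          supEta P X mw j * ENNReal.ofReal ((2 : ℝ) ^ ((j : ℝ) / 2) * constC Φm)).toReal ^ p

/-- `∫_0^T |X_{n,k_n}(t) - X(t)|^p dt`, for the trajectory `ω`, with values in `[0, ∞]`. -/
def lpError (P : Measure Ω) (X : ℝ → Ω → ℝ) (fw mw : ℝ → ℂ) (p T : ℝ)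
    (n k0 : ℕ) (k : ℕ → ℕ) (ω : Ω) : ℝ≥0∞ :=
  ∫⁻ t in Set.Icc 0 T, ‖approx P X fw mw n k0 k t ω - (X t ω : ℂ)‖ₑ ^ p

/-- The process `Y` belongs to `L_p([0,T])`. -/
def InLp (P : Measure Ω) (Y : ℝ → Ω → ℂ) (p T : ℝ) : Prop :=
  ∀ᵐ ω ∂P, MemLp (fun t => Y t ω) (ENNReal.ofReal p) (volume.restrict (Set.Icc 0 T))

end Expansion

end SubGaussWavelet

end

namespace SubGaussWavelet

/-! ### Consequences of Assumption S -/

namespace AssumptionS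

variable {g : ℝ → ℂ} {Φ : ℝ → ℝ}

/-! The proof has a deterministic and a probabilistic half. They meet in one number: a bound `σ` for
the `L_2(Ω)` norm of the error `X_{n,k_n}(t) - X(t)`, uniform in `t ∈ [0,T]`, for which `c_n^∞ =
C_X^p T σ^p`.

Deterministic half. The process is a continuous curve `Z` in complex `L_2(Ω)` with norm at most
`c(t)`, and the wavelet expansion is studied for any such Banach-valued curve. The level-`j` series
of `g` is the integral of `Z` against `2^j K_g(2^j t, 2^j s)`, where `K_g(x,y) = ∑_k g(x-k) conj
g(y-k)` is bounded by a multiple of `Φ(|x-y|/2)`. Two facts about these kernels suffice. First,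
`K_fw(x,y) + K_mw(x,y) = 2 K_fw(2x,2y)` (`kernel_add_kernel`), so the levels telescope. Assumption S
makes the mask an absolutely convergent trigonometric series; hence the two-scale relations hold at
every point, and the identity becomes perfect reconstruction for a pair of conjugate quadrature
filters (`tsum_filtered_add`). Second, `∫ K_fw(x,y) dy = 1` (`IsFWavelet.integral_kernel`): the
periodization of `fw` is invariant under dilation by 2 and continuous at 0, hence constant, and
orthonormality of the translates fixes the constant. Thus the level projections act as an
approximate identity and converge to `Z(t)` for every `t` (`tendsto_levelProj`). The error of the
truncated expansion is then at most the suprema of the coefficient norms times the omitted parts of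
`∑_k |g(2^j t - k)|`, which `tailC` or `constC` controls (`enorm_expansion_error_le`).

Probabilistic half. The error lies in the closed complex span of `X`. For `Z` in this span, `‖Z‖ <
σ` implies `E cosh(l|Z|) ≤ exp φ(C_X σ l)` (`IsStrictlySub.lintegral_cosh_closure_le`). The wavelets
may be complex; convexity of `x ↦ cosh √x` combines real and imaginary parts without loss in the
constant. Comparing `y^s` with `cosh(ly)` yields `E|Z|^s ≤ 2 (s C_X σ / a)^s e^{-s} e^{φ(a)}`, and
Jensen, Fubini and Markov give a bound for the probability for all `s ≥ p` and `a > 0`. With `x =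
(ε/c_n^∞)^{1/p}` and `s = xa` this bound collapses to `2 exp(-(xa - φ(a)))`. The restriction `s ≥ p`
reads `a ≥ p/x`, and the condition on `ε` reads `f(p/x) < x`: the function `y ↦ xy - φ(y)` is still
non-decreasing up to `p/x`, so the restriction costs nothing in the supremum defining `φ*(x)`.
Convergence in probability uses the same bound with `s = p`, `a = 1`, and `σ → 0` by dominated
convergence over the levels. -/

theorem nonneg (hS : AssumptionS g Φ) {x : ℝ} (hx : 0 ≤ x) : 0 ≤ Φ x := by
  by_contra! h
  -- By monotonicity a negative value at `x` persists on all of `(x, ∞)`, where the a.e. bound would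
  -- then fail.
  have h0 : volume (Set.Ioi x) = 0 := by
    refine measure_mono_null (fun y hy => ?_) (ae_iff.1 hS.bound)
    have hy' : x < y := hy
    have h1 := hS.antitoneOn (Set.mem_Ici.2 hx) (Set.mem_Ici.2 (hx.trans hy'.le)) hy'.le
    simp only [Set.mem_ofPred_eq, not_le, abs_of_nonneg (hx.trans hy'.le)]
    exact (h1.trans_lt h).trans_le (norm_nonneg _)
  simp at h0

/-- `Φ` need not be continuous, so the a.e. bound is upgraded by moving away from the origin, where
`Φ` can only decrease: a violation at `x` spreads to an open set of points `y` with `|y| ≥ |x|`,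
which has positive measure. -/
theorem norm_le (hS : AssumptionS g Φ) (hg : Continuous g) (x : ℝ) : ‖g x‖ ≤ Φ |x| := by
  by_contra! h
  set U : Set ℝ := {y | Φ |x| < ‖g y‖} with hU
  have hUo : IsOpen U := isOpen_lt continuous_const hg.norm
  have hxU : x ∈ U := h
  have key : ∀ V : Set ℝ, IsOpen V → (∀ y ∈ V, |x| ≤ |y|) → ¬ (U ∩ V).Nonempty := by
    intro V hV hVx hne
    have h1 := (hUo.inter hV).measure_pos volume hne
    refine h1.ne' (measure_mono_null (fun y hy => ?_) (ae_iff.1 hS.bound))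
    simp only [Set.mem_ofPred_eq, not_le]
    exact (hS.antitoneOn (Set.mem_Ici.2 (abs_nonneg x)) (Set.mem_Ici.2 (abs_nonneg y))
      (hVx y hy.2)).trans_lt hy.1
  rcases le_total 0 x with h0 | h0
  · refine key (Set.Ioi x) isOpen_Ioi (fun y hy => ?_) ?_
    · rw [abs_of_nonneg h0, abs_of_nonneg (h0.trans (le_of_lt hy))]; exact le_of_lt hy
    · have : U ∈ 𝓝[>] x := mem_nhdsWithin_of_mem_nhds (hUo.mem_nhds hxU)
      exact (inter_mem this self_mem_nhdsWithin : U ∩ Set.Ioi x ∈ 𝓝[>] x) |> fun h =>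
        Filter.nonempty_of_mem h
  · refine key (Set.Iio x) isOpen_Iio (fun y hy => ?_) ?_
    · rw [abs_of_nonpos h0, abs_of_nonpos ((le_of_lt hy).trans h0)]
      exact neg_le_neg (le_of_lt hy)
    · have : U ∈ 𝓝[<] x := mem_nhdsWithin_of_mem_nhds (hUo.mem_nhds hxU)
      exact (inter_mem this self_mem_nhdsWithin : U ∩ Set.Iio x ∈ 𝓝[<] x) |> fun h =>
        Filter.nonempty_of_mem h

theorem norm_le_zero (hS : AssumptionS g Φ) (hg : Continuous g) (x : ℝ) : ‖g x‖ ≤ Φ 0 :=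
  (hS.norm_le hg x).trans
    (hS.antitoneOn (Set.mem_Ici.2 le_rfl) (Set.mem_Ici.2 (abs_nonneg x)) (abs_nonneg x))

theorem integrable_self (hS : AssumptionS g Φ) (hg : Continuous g) : Integrable g :=
  hS.integrable.mono' hg.aestronglyMeasurable hS.bound

theorem integrableOn_Ioi (hS : AssumptionS g Φ) {a : ℝ} (ha : 0 ≤ a) :
    IntegrableOn Φ (Set.Ioi a) :=
  (hS.integrable.integrableOn (s := Set.Ioi a)).congr_fun
    (fun x hx => by simp only [abs_of_nonneg (ha.trans (le_of_lt hx))]) measurableSet_Ioi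

theorem setIntegral_Ioi_nonneg (hS : AssumptionS g Φ) {a : ℝ} (ha : 0 ≤ a) :
    0 ≤ ∫ t in Set.Ioi a, Φ t :=
  setIntegral_nonneg measurableSet_Ioi fun _ hx => hS.nonneg (ha.trans (le_of_lt hx))

theorem setIntegral_Ioi_anti (hS : AssumptionS g Φ) {a b : ℝ} (ha : 0 ≤ a) (hab : a ≤ b) :
    ∫ t in Set.Ioi b, Φ t ≤ ∫ t in Set.Ioi a, Φ t :=
  setIntegral_mono_set (hS.integrableOn_Ioi ha)
    ((ae_restrict_iff' measurableSet_Ioi).2 (Eventually.of_forall fun _ hx =>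
      hS.nonneg (ha.trans (le_of_lt hx)))) (Set.Ioi_subset_Ioi hab).eventuallyLE

/-- Comparison of a series of values of the majorant with its integral. -/
theorem tsum_le_setIntegral (hS : AssumptionS g Φ) {a : ℝ} (ha : 0 ≤ a) :
    ∑' m : ℕ, ENNReal.ofReal (Φ (a + 1 + m)) ≤ ENNReal.ofReal (∫ t in Set.Ioi a, Φ t) := by
  rw [ofReal_integral_eq_lintegral_ofReal (hS.integrableOn_Ioi ha)
    ((ae_restrict_iff' measurableSet_Ioi).2 (Eventually.of_forall fun _ hx =>
      hS.nonneg (ha.trans (le_of_lt hx))))]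
  have hmono : Monotone fun m : ℕ => a + (m : ℝ) := fun m n h => by
    have : (m : ℝ) ≤ n := by exact_mod_cast h
    simpa using this
  have hdisj := hmono.pairwise_disjoint_on_Ioc_succ
  have hstep : ∀ m : ℕ, ENNReal.ofReal (Φ (a + 1 + m)) ≤
      ∫⁻ t in Set.Ioc (a + (m : ℝ)) (a + ((Order.succ m : ℕ) : ℝ)), ENNReal.ofReal (Φ t) := by
    intro m
    have hm : (0 : ℝ) ≤ m := m.cast_nonneg
    have : ∀ t ∈ Set.Ioc (a + (m : ℝ)) (a + ((Order.succ m : ℕ) : ℝ)),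
        ENNReal.ofReal (Φ (a + 1 + m)) ≤ ENNReal.ofReal (Φ t) := by
      intro t ht
      refine ENNReal.ofReal_le_ofReal (hS.antitoneOn ?_ ?_ ?_)
      · exact Set.mem_Ici.2 (by linarith [ht.1])
      · exact Set.mem_Ici.2 (by linarith [ht.1])
      · have := ht.2
        simp only [Nat.succ_eq_succ, Nat.succ_eq_add_one, Nat.cast_add, Nat.cast_one] at this
        linarith
    refine le_trans ?_ (setLIntegral_mono' measurableSet_Ioc this)
    rw [setLIntegral_const, Real.volume_Ioc]
    simp
  calc _ ≤ ∑' m : ℕ, ∫⁻ t in Set.Ioc (a + (m : ℝ)) (a + ((Order.succ m : ℕ) : ℝ)),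
        ENNReal.ofReal (Φ t) := ENNReal.tsum_le_tsum hstep
    _ = ∫⁻ t in ⋃ m : ℕ, Set.Ioc (a + (m : ℝ)) (a + ((Order.succ m : ℕ) : ℝ)),
        ENNReal.ofReal (Φ t) :=
      (lintegral_iUnion (fun _ => measurableSet_Ioc) hdisj _).symm
    _ ≤ _ := lintegral_mono_set (Set.iUnion_subset fun m t ht => by
      have hm : (0 : ℝ) ≤ m := m.cast_nonneg
      exact Set.mem_Ioi.2 (by linarith [ht.1]))

theorem constC_nonneg (hS : AssumptionS g Φ) : 0 ≤ constC Φ := by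
  have h1 := hS.nonneg le_rfl
  have h2 := hS.setIntegral_Ioi_nonneg (a := 1 / 2) (by norm_num)
  unfold constC
  positivity

theorem setIntegral_Ioi_zero_le (hS : AssumptionS g Φ) :
    ∫ t in Set.Ioi (0 : ℝ), Φ t ≤ Φ 0 / 2 + ∫ t in Set.Ioi (1 / 2 : ℝ), Φ t := by
  have h : Set.Ioc (0 : ℝ) (1 / 2) ∪ Set.Ioi (1 / 2) = Set.Ioi 0 :=
    Set.Ioc_union_Ioi_eq_Ioi (by norm_num)
  have h0 := hS.integrableOn_Ioi (a := 0) le_rfl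
  have hI : IntegrableOn Φ (Set.Ioc (0 : ℝ) (1 / 2)) := h0.mono_set fun x hx => hx.1
  rw [← h, setIntegral_union (Set.Ioc_disjoint_Ioi le_rfl) measurableSet_Ioi hI
    (hS.integrableOn_Ioi (by norm_num))]
  gcongr
  calc ∫ t in Set.Ioc (0 : ℝ) (1 / 2), Φ t ≤ ∫ _ in Set.Ioc (0 : ℝ) (1 / 2), Φ 0 :=
        setIntegral_mono_on hI (by simp) measurableSet_Ioc fun x hx =>
          hS.antitoneOn (Set.mem_Ici.2 le_rfl) (Set.mem_Ici.2 hx.1.le) hx.1.le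
    _ = Φ 0 / 2 := by simp; ring

/-- The sum of the integer translates of the majorant is bounded by `C_δ`. -/
theorem tsum_majorant_le (hS : AssumptionS g Φ) (x : ℝ) :
    ∑' k : ℤ, ENNReal.ofReal (Φ |x - k|) ≤ ENNReal.ofReal (constC Φ) := by
  -- The sum is 1-periodic in `x`, so `x` may be taken in `[0, 1)`.
  set y := Int.fract x with hy
  have hy0 : 0 ≤ y := Int.fract_nonneg x
  have hy1 : y < 1 := Int.fract_lt_one x
  have hmono : ∀ {u v : ℝ}, 0 ≤ u → u ≤ v → ENNReal.ofReal (Φ v) ≤ ENNReal.ofReal (Φ u) :=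
    fun hu huv => ENNReal.ofReal_le_ofReal
      (hS.antitoneOn (Set.mem_Ici.2 hu) (Set.mem_Ici.2 (hu.trans huv)) huv)
  have h1 : ∑' k : ℤ, ENNReal.ofReal (Φ |x - k|) = ∑' k : ℤ, ENNReal.ofReal (Φ |y - k|) := by
    rw [← (Equiv.addRight ⌊x⌋).tsum_eq]
    congr 1 with k
    simp only [Equiv.coe_addRight, Int.cast_add]
    rw [show x - (k + (⌊x⌋ : ℝ)) = y - k by rw [hy, Int.fract]; ring]
  rw [h1, tsum_of_nat_of_neg_add_one ENNReal.summable ENNReal.summable]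
  have hneg : ∑' n : ℕ, ENNReal.ofReal (Φ |y - ((-((n : ℤ) + 1) : ℤ) : ℝ)|) ≤
      ENNReal.ofReal (∫ t in Set.Ioi (0 : ℝ), Φ t) := by
    refine le_trans (ENNReal.tsum_le_tsum fun n => ?_) (hS.tsum_le_setIntegral le_rfl)
    have hn : (0 : ℝ) ≤ n := n.cast_nonneg
    push_cast
    rw [abs_of_nonneg (by linarith)]
    exact hmono (by linarith) (by linarith)
  have hpos : ∑' n : ℕ, ENNReal.ofReal (Φ |y - ((n : ℤ) : ℝ)|) ≤
      ENNReal.ofReal (Φ 0) + ENNReal.ofReal (Φ 0) +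
        ENNReal.ofReal (∫ t in Set.Ioi (0 : ℝ), Φ t) := by
    -- The translates `k = 0` and `k = 1`, at distance less than or equal to one from `y`, are
    -- bounded by `Φ 0`; the others are compared with the integral over `(0, ∞)`.
    rw [tsum_eq_zero_add' ENNReal.summable, tsum_eq_zero_add' ENNReal.summable, ← add_assoc]
    refine add_le_add (add_le_add ?_ ?_) ?_
    · exact hmono le_rfl (abs_nonneg _)
    · exact hmono le_rfl (abs_nonneg _)
    · refine le_trans (ENNReal.tsum_le_tsum fun n => ?_) (hS.tsum_le_setIntegral le_rfl)
      have hn : (0 : ℝ) ≤ n := n.cast_nonneg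
      push_cast
      rw [abs_of_nonpos (by linarith)]
      exact hmono (by linarith) (by linarith)
  refine (add_le_add hpos hneg).trans ?_
  have h0 := hS.nonneg le_rfl
  have hI := hS.setIntegral_Ioi_nonneg (a := 0) le_rfl
  have hI2 := hS.setIntegral_Ioi_nonneg (a := 1 / 2) (by norm_num)
  rw [← ENNReal.ofReal_add h0 h0, ← ENNReal.ofReal_add (by positivity) hI,
    ← ENNReal.ofReal_add (by positivity) hI]
  -- The total is `2 Φ(0) + 2 ∫_0^∞ Φ ≤ 3 Φ(0) + 2 ∫_{1/2}^∞ Φ`, which leaves room below `constC`.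
  refine ENNReal.ofReal_le_ofReal ?_
  have := hS.setIntegral_Ioi_zero_le
  unfold constC
  linarith

theorem enorm_le (hS : AssumptionS g Φ) (hg : Continuous g) (x : ℝ) :
    ‖g x‖ₑ ≤ ENNReal.ofReal (Φ |x|) := by
  rw [← ofReal_norm]
  exact ENNReal.ofReal_le_ofReal (hS.norm_le hg x)

theorem tsum_enorm_le (hS : AssumptionS g Φ) (hg : Continuous g) (x : ℝ) :
    ∑' k : ℤ, ‖g (x - k)‖ₑ ≤ ENNReal.ofReal (constC Φ) :=
  (ENNReal.tsum_le_tsum fun _ => hS.enorm_le hg _).trans (hS.tsum_majorant_le x)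

/-- The tail of the sum of translates is bounded by `C_δ(S, K)`. -/
theorem tsum_tail_enorm_le (hS : AssumptionS g Φ) (hg : Continuous g) {x S : ℝ} (hx0 : 0 ≤ x)
    (hxS : x ≤ S) {K : ℕ} (hK : S + 1 ≤ K) :
    ∑' k : ℤ, (if k ∈ Finset.Icc (-(K : ℤ)) K then 0 else ‖g (x - k)‖ₑ) ≤
      ENNReal.ofReal (tailC Φ S K) := by
  have hmono : ∀ {u v : ℝ}, 0 ≤ u → u ≤ v → ENNReal.ofReal (Φ v) ≤ ENNReal.ofReal (Φ u) :=
    fun hu huv => ENNReal.ofReal_le_ofReal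
      (hS.antitoneOn (Set.mem_Ici.2 hu) (Set.mem_Ici.2 (hu.trans huv)) huv)
  have hshift : ∀ (F : ℕ → ℝ≥0∞) (N : ℕ), (∀ n < N, F n = 0) →
      ∑' n, F n = ∑' n, F (n + N) := by
    intro F N hF
    rw [← ENNReal.summable.sum_add_tsum_nat_add' (k := N),
      Finset.sum_eq_zero (fun i hi => hF i (Finset.mem_range.1 hi)), zero_add]
  rw [tsum_of_nat_of_neg_add_one ENNReal.summable ENNReal.summable, tailC,
    ENNReal.ofReal_add (hS.setIntegral_Ioi_nonneg (by linarith))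
      (hS.setIntegral_Ioi_nonneg (by linarith))]
  gcongr
  -- The integers are split into `n` and `-(n + 1)` with `n : ℕ`, so the cut-off `|k| ≤ K` removes
  -- `K + 1` terms from this half and `K` from the other. The surviving arguments have modulus at
  -- least `K - S + n` here and `K + n` there.
  · rw [hshift _ (K + 1) (fun n hn => if_pos (by rw [Finset.mem_Icc]; omega))]
    refine le_trans (ENNReal.tsum_le_tsum fun n => ?_) (hS.tsum_le_setIntegral (by linarith))
    rw [if_neg (by rw [Finset.mem_Icc]; omega)]
    refine (hS.enorm_le hg _).trans ?_
    have hn : (0 : ℝ) ≤ n := n.cast_nonneg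
    push_cast
    rw [abs_of_nonpos (by linarith)]
    exact hmono (by linarith) (by linarith)
  · rw [hshift _ K (fun n hn => if_pos (by rw [Finset.mem_Icc]; omega))]
    refine le_trans (ENNReal.tsum_le_tsum fun n => ?_) (hS.tsum_le_setIntegral (by linarith))
    rw [if_neg (by rw [Finset.mem_Icc]; omega)]
    refine (hS.enorm_le hg _).trans ?_
    have hn : (0 : ℝ) ≤ n := n.cast_nonneg
    push_cast
    rw [abs_of_nonneg (by linarith)]
    exact hmono (by linarith) (by linarith)

theorem tendsto_tailC (hS : AssumptionS g Φ) (S : ℝ) :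
    Tendsto (fun K : ℕ => tailC Φ S K) atTop (𝓝 0) := by
  have hI := hS.integrableOn_Ioi (a := 0) le_rfl
  have key : ∀ b : ℝ, Tendsto (fun K : ℕ => ∫ t in Set.Ioi ((K : ℝ) - b), Φ t) atTop (𝓝 0) := by
    intro b
    have h1 : Tendsto (fun r : ℝ => ∫ t in Set.Ioi r, Φ t) atTop (𝓝 0) := by
      have h2 := intervalIntegral_tendsto_integral_Ioi 0 hI tendsto_id
      have h3 : Tendsto (fun r : ℝ => (∫ t in Set.Ioi 0, Φ t) - ∫ t in (0 : ℝ)..r, Φ t) atTop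
          (𝓝 0) := by simpa using h2.const_sub (∫ t in Set.Ioi 0, Φ t)
      refine h3.congr' ?_
      filter_upwards [eventually_ge_atTop 0] with r hr
      rw [intervalIntegral.integral_of_le hr, ← Set.Ioc_union_Ioi_eq_Ioi hr,
        setIntegral_union (Set.Ioc_disjoint_Ioi le_rfl) measurableSet_Ioi
          (hI.mono_set fun x hx => hx.1) (hS.integrableOn_Ioi hr)]
      ring
    exact h1.comp (tendsto_atTop_add_const_right _ (-b) tendsto_natCast_atTop_atTop)
  have := (key (S + 1)).add (key 1)
  simpa [tailC, sub_sub] using this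

/-- Off-diagonal decay of the kernel built from the integer translates. -/
theorem tsum_kernel_le (hS : AssumptionS g Φ) (hg : Continuous g) (x y : ℝ) :
    ∑' k : ℤ, ‖g (x - k)‖ₑ * ‖g (y - k)‖ₑ ≤
      ENNReal.ofReal (2 * constC Φ * Φ (|x - y| / 2)) := by
  have h0 : 0 ≤ |x - y| / 2 := by positivity
  have hΦ := hS.nonneg h0
  have hmono : ∀ {u v : ℝ}, 0 ≤ u → u ≤ v → ENNReal.ofReal (Φ v) ≤ ENNReal.ofReal (Φ u) :=
    fun hu huv => ENNReal.ofReal_le_ofReal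
      (hS.antitoneOn (Set.mem_Ici.2 hu) (Set.mem_Ici.2 (hu.trans huv)) huv)
  have hterm : ∀ k : ℤ, ‖g (x - k)‖ₑ * ‖g (y - k)‖ₑ ≤
      ENNReal.ofReal (Φ (|x - y| / 2)) * (‖g (x - k)‖ₑ + ‖g (y - k)‖ₑ) := by
    intro k
    -- At least one of `x`, `y` is at distance `|x - y| / 2` or more from `k`; that factor supplies
    -- the decay, and the other is kept for the sum over `k`.
    have htri : |x - y| ≤ |x - k| + |y - k| := by
      have := abs_sub (x - k) (y - k)
      rwa [show x - k - (y - k) = x - y by ring] at this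
    rcases le_total (|x - y| / 2) |x - k| with h | h
    · calc ‖g (x - k)‖ₑ * ‖g (y - k)‖ₑ
          ≤ ENNReal.ofReal (Φ (|x - y| / 2)) * ‖g (y - k)‖ₑ := by
            gcongr; exact (hS.enorm_le hg _).trans (hmono h0 h)
        _ ≤ _ := by gcongr; exact le_add_self
    · have h' : |x - y| / 2 ≤ |y - k| := by linarith
      calc ‖g (x - k)‖ₑ * ‖g (y - k)‖ₑ
          ≤ ‖g (x - k)‖ₑ * ENNReal.ofReal (Φ (|x - y| / 2)) := by
            gcongr; exact (hS.enorm_le hg _).trans (hmono h0 h')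
        _ ≤ _ := by rw [mul_comm]; gcongr; exact le_self_add
  refine (ENNReal.tsum_le_tsum hterm).trans ?_
  rw [ENNReal.tsum_mul_left, ENNReal.tsum_add]
  calc _ ≤ ENNReal.ofReal (Φ (|x - y| / 2)) *
        (ENNReal.ofReal (constC Φ) + ENNReal.ofReal (constC Φ)) := by
        gcongr <;> exact hS.tsum_enorm_le hg _
    _ = _ := by
      rw [← ENNReal.ofReal_add hS.constC_nonneg hS.constC_nonneg, ← ENNReal.ofReal_mul hΦ]
      congr 1; ring

theorem summable_norm (hS : AssumptionS g Φ) (hg : Continuous g) (x : ℝ) :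
    Summable fun k : ℤ => ‖g (x - k)‖ := by
  have h := (hS.tsum_enorm_le hg x).trans_lt ENNReal.ofReal_lt_top
  have h2 := ENNReal.summable_toReal h.ne
  simpa using h2

end AssumptionS

end SubGaussWavelet

namespace SubGaussWavelet

open scoped FourierTransform ComplexConjugate Convolution

/-! ### Fourier transforms: correlation, periodization -/

/-- Passage from angular frequency to the normalization of `𝓕`. From here on the mask is the
1-periodic function `w ↦ m₀ (2πw)` and the translates in frequency are by integers. -/
theorem fourier_two_pi_mul (g : ℝ → ℂ) (w : ℝ) : fourier g (2 * Real.pi * w) = 𝓕 g w := by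
  rw [Real.fourier_real_eq_integral_exp_smul, fourier]
  congr 1 with x
  rw [smul_eq_mul]
  congr 2
  push_cast
  ring

theorem continuous_fourierTransform {g : ℝ → ℂ} (hg : Integrable g) : Continuous (𝓕 g) :=
  VectorFourier.fourierIntegral_continuous Real.continuous_fourierChar
    (by fun_prop) hg

theorem fourierTransform_conj_neg (b : ℝ → ℂ) (w : ℝ) :
    𝓕 (fun x => conj (b (-x))) w = conj (𝓕 b w) := by
  rw [Real.fourier_real_eq_integral_exp_smul, Real.fourier_real_eq_integral_exp_smul,
    ← integral_conj, ← integral_neg_eq_self]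
  congr 1 with x
  simp only [neg_neg, smul_eq_mul, map_mul, ← Complex.exp_conj, Complex.conj_I,
    Complex.conj_ofReal]
  congr 2
  push_cast
  ring

/-- Parseval's identity for the correlation of two functions. -/
theorem integral_mul_conj_translate {a b : ℝ → ℂ} (ha : Integrable a) (hb : Integrable b)
    (hbc : Continuous b) {B : ℝ} (hbB : ∀ x, ‖b x‖ ≤ B)
    (hInt : Integrable fun w => 𝓕 a w * conj (𝓕 b w)) (x : ℝ) :
    ∫ z, a z * conj (b (z - x)) =
      ∫ w : ℝ, Complex.exp (2 * Real.pi * Complex.I * (w * x)) * (𝓕 a w * conj (𝓕 b w)) := by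
  set b' : ℝ → ℂ := fun y => conj (b (-y)) with hb'
  have hb'c : Continuous b' := Complex.continuous_conj.comp (hbc.comp continuous_neg)
  have hb'i : Integrable b' :=
    hb.comp_neg.norm.mono' hb'c.aestronglyMeasurable (by simp [hb'])
  -- The correlation is the convolution of `a` with the reflected conjugate of `b`. Since `b` is
  -- bounded and continuous, `u` is continuous, so Fourier inversion holds at every point and not
  -- only almost everywhere.
  set u : ℝ → ℂ := a ⋆[ContinuousLinearMap.mul ℂ ℂ] b' with hu
  have huF : 𝓕 u = fun w => 𝓕 a w * conj (𝓕 b w) := by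
    ext w
    rw [hu, Real.fourier_mul_convolution_eq ha hb'i, hb', fourierTransform_conj_neg]
  have huc : Continuous u := by
    refine BddAbove.continuous_convolution_right_of_integrable _ ⟨B, ?_⟩ ha hb'c
    rintro _ ⟨y, rfl⟩
    simpa [hb'] using hbB (-y)
  have hui : Integrable u := ha.integrable_convolution _ hb'i
  have hinv := congrFun (huc.fourierInv_fourier_eq hui (by rw [huF]; exact hInt)) x
  have hux : u x = ∫ z, a z * conj (b (z - x)) := by
    rw [hu, convolution_def]
    congr 1 with z
    simp [hb']
  rw [← hux, ← hinv, Real.fourierInv_eq', huF]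
  congr 1 with w
  rw [smul_eq_mul]
  congr 2
  simp
  ring

theorem lintegral_eq_lintegral_periodization {G : ℝ → ℝ≥0∞} (hG : Measurable G) :
    ∫⁻ w, G w = ∫⁻ w in Set.Ioc (0 : ℝ) 1, ∑' k : ℤ, G (w + k) := by
  rw [lintegral_tsum (f := fun (k : ℤ) w => G (w + k))
      (fun k => (hG.comp (measurable_add_const (k : ℝ))).aemeasurable),
    ← setLIntegral_univ, ← iUnion_Ioc_intCast ℝ,
    lintegral_iUnion (fun _ => measurableSet_Ioc) (Set.pairwise_disjoint_Ioc_intCast ℝ)]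
  congr 1 with k
  have h := (measurePreserving_add_right volume (k : ℝ)).setLIntegral_comp_preimage
    (s := Set.Ioc (k : ℝ) (k + 1)) measurableSet_Ioc hG
  rw [← h]
  congr 2
  ext x
  simp

theorem integral_eq_integral_periodization {G S : ℝ → ℂ} (hG : Integrable G)
    (hS : ∀ᵐ w : ℝ, HasSum (fun k : ℤ => G (w + k)) (S w)) :
    ∫ w, G w = ∫ w in (0 : ℝ)..1, S w := by
  have h1 := hG.hasSum_intervalIntegral_comp_add_int
  have h2 := hG.norm.hasSum_intervalIntegral_comp_add_int.summable
  simp_rw [intervalIntegral.integral_of_le zero_le_one] at h1 h2 ⊢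
  have h3 := hasSum_integral_of_summable_integral_norm
    (μ := volume.restrict (Set.Ioc (0 : ℝ) 1)) (F := fun (k : ℤ) w => G (w + k))
    (fun k => (hG.comp_add_right (k : ℝ)).integrableOn) h2
  rw [h1.unique h3]
  exact integral_congr_ae (ae_restrict_of_ae (hS.mono fun w hw => hw.tsum_eq))

theorem ae_comp_mul_left {p : ℝ → Prop} (h : ∀ᵐ y : ℝ, p y) {r : ℝ} (hr : r ≠ 0) :
    ∀ᵐ w : ℝ, p (r * w) := by
  have : Measure.QuasiMeasurePreserving (fun w : ℝ => r * w) volume volume :=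
    ⟨measurable_const_mul r, by
      rw [Real.map_volume_mul_left hr]
      exact Measure.smul_absolutelyContinuous⟩
  exact this.ae h

theorem ae_comp_add_right {p : ℝ → Prop} (h : ∀ᵐ y : ℝ, p y) (r : ℝ) : ∀ᵐ w : ℝ, p (w + r) :=
  (measurePreserving_add_right volume r).quasiMeasurePreserving.ae h

theorem norm_exp_two_pi_mul (w x : ℝ) :
    ‖Complex.exp (2 * Real.pi * Complex.I * (w * x))‖ = 1 := by
  rw [show (2 * Real.pi * Complex.I * (w * x) : ℂ) =
    ((2 * Real.pi * (w * x) : ℝ) : ℂ) * Complex.I by push_cast; ring]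
  exact Complex.norm_exp_ofReal_mul_I _

theorem exp_two_pi_mul_add_int (w : ℝ) (n k : ℤ) :
    Complex.exp (2 * Real.pi * Complex.I * (((w + n : ℝ) : ℂ) * k)) =
      Complex.exp (2 * Real.pi * Complex.I * (w * k)) := by
  have : (2 * Real.pi * Complex.I * (((w + n : ℝ) : ℂ) * k) : ℂ) =
      2 * Real.pi * Complex.I * (w * k) + ((n * k : ℤ) : ℂ) * (2 * Real.pi * Complex.I) := by
    push_cast; ring
  rw [this, Complex.exp_add, Complex.exp_int_mul_two_pi_mul_I, mul_one]

theorem integral_exp_int (k : ℤ) :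
    ∫ w in (0 : ℝ)..1, Complex.exp (2 * Real.pi * Complex.I * (w * k)) = if k = 0 then 1 else 0 := by
  split_ifs with hk
  · simp [hk]
  · have hc : (2 * Real.pi * Complex.I * k : ℂ) ≠ 0 := by simp [hk, Real.pi_ne_zero]
    have : ∀ w : ℝ, Complex.exp (2 * Real.pi * Complex.I * (w * k)) =
        Complex.exp ((2 * Real.pi * Complex.I * k) * w) := fun w => by congr 1; ring
    simp_rw [this]
    rw [integral_exp_mul_complex hc]
    have : Complex.exp (2 * Real.pi * Complex.I * k) = 1 := by
      rw [mul_comm]; exact Complex.exp_int_mul_two_pi_mul_I k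
    simp [this]

/-! ### The translates of the scaling function are orthonormal -/

section Scaling

variable {fw m₀ : ℝ → ℂ} {Φ : ℝ → ℝ}

theorem IsFWavelet.hasSum_sq (hfw : IsFWavelet fw m₀) :
    ∀ᵐ w : ℝ, HasSum (fun k : ℤ => ‖𝓕 fw (w + k)‖ ^ 2) 1 := by
  filter_upwards [ae_comp_mul_left hfw.sum_eq_one Real.two_pi_pos.ne'] with w hw
  simpa only [← mul_add, fourier_two_pi_mul] using hw

theorem IsFWavelet.refinement_unit (hfw : IsFWavelet fw m₀) :
    ∀ᵐ w : ℝ, 𝓕 fw (2 * w) = m₀ (2 * Real.pi * w) * 𝓕 fw w := by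
  filter_upwards [ae_comp_mul_left hfw.refinement (r := 2 * (2 * Real.pi)) (by positivity)]
    with w hw
  rwa [show 2 * (2 * Real.pi) * w / 2 = 2 * Real.pi * w by ring,
    show 2 * (2 * Real.pi) * w = 2 * Real.pi * (2 * w) by ring, fourier_two_pi_mul,
    fourier_two_pi_mul] at hw

/-- The periodization of `‖𝓕 fw‖ ^ 2` is a.e. equal to 1, so its integral over the line is that of 1
over a period. -/
theorem IsFWavelet.integrable_sq (hfw : IsFWavelet fw m₀) (hi : Integrable fw) :
    Integrable fun w => ‖𝓕 fw w‖ ^ 2 := by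
  have hc := continuous_fourierTransform hi
  refine ⟨(hc.norm.pow 2).aestronglyMeasurable, ?_⟩
  rw [HasFiniteIntegral, lintegral_eq_lintegral_periodization (by fun_prop)]
  have : ∀ᵐ w ∂(volume.restrict (Set.Ioc (0 : ℝ) 1)),
      ∑' k : ℤ, ‖‖𝓕 fw (w + k)‖ ^ 2‖ₑ = 1 := by
    refine ae_restrict_of_ae (hfw.hasSum_sq.mono fun w hw => ?_)
    have h : ∀ k : ℤ, ‖‖𝓕 fw (w + k)‖ ^ 2‖ₑ = ENNReal.ofReal (‖𝓕 fw (w + k)‖ ^ 2) :=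
      fun k => Real.enorm_of_nonneg (by positivity)
    simp_rw [h]
    rw [← ENNReal.ofReal_tsum_of_nonneg (fun _ => by positivity) hw.summable, hw.tsum_eq,
      ENNReal.ofReal_one]
  rw [lintegral_congr_ae this]
  simp

/-- By Parseval the correlation at an integer `k` is a Fourier coefficient of the periodization of
`‖𝓕 fw‖ ^ 2`, and this periodization is the constant 1. -/
theorem IsFWavelet.orthonormal (hfw : IsFWavelet fw m₀) (hS : AssumptionS fw Φ)
    (hc : Continuous fw) (k : ℤ) :
    ∫ z, fw z * conj (fw (z - k)) = if k = 0 then 1 else 0 := by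
  have hi := hS.integrable_self hc
  have hsq : ∀ w, 𝓕 fw w * conj (𝓕 fw w) = ((‖𝓕 fw w‖ ^ 2 : ℝ) : ℂ) := fun w => by
    rw [Complex.mul_conj, Complex.normSq_eq_norm_sq]
  have hInt : Integrable fun w => 𝓕 fw w * conj (𝓕 fw w) := by
    simp_rw [hsq]
    exact (hfw.integrable_sq hi).ofReal
  rw [integral_mul_conj_translate hi hi hc (hS.norm_le_zero hc) hInt, ← integral_exp_int k]
  rw [integral_eq_integral_periodization
    (S := fun w => Complex.exp (2 * Real.pi * Complex.I * (w * k)))]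
  · exact (hInt.bdd_mul (by fun_prop) (Eventually.of_forall fun w => (norm_exp_two_pi_mul w k).le))
  · filter_upwards [hfw.hasSum_sq] with w hw
    simp_rw [hsq]
    have h1 : HasSum (fun n : ℤ => ((‖𝓕 fw (w + n)‖ ^ 2 : ℝ) : ℂ)) ((1 : ℝ) : ℂ) :=
      Complex.hasSum_ofReal.2 hw
    have h2 := h1.mul_left (Complex.exp (2 * Real.pi * Complex.I * (w * k)))
    simp only [Complex.ofReal_one, mul_one] at h2
    refine h2.congr_fun fun n => ?_
    simp only [Complex.ofReal_intCast, exp_two_pi_mul_add_int]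

end Scaling

end SubGaussWavelet

namespace SubGaussWavelet

open scoped FourierTransform ComplexConjugate

/-! ### The mask and the two-scale relations -/

/-- The coefficients of the two-scale relation. -/
noncomputable def maskCoeff (fw : ℝ → ℂ) (k : ℤ) : ℂ := ∫ z, fw z * conj (fw (2 * z - k))

/-- The trigonometric series `∑ d_k e^{-2πikw}`. -/
noncomputable def expSum (d : ℤ → ℂ) (w : ℝ) : ℂ :=
  ∑' k : ℤ, d k * conj (Complex.exp (2 * Real.pi * Complex.I * (w * k)))

/-- The function `x ↦ 2 ∑ d_k g(2x - k)`. -/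
noncomputable def twoScale (d : ℤ → ℂ) (g : ℝ → ℂ) (x : ℝ) : ℂ := 2 * ∑' k : ℤ, d k * g (2 * x - k)

theorem norm_exp_two_pi_mul_int (w : ℝ) (k : ℤ) :
    ‖Complex.exp (2 * Real.pi * Complex.I * (w * k))‖ = 1 := by
  simpa using norm_exp_two_pi_mul w k

theorem continuous_expSum {d : ℤ → ℂ} (hd : Summable fun k => ‖d k‖) : Continuous (expSum d) := by
  refine continuous_tsum (fun k => ?_) hd fun k w => ?_
  · exact continuous_const.mul (Complex.continuous_conj.comp (by fun_prop))
  · simp [norm_exp_two_pi_mul_int]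

theorem hasSum_expSum {d : ℤ → ℂ} (hd : Summable fun k => ‖d k‖) (w : ℝ) :
    HasSum (fun k : ℤ => d k * conj (Complex.exp (2 * Real.pi * Complex.I * (w * k))))
      (expSum d w) := by
  refine (Summable.of_norm ?_).hasSum
  simpa [norm_exp_two_pi_mul_int] using hd

theorem expSum_add_int (d : ℤ → ℂ) (w : ℝ) (n : ℤ) : expSum d (w + n) = expSum d w := by
  simp only [expSum, exp_two_pi_mul_add_int]

theorem integral_exp_mul_expSum {d : ℤ → ℂ} (hd : Summable fun k => ‖d k‖) (k : ℤ) :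
    ∫ w in (0 : ℝ)..1, Complex.exp (2 * Real.pi * Complex.I * (w * k)) * expSum d w = d k := by
  rw [intervalIntegral.integral_of_le zero_le_one]
  have hcont : ∀ j : ℤ, Continuous fun w : ℝ => Complex.exp (2 * Real.pi * Complex.I * (w * k)) *
      (d j * conj (Complex.exp (2 * Real.pi * Complex.I * (w * j)))) := fun j =>
    Continuous.mul (by fun_prop) (continuous_const.mul (Complex.continuous_conj.comp (by fun_prop)))
  have hs := hasSum_integral_of_summable_integral_norm
    (μ := volume.restrict (Set.Ioc (0 : ℝ) 1))
    (F := fun (j : ℤ) w => Complex.exp (2 * Real.pi * Complex.I * (w * k)) *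
      (d j * conj (Complex.exp (2 * Real.pi * Complex.I * (w * j)))))
    (fun j => (hcont j).integrableOn_Ioc)
    (by simpa [norm_exp_two_pi_mul_int] using hd)
  have h1 : ∀ w : ℝ, ∑' j : ℤ, Complex.exp (2 * Real.pi * Complex.I * (w * k)) *
      (d j * conj (Complex.exp (2 * Real.pi * Complex.I * (w * j)))) =
      Complex.exp (2 * Real.pi * Complex.I * (w * k)) * expSum d w := fun w => by
    rw [tsum_mul_left, expSum]
  simp_rw [h1] at hs
  refine hs.unique ?_
  have h2 : ∀ j : ℤ, ∫ w in Set.Ioc (0 : ℝ) 1, Complex.exp (2 * Real.pi * Complex.I * (w * k)) *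
      (d j * conj (Complex.exp (2 * Real.pi * Complex.I * (w * j)))) =
      if j = k then d k else 0 := fun j => by
    have h3 : ∀ w : ℝ, Complex.exp (2 * Real.pi * Complex.I * (w * k)) *
      (d j * conj (Complex.exp (2 * Real.pi * Complex.I * (w * j)))) =
        d j * Complex.exp (2 * Real.pi * Complex.I * (w * ((k - j : ℤ) : ℂ))) := fun w => by
      rw [← Complex.exp_conj, mul_left_comm, ← Complex.exp_add]
      congr 2
      simp only [map_mul, Complex.conj_ofReal, Complex.conj_I, map_ofNat, map_intCast]
      push_cast
      ring
    simp_rw [h3]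
    rw [integral_const_mul, ← intervalIntegral.integral_of_le zero_le_one, integral_exp_int]
    by_cases hjk : j = k
    · simp [hjk]
    · rw [if_neg (by omega), if_neg hjk, mul_zero]
  simp_rw [h2]
  exact hasSum_ite_eq k (d k)

/-- A bounded `1`-periodic function is determined a.e. by its Fourier coefficients. -/
theorem ae_eq_expSum {μ : ℝ → ℂ} {d : ℤ → ℂ} (hd : Summable fun k => ‖d k‖)
    (hm : AEStronglyMeasurable μ volume) {B : ℝ} (hB : ∀ᵐ w : ℝ, ‖μ w‖ ≤ B)
    (hper : ∀ (w : ℝ) (n : ℤ), μ (w + n) = μ w)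
    (hco : ∀ k : ℤ, ∫ w in (0 : ℝ)..1, Complex.exp (2 * Real.pi * Complex.I * (w * k)) * μ w =
      d k) :
    ∀ᵐ w : ℝ, μ w = expSum d w := by
  have hE := continuous_expSum hd
  have hEB : ∀ w, ‖expSum d w‖ ≤ ∑' k, ‖d k‖ := fun w => by
    refine (norm_tsum_le_tsum_norm ?_).trans_eq ?_ <;> simp [norm_exp_two_pi_mul_int, hd]
  set D : ℝ → ℂ := fun w => μ w - expSum d w with hD
  have hDm : AEStronglyMeasurable D volume := hm.sub hE.aestronglyMeasurable
  have hμL : MemLp μ 2 (volume.restrict (Set.Ioc (0 : ℝ) 1)) :=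
    MemLp.of_bound hm.restrict B (ae_restrict_of_ae hB)
  have hEL : MemLp (expSum d) 2 (volume.restrict (Set.Ioc (0 : ℝ) 1)) :=
    MemLp.of_bound hE.aestronglyMeasurable.restrict _ (Eventually.of_forall hEB)
  have hDL : MemLp D 2 (volume.restrict (Set.Ioc (0 : ℝ) 1)) := hμL.sub hEL
  have hexpc : ∀ k : ℤ, Continuous fun w : ℝ =>
      Complex.exp (2 * Real.pi * Complex.I * (w * k)) := fun k => by fun_prop
  have hInt : ∀ (k : ℤ) {v : ℝ → ℂ}, MemLp v 2 (volume.restrict (Set.Ioc (0 : ℝ) 1)) →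
      IntervalIntegrable (fun w : ℝ => Complex.exp (2 * Real.pi * Complex.I * (w * k)) * v w)
        volume 0 1 := fun k v hv => by
    rw [intervalIntegrable_iff_integrableOn_Ioc_of_le zero_le_one]
    exact (hv.integrable one_le_two).bdd_mul (hexpc k).aestronglyMeasurable
      (Eventually.of_forall fun w => (norm_exp_two_pi_mul_int w k).le)
  have hcoeff : ∀ k : ℤ, fourierCoeffOn (zero_lt_one' ℝ) D k = 0 := fun k => by
    rw [fourierCoeffOn_eq_integral]
    have h1 : ∀ w : ℝ, _root_.fourier (-k) (w : AddCircle ((1 : ℝ) - 0)) • D w =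
        Complex.exp (2 * Real.pi * Complex.I * (w * ((-k : ℤ) : ℂ))) * μ w -
        Complex.exp (2 * Real.pi * Complex.I * (w * ((-k : ℤ) : ℂ))) * expSum d w := fun w => by
      rw [fourier_coe_apply, smul_eq_mul, hD, mul_sub]
      congr 3 <;> · push_cast; ring
    simp_rw [h1]
    rw [intervalIntegral.integral_sub (hInt _ hμL) (hInt _ hEL), hco,
      integral_exp_mul_expSum hd, sub_self, smul_zero]
  -- Parseval on one period: all Fourier coefficients of the difference vanish, so its `L_2` norm
  -- does. Periodicity then carries the equality to the whole line.
  have hz := hasSum_sq_fourierCoeffOn (zero_lt_one' ℝ) hDL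
  simp only [hcoeff, norm_zero, ne_eq, OfNat.ofNat_ne_zero, not_false_eq_true, zero_pow, sub_zero,
    inv_one, one_smul] at hz
  have hz0 : ∫ w in Set.Ioc (0 : ℝ) 1, ‖D w‖ ^ 2 = 0 := by
    rw [← intervalIntegral.integral_of_le zero_le_one]
    exact hz.unique hasSum_zero
  rw [integral_eq_zero_iff_of_nonneg (fun _ => by positivity) hDL.norm.integrable_sq] at hz0
  have hae : ∀ᵐ w : ℝ, w ∈ Set.Ioc (0 : ℝ) 1 → D w = 0 := by
    rw [EventuallyEq, ae_restrict_iff' measurableSet_Ioc] at hz0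
    filter_upwards [hz0] with w hw hw'
    simpa using hw hw'
  have hall : ∀ᵐ w : ℝ, ∀ n : ℤ, w + n ∈ Set.Ioc (0 : ℝ) 1 → D (w + n) = 0 :=
    ae_all_iff.2 fun n => ae_comp_add_right hae n
  filter_upwards [hall] with w hw
  obtain ⟨n, hn⟩ : ∃ n : ℤ, w ∈ Set.Ioc (n : ℝ) (n + 1) := by
    have : w ∈ ⋃ n : ℤ, Set.Ioc (n : ℝ) (n + 1) := by rw [iUnion_Ioc_intCast]; trivial
    simpa using this
  have h := hw (-n) (by push_cast; exact ⟨by linarith [hn.1], by linarith [hn.2]⟩)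
  rw [hD] at h
  simp only [hper, expSum_add_int] at h
  exact sub_eq_zero.1 h

/-! ### Two-scale series and their Fourier transforms. -/

section TwoScale

variable {g : ℝ → ℂ} {d : ℤ → ℂ} {B : ℝ}

theorem continuous_twoScale (hd : Summable fun k => ‖d k‖) (hB : ∀ x, ‖g x‖ ≤ B)
    (hg : Continuous g) : Continuous (twoScale d g) := by
  refine continuous_const.mul (continuous_tsum (fun k => by fun_prop) (hd.mul_right B)
    fun k x => ?_)
  rw [norm_mul]; exact mul_le_mul_of_nonneg_left (hB _) (norm_nonneg _)

theorem integrable_comp_two_mul_sub (hi : Integrable g) (k : ℝ) :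
    Integrable fun x : ℝ => g (2 * x - k) :=
  (hi.comp_sub_right k).comp_mul_left' two_ne_zero

theorem integral_comp_two_mul_sub {E : Type*} [NormedAddCommGroup E] [NormedSpace ℝ E]
    (v : ℝ → E) (k : ℝ) : ∫ x : ℝ, v (2 * x - k) = (2 : ℝ)⁻¹ • ∫ x, v x := by
  have h := Measure.integral_comp_mul_left (fun y => v (y - k)) 2
  rw [h, integral_sub_right_eq_self v k]
  norm_num

theorem integrable_twoScale (hd : Summable fun k => ‖d k‖) (hB : ∀ x, ‖g x‖ ≤ B)
    (hg : Continuous g) (hi : Integrable g) : Integrable (twoScale d g) := by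
  refine ⟨(continuous_twoScale hd hB hg).aestronglyMeasurable, ?_⟩
  have hd' : ∑' k : ℤ, ‖d k‖ₑ ≠ ∞ := tsum_enorm_ne_top_iff_summable_norm.2 hd
  have hl : ∀ k : ℤ, ∫⁻ x : ℝ, ‖g (2 * x - k)‖ₑ = ∫⁻ x : ℝ, ‖g (2 * x)‖ₑ := fun k => by
    have := lintegral_sub_right_eq_self (μ := (volume : Measure ℝ))
      (fun x => ‖g (2 * x)‖ₑ) ((k : ℝ) / 2)
    rw [← this]
    congr 1 with x
    congr 2
    ring
  calc ∫⁻ x, ‖twoScale d g x‖ₑ ≤ ∫⁻ x, 2 * ∑' k : ℤ, ‖d k‖ₑ * ‖g (2 * x - k)‖ₑ := by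
        refine lintegral_mono fun x => ?_
        rw [twoScale, enorm_mul]
        gcongr
        · rw [← ofReal_norm]; simp
        · refine enorm_tsum_le_tsum_enorm.trans_eq ?_
          simp [enorm_mul]
    _ = 2 * ((∑' k : ℤ, ‖d k‖ₑ) * ∫⁻ x : ℝ, ‖g (2 * x)‖ₑ) := by
        have hgm := hg.measurable
        have hm : ∀ k : ℤ, Measurable fun x : ℝ => ‖d k‖ₑ * ‖g (2 * x - k)‖ₑ := fun k => by
          fun_prop
        rw [lintegral_const_mul _ (Measurable.tsum hm),
          lintegral_tsum fun k => (hm k).aemeasurable, ← ENNReal.tsum_mul_right]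
        congr 2 with k
        rw [lintegral_const_mul _ (by fun_prop), hl]
    _ < ∞ := by
        have := (integrable_comp_two_mul_sub hi 0).2
        rw [HasFiniteIntegral] at this
        simp only [sub_zero] at this
        exact ENNReal.mul_lt_top (by simp) (ENNReal.mul_lt_top hd'.lt_top this)

/-- Termwise transformation: a shift by `k` produces the exponential of `expSum`, and the factor 2
in `twoScale` cancels the Jacobian of `x ↦ 2x`. Absolute summability permits the interchange. -/
theorem fourierTransform_twoScale (hd : Summable fun k => ‖d k‖) (hi : Integrable g) (w : ℝ) :
    𝓕 (twoScale d g) (2 * w) = expSum d w * 𝓕 g w := by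
  have hE : ∀ x : ℝ, ‖Complex.exp (((-2 * Real.pi * x * (2 * w) : ℝ) : ℂ) * Complex.I)‖ = 1 :=
    fun x => Complex.norm_exp_ofReal_mul_I _
  rw [Real.fourier_real_eq_integral_exp_smul]
  have h1 : ∀ x : ℝ, Complex.exp (((-2 * Real.pi * x * (2 * w) : ℝ) : ℂ) * Complex.I) •
      twoScale d g x = ∑' k : ℤ, 2 * (Complex.exp (((-2 * Real.pi * x * (2 * w) : ℝ) : ℂ) *
        Complex.I) * (d k * g (2 * x - k))) := fun x => by
    rw [tsum_mul_left, tsum_mul_left, twoScale, smul_eq_mul]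
    ring
  simp_rw [h1]
  have hInt : ∀ k : ℤ, Integrable fun x : ℝ => 2 * (Complex.exp
      (((-2 * Real.pi * x * (2 * w) : ℝ) : ℂ) * Complex.I) * (d k * g (2 * x - k))) := fun k =>
    (((integrable_comp_two_mul_sub hi k).const_mul (d k)).bdd_mul (by fun_prop)
      (Eventually.of_forall fun x => (hE x).le)).const_mul 2
  have hk : ∀ k : ℤ, ∫ x : ℝ, 2 * (Complex.exp
      (((-2 * Real.pi * x * (2 * w) : ℝ) : ℂ) * Complex.I) * (d k * g (2 * x - k))) =
      d k * conj (Complex.exp (2 * Real.pi * Complex.I * (w * k))) * 𝓕 g w := fun k => by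
    have h2 : ∀ x : ℝ, 2 * (Complex.exp
      (((-2 * Real.pi * x * (2 * w) : ℝ) : ℂ) * Complex.I) * (d k * g (2 * x - k))) =
      (2 * (d k * conj (Complex.exp (2 * Real.pi * Complex.I * (w * k))))) *
        (fun y : ℝ => Complex.exp (((-2 * Real.pi * y * w : ℝ) : ℂ) * Complex.I) • g y)
          (2 * x - k) := fun x => by
      have h3 : Complex.exp (((-2 * Real.pi * x * (2 * w) : ℝ) : ℂ) * Complex.I) =
          conj (Complex.exp (2 * Real.pi * Complex.I * (w * k))) *
            Complex.exp (((-2 * Real.pi * (2 * x - k) * w : ℝ) : ℂ) * Complex.I) := by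
        rw [← Complex.exp_conj, ← Complex.exp_add]
        congr 1
        simp only [map_mul, Complex.conj_ofReal, Complex.conj_I, map_ofNat, map_intCast]
        push_cast
        ring
      simp only [smul_eq_mul, h3]
      ring
    simp_rw [h2]
    rw [integral_const_mul, integral_comp_two_mul_sub (fun y : ℝ =>
        Complex.exp (((-2 * Real.pi * y * w : ℝ) : ℂ) * Complex.I) • g y), ← Real.fourier_real_eq_integral_exp_smul,
      Complex.real_smul]
    push_cast
    ring
  have hs := hasSum_integral_of_summable_integral_norm hInt (by
    have h4 : ∀ k : ℤ, ∫ x : ℝ, ‖2 * (Complex.exp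
      (((-2 * Real.pi * x * (2 * w) : ℝ) : ℂ) * Complex.I) * (d k * g (2 * x - k)))‖ =
        ‖d k‖ * ∫ x, ‖g x‖ := fun k => by
      simp only [norm_mul, hE, one_mul, Complex.norm_ofNat]
      rw [integral_const_mul, integral_const_mul, integral_comp_two_mul_sub (fun y => ‖g y‖),
        smul_eq_mul]
      ring
    simp_rw [h4]
    exact hd.mul_right _)
  simp_rw [hk] at hs
  exact hs.unique ((hasSum_expSum hd w).mul_right _)

/-- A continuous integrable function is determined by its Fourier transform: two-scale form. -/
theorem eq_twoScale {v : ℝ → ℂ} (hv : Continuous v) (hvi : Integrable v)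
    (hd : Summable fun k => ‖d k‖) (hB : ∀ x, ‖g x‖ ≤ B) (hg : Continuous g)
    (hi : Integrable g) (h : ∀ᵐ w : ℝ, 𝓕 v (2 * w) = expSum d w * 𝓕 g w) (x : ℝ) :
    v x = twoScale d g x := by
  have hti := integrable_twoScale hd hB hg hi
  have htc := continuous_twoScale hd hB hg
  -- The transform of the difference vanishes a.e., hence everywhere by continuity; inversion for
  -- the continuous integrable difference gives equality at every point.
  have hae : ∀ᵐ w : ℝ, 𝓕 (fun x => v x - twoScale d g x) w = 0 := by
    have h' := ae_comp_mul_left h (r := 2⁻¹) (by norm_num)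
    filter_upwards [h'] with w hw
    have hw2 := fourierTransform_twoScale hd hi (2⁻¹ * w)
    rw [← hw, mul_inv_cancel_left₀ two_ne_zero] at hw2
    rw [Real.fourier_real_eq] at hw2 ⊢
    rw [Real.fourier_real_eq] at hw2
    simp_rw [smul_sub]
    have hconv : ∀ {u : ℝ → ℂ}, Integrable u →
        Integrable fun y : ℝ => Real.fourierChar (-(y * w)) • u y := fun hu => by
      simpa [mul_comm] using (Real.fourierIntegral_convergent_iff (V := ℝ) w).2 hu
    rw [integral_sub (hconv hvi) (hconv hti), hw2, sub_self]
  have hzero : 𝓕 (fun x => v x - twoScale d g x) = fun _ => 0 :=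
    (Continuous.ae_eq_iff_eq volume (continuous_fourierTransform (hvi.sub hti))
      continuous_const).1 hae
  have hinv := congrFun ((hv.sub htc).fourierInv_fourier_eq (hvi.sub hti)
    (by
      change Integrable (𝓕 (fun x => v x - twoScale d g x))
      rw [hzero]; exact integrable_zero _ _ _)) x
  change (FourierTransformInv.fourierInv (𝓕 (fun x => v x - twoScale d g x))) x =
    v x - twoScale d g x at hinv
  rw [hzero, Real.fourierInv_eq] at hinv
  simp only [smul_zero, integral_zero] at hinv
  exact sub_eq_zero.1 hinv.symm

end TwoScale

end SubGaussWavelet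

namespace SubGaussWavelet

open scoped FourierTransform ComplexConjugate

/-! ### The mask as an absolutely convergent series; the two-scale relations of both wavelets. -/

section Mask

variable {fw m₀ mw : ℝ → ℂ} {Φ : ℝ → ℝ}

/-- Tonelli and the uniform bound `constC` on sums of translates. The scale `r = 2` serves the mask
coefficients, `r = 1` the integral of the periodization. -/
theorem lintegral_mul_tsum_lt_top {v : ℝ → ℂ} (hv : Continuous v) (hvi : Integrable v)
    (hS : AssumptionS fw Φ) (hc : Continuous fw) (r : ℝ) :
    ∑' k : ℤ, ∫⁻ z : ℝ, ‖v z * conj (fw (r * z - k))‖ₑ < ∞ := by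
  have hm : ∀ k : ℤ, AEMeasurable (fun z : ℝ => ‖v z * conj (fw (r * z - k))‖ₑ) := fun k =>
    (hv.mul (Complex.continuous_conj.comp (hc.comp (by fun_prop)))).enorm.measurable.aemeasurable
  rw [← lintegral_tsum hm]
  calc ∫⁻ z : ℝ, ∑' k : ℤ, ‖v z * conj (fw (r * z - k))‖ₑ
      ≤ ∫⁻ z : ℝ, ‖v z‖ₑ * ENNReal.ofReal (constC Φ) := by
        refine lintegral_mono fun z => ?_
        have h : ∀ k : ℤ, ‖v z * conj (fw (r * z - k))‖ₑ = ‖v z‖ₑ * ‖fw (r * z - k)‖ₑ := fun k => by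
          rw [enorm_mul]
          congr 1
          rw [← ofReal_norm, ← ofReal_norm, RCLike.norm_conj]
        simp_rw [h, ENNReal.tsum_mul_left]
        gcongr
        exact hS.tsum_enorm_le hc _
    _ = (∫⁻ z : ℝ, ‖v z‖ₑ) * ENNReal.ofReal (constC Φ) :=
        lintegral_mul_const _ hv.enorm.measurable
    _ < ∞ := ENNReal.mul_lt_top hvi.2 ENNReal.ofReal_lt_top

/-- This absolute summability is what justifies the rearrangements of filter series below. -/
theorem summable_maskCoeff (hS : AssumptionS fw Φ) (hc : Continuous fw) :
    Summable fun k => ‖maskCoeff fw k‖ := by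
  refine tsum_enorm_ne_top_iff_summable_norm.1 (ne_top_of_le_ne_top
    (lintegral_mul_tsum_lt_top hc (hS.integrable_self hc) hS hc 2).ne
    (ENNReal.tsum_le_tsum fun k => ?_))
  exact enorm_integral_le_lintegral_enorm _

theorem fourierTransform_half (g : ℝ → ℂ) (w : ℝ) :
    𝓕 (fun z => 2⁻¹ * g (z / 2)) w = 𝓕 g (2 * w) := by
  rw [Real.fourier_real_eq_integral_exp_smul, Real.fourier_real_eq_integral_exp_smul]
  have h := Measure.integral_comp_div
    (fun z : ℝ => Complex.exp (((-2 * Real.pi * z * (2 * w) : ℝ) : ℂ) * Complex.I) • g z) 2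
  have h2 : ∀ z : ℝ, Complex.exp (((-2 * Real.pi * z * w : ℝ) : ℂ) * Complex.I) •
      (2⁻¹ * g (z / 2)) = 2⁻¹ * (Complex.exp
        (((-2 * Real.pi * (z / 2) * (2 * w) : ℝ) : ℂ) * Complex.I) • g (z / 2)) := fun z => by
    rw [show -2 * Real.pi * (z / 2) * (2 * w) = -2 * Real.pi * z * w by ring, smul_eq_mul,
      smul_eq_mul]
    ring
  simp_rw [h2]
  rw [integral_const_mul, h]
  simp

/-- In the refinement equation at `w + k` the mask is independent of `k` by periodicity; multiplying
by `conj (𝓕 fw (w + k))` and summing isolates it, because the squares sum to 1. -/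
theorem IsFWavelet.hasSum_mask (hfw : IsFWavelet fw m₀) :
    ∀ᵐ w : ℝ, HasSum (fun k : ℤ => 𝓕 fw (2 * (w + k)) * conj (𝓕 fw (w + k)))
      (m₀ (2 * Real.pi * w)) := by
  have hall : ∀ᵐ w : ℝ, ∀ k : ℤ, 𝓕 fw (2 * (w + k)) = m₀ (2 * Real.pi * (w + k)) * 𝓕 fw (w + k) :=
    ae_all_iff.2 fun k => ae_comp_add_right hfw.refinement_unit k
  filter_upwards [hall, hfw.hasSum_sq] with w hw hs
  have h1 : HasSum (fun n : ℤ => ((‖𝓕 fw (w + n)‖ ^ 2 : ℝ) : ℂ)) ((1 : ℝ) : ℂ) :=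
    Complex.hasSum_ofReal.2 hs
  have h2 := h1.mul_left (m₀ (2 * Real.pi * w))
  rw [Complex.ofReal_one, mul_one] at h2
  refine h2.congr_fun fun k => ?_
  have hper : m₀ (2 * Real.pi * (w + k)) = m₀ (2 * Real.pi * w) := by
    have := (hfw.mask_periodic.int_mul k) (2 * Real.pi * w)
    rw [← this]
    congr 1
    ring
  rw [hw k, hper, mul_assoc, Complex.mul_conj, Complex.normSq_eq_norm_sq]

/-- Summing the squared refinement equation gives `|m₀|²` as the sum of `‖𝓕 fw (2w + 2k)‖ ^ 2`,
which consists of the even terms of a series with sum 1. -/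
theorem IsFWavelet.norm_mask_le (hfw : IsFWavelet fw m₀) :
    ∀ᵐ w : ℝ, ‖m₀ (2 * Real.pi * w)‖ ≤ 1 := by
  have hall : ∀ᵐ w : ℝ, ∀ k : ℤ, 𝓕 fw (2 * (w + k)) = m₀ (2 * Real.pi * (w + k)) * 𝓕 fw (w + k) :=
    ae_all_iff.2 fun k => ae_comp_add_right hfw.refinement_unit k
  filter_upwards [hall, hfw.hasSum_sq, ae_comp_mul_left hfw.hasSum_sq two_ne_zero] with w hw hs hs2
  have h2 := hs.mul_left (‖m₀ (2 * Real.pi * w)‖ ^ 2)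
  rw [mul_one] at h2
  have hle : ‖m₀ (2 * Real.pi * w)‖ ^ 2 ≤ 1 := by
    have hinj : Function.Injective fun k : ℤ => 2 * k := fun a b h => by simpa using h
    have hsub := hs2.summable.comp_injective hinj
    rw [← h2.tsum_eq, ← hs2.tsum_eq]
    refine le_trans (le_of_eq ?_) (tsum_comp_le_tsum_of_inj hs2.summable
      (fun _ => by positivity) hinj)
    congr 1 with k
    have hper : m₀ (2 * Real.pi * (w + k)) = m₀ (2 * Real.pi * w) := by
      have := (hfw.mask_periodic.int_mul k) (2 * Real.pi * w)
      rw [← this]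
      congr 1
      ring
    have := hw k
    rw [hper] at this
    simp only [Function.comp_apply]
    rw [← mul_pow, ← norm_mul, ← this]
    push_cast
    rw [mul_add]
  nlinarith [norm_nonneg (m₀ (2 * Real.pi * w))]

/-- The mask is the periodization of `𝓕 fw (2w) * conj (𝓕 fw w)`. By Parseval its Fourier
coefficients are the correlations of `z ↦ fw (z/2) / 2` with `fw`, which become `maskCoeff` after
rescaling `z`. -/
theorem IsFWavelet.mask_eq (hfw : IsFWavelet fw m₀) (hS : AssumptionS fw Φ)
    (hc : Continuous fw) :
    ∀ᵐ w : ℝ, m₀ (2 * Real.pi * w) = expSum (maskCoeff fw) w := by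
  have hi := hS.integrable_self hc
  have hF := continuous_fourierTransform hi
  have hGc : Continuous fun w => 𝓕 fw (2 * w) * conj (𝓕 fw w) :=
    (hF.comp (by fun_prop)).mul (Complex.continuous_conj.comp hF)
  have hGi : Integrable fun w => 𝓕 fw (2 * w) * conj (𝓕 fw w) := by
    have h1 := hfw.integrable_sq hi
    have h2 : Integrable fun w : ℝ => ‖𝓕 fw (2 * w)‖ ^ 2 := h1.comp_mul_left' two_ne_zero
    refine (h2.add h1).mono' hGc.aestronglyMeasurable (Eventually.of_forall fun w => ?_)
    rw [norm_mul, RCLike.norm_conj]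
    simp only [Pi.add_apply]
    nlinarith [sq_nonneg (‖𝓕 fw (2 * w)‖ - ‖𝓕 fw w‖), sq_nonneg (‖𝓕 fw (2 * w)‖),
      sq_nonneg (‖𝓕 fw w‖)]
  refine ae_eq_expSum (summable_maskCoeff hS hc) ?_ hfw.norm_mask_le (fun w n => ?_) fun k => ?_
  -- Measurability on the whole line comes from the periodization: the mask is an a.e. limit of
  -- continuous partial sums.
  · refine aestronglyMeasurable_of_tendsto_ae (u := (atTop : Filter (Finset ℤ)))
      (f := fun s w => ∑ k ∈ s, 𝓕 fw (2 * (w + k)) * conj (𝓕 fw (w + k))) (fun s => ?_) ?_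
    · refine (continuous_finsetSum _ fun k _ => ?_).aestronglyMeasurable
      exact hGc.comp (continuous_add_const (k : ℝ))
    · exact hfw.hasSum_mask
  · have := (hfw.mask_periodic.int_mul n) (2 * Real.pi * w)
    rw [← this]
    congr 1
    ring
  · have hhi : Integrable fun z => (2⁻¹ : ℂ) * fw (z / 2) :=
      (hi.comp_div two_ne_zero).const_mul _
    have hp := integral_mul_conj_translate hhi hi hc (hS.norm_le_zero hc)
      (by simpa only [fourierTransform_half] using hGi) k
    simp only [fourierTransform_half] at hp
    have hleft : ∫ z : ℝ, 2⁻¹ * fw (z / 2) * conj (fw (z - k)) = maskCoeff fw k := by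
      have h := Measure.integral_comp_div (fun z : ℝ => fw z * conj (fw (2 * z - k))) 2
      simp_rw [mul_assoc]
      rw [integral_const_mul]
      have h3 : ∀ z : ℝ, 2 * (z / 2) = z := fun z => by ring
      simp only [h3] at h
      rw [h, maskCoeff]
      simp
    rw [← hleft, hp]
    symm
    refine integral_eq_integral_periodization ?_ ?_
    · exact hGi.bdd_mul (by fun_prop) (Eventually.of_forall fun w => (norm_exp_two_pi_mul w k).le)
    · filter_upwards [hfw.hasSum_mask] with w hw
      refine (hw.mul_left (Complex.exp (2 * Real.pi * Complex.I * (w * k)))).congr_fun fun n => ?_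
      simp only [Complex.ofReal_intCast, exp_two_pi_mul_add_int]

/-- The two-scale relation of the scaling function. -/
theorem IsFWavelet.two_scale (hfw : IsFWavelet fw m₀) (hS : AssumptionS fw Φ)
    (hc : Continuous fw) (x : ℝ) : fw x = twoScale (maskCoeff fw) fw x := by
  have hi := hS.integrable_self hc
  refine eq_twoScale hc hi (summable_maskCoeff hS hc) (hS.norm_le_zero hc) hc hi ?_ x
  filter_upwards [hfw.refinement_unit, hfw.mask_eq hS hc] with w h1 h2
  rw [h1, h2]

/-- The coefficients of the wavelet in terms of the scaling function. -/
noncomputable def waveCoeff (h : ℤ → ℂ) (k : ℤ) : ℂ := (-1) ^ (1 - k) * conj (h (1 - k))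

theorem norm_waveCoeff (h : ℤ → ℂ) (k : ℤ) : ‖waveCoeff h k‖ = ‖h (1 - k)‖ := by
  simp [waveCoeff]

theorem summable_waveCoeff {h : ℤ → ℂ} (hh : Summable fun k => ‖h k‖) :
    Summable fun k => ‖waveCoeff h k‖ := by
  simp_rw [norm_waveCoeff]
  exact (Equiv.subLeft (1 : ℤ)).summable_iff.2 hh

/-- Reindex by `k ↦ 1 - k`. The sign `(-1)^k = e^{iπk}` is the half-period shift, and the 1 in `1 -
k` produces the factor `e^{-2πiw}`, as in the definition of the m-wavelet. -/
theorem expSum_waveCoeff (h : ℤ → ℂ) (w : ℝ) :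
    expSum (waveCoeff h) w = conj (expSum h (w + 1 / 2)) *
      Complex.exp (-(2 * Real.pi * Complex.I * w)) := by
  rw [expSum, expSum, Complex.conj_tsum, ← tsum_mul_right, ← (Equiv.subLeft (1 : ℤ)).tsum_eq]
  congr 1 with k
  simp only [Equiv.subLeft_apply, waveCoeff, sub_sub_cancel, map_mul, Complex.conj_conj]
  have hneg : (-1 : ℂ) ^ k = Complex.exp (Real.pi * Complex.I * k) := by
    rw [mul_comm, Complex.exp_int_mul, Complex.exp_pi_mul_I]
  rw [hneg, ← Complex.exp_conj, mul_comm (Complex.exp (Real.pi * Complex.I * k)), mul_assoc,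
    ← Complex.exp_add, mul_assoc (conj (h k)), ← Complex.exp_add]
  congr 2
  simp only [map_mul, Complex.conj_ofReal, Complex.conj_I, map_ofNat, map_intCast]
  push_cast
  ring

/-- The two-scale relation of the wavelet. -/
theorem IsMWavelet.two_scale (hfw : IsFWavelet fw m₀) (hmw : IsMWavelet fw m₀ mw)
    (hmc : Continuous mw) (hS : AssumptionS fw Φ) (hc : Continuous fw) (x : ℝ) :
    mw x = twoScale (waveCoeff (maskCoeff fw)) fw x := by
  have hi := hS.integrable_self hc
  refine eq_twoScale hmc hmw.1 (summable_waveCoeff (summable_maskCoeff hS hc))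
    (hS.norm_le_zero hc) hc hi ?_ x
  filter_upwards [ae_comp_add_right (hfw.mask_eq hS hc) (1 / 2),
    ae_comp_mul_left hmw.2 (r := 2 * (2 * Real.pi)) (by positivity)] with w h1 h2
  rw [show 2 * (2 * Real.pi) * w / 2 + Real.pi = 2 * Real.pi * (w + 1 / 2) by ring,
    show 2 * (2 * Real.pi) * w / 2 = 2 * Real.pi * w by ring,
    show 2 * (2 * Real.pi) * w = 2 * Real.pi * (2 * w) by ring, fourier_two_pi_mul,
    fourier_two_pi_mul, h1] at h2
  rw [h2, expSum_waveCoeff]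
  congr 3
  push_cast
  ring

/-- Orthogonality relations of the mask coefficients. -/
theorem IsFWavelet.hasSum_maskCoeff (hfw : IsFWavelet fw m₀) (hS : AssumptionS fw Φ)
    (hc : Continuous fw) (k : ℤ) :
    HasSum (fun l : ℤ => maskCoeff fw (l + 2 * k) * conj (maskCoeff fw l))
      (if k = 0 then 1 / 2 else 0) := by
  have hi := hS.integrable_self hc
  set h := maskCoeff fw with hh
  have hsum := summable_maskCoeff hS hc
  have hF : ∀ l : ℤ, Integrable fun z : ℝ =>
      2 * (fw z * (conj (h l) * conj (fw (2 * z - ((l + 2 * k : ℤ) : ℝ))))) := fun l => by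
    refine (Integrable.mul_bdd (c := ‖h l‖ * Φ 0) hi ?_ ?_).const_mul 2
    · exact (continuous_const.mul (Complex.continuous_conj.comp
        (hc.comp (by fun_prop)))).aestronglyMeasurable
    · refine Eventually.of_forall fun z => ?_
      rw [norm_mul, RCLike.norm_conj, RCLike.norm_conj]
      gcongr
      exact hS.norm_le_zero hc _
  -- The second factor of `∫ fw z * conj (fw (z - k))` is expanded by the two-scale relation and
  -- integrated termwise. The left side is known by orthonormality; the factor 2 of `twoScale`
  -- accounts for `1 / 2`.
  have key := hasSum_integral_of_summable_integral_norm hF (by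
    refine Summable.of_nonneg_of_le (fun l => integral_nonneg fun _ => norm_nonneg _) (fun l => ?_)
      (hsum.mul_right (2 * Φ 0 * ∫ z, ‖fw z‖))
    calc _ ≤ ∫ z, 2 * ‖h l‖ * Φ 0 * ‖fw z‖ := by
          refine integral_mono (hF l).norm (hi.norm.const_mul _) fun z => ?_
          simp only [norm_mul, RCLike.norm_conj, Complex.norm_ofNat]
          have := hS.norm_le_zero hc (2 * z - ((l + 2 * k : ℤ) : ℝ))
          calc 2 * (‖fw z‖ * (‖h l‖ * ‖fw (2 * z - ((l + 2 * k : ℤ) : ℝ))‖))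
              ≤ 2 * (‖fw z‖ * (‖h l‖ * Φ 0)) := by gcongr
            _ = _ := by ring
      _ = _ := by rw [integral_const_mul]; ring)
  have h1 : ∀ z : ℝ, ∑' l : ℤ, 2 * (fw z * (conj (h l) *
      conj (fw (2 * z - ((l + 2 * k : ℤ) : ℝ))))) = fw z * conj (fw (z - k)) := fun z => by
    rw [tsum_mul_left, tsum_mul_left, hfw.two_scale hS hc (z - k), twoScale, map_mul, map_ofNat,
      Complex.conj_tsum, ← hh, mul_left_comm]
    congr 3
    ext l
    rw [map_mul]
    congr 3
    push_cast
    ring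
  have h2 : ∀ l : ℤ, ∫ z : ℝ, 2 * (fw z * (conj (h l) *
      conj (fw (2 * z - ((l + 2 * k : ℤ) : ℝ))))) = 2 * (h (l + 2 * k) * conj (h l)) := fun l => by
    rw [integral_const_mul]
    simp_rw [mul_left_comm (fw _)]
    rw [integral_const_mul, mul_comm (conj (h l)), hh, maskCoeff, ← maskCoeff]
  simp_rw [h1, h2, hfw.orthonormal hS hc k] at key
  have := key.mul_left (1 / 2 : ℂ)
  simp only [← mul_assoc] at this
  norm_num at this
  simpa using this

/-- At frequency 0 the transformed two-scale relation reads `𝓕 fw 0 = (∑ h_k) 𝓕 fw 0`, and `𝓕 fw 0 ≠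
0`. -/
theorem IsFWavelet.tsum_maskCoeff (hfw : IsFWavelet fw m₀) (hS : AssumptionS fw Φ)
    (hc : Continuous fw) : ∑' k, maskCoeff fw k = 1 := by
  have hi := hS.integrable_self hc
  have h0 : 𝓕 fw 0 ≠ 0 := by
    rw [← fourier_two_pi_mul, mul_zero]; exact hfw.fourier_zero
  have h1 := fourierTransform_twoScale (summable_maskCoeff hS hc) hi 0
  rw [mul_zero, ← funext (hfw.two_scale hS hc)] at h1
  have h2 : expSum (maskCoeff fw) 0 = ∑' k, maskCoeff fw k := by simp [expSum]
  rw [← h2]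
  exact (mul_eq_right₀ h0).1 h1.symm

end Mask

end SubGaussWavelet

namespace SubGaussWavelet

open scoped FourierTransform ComplexConjugate

/-! ### Splitting of integer series by parity -/

section Parity

variable {B : ℤ → ℂ}

theorem hasSum_int_even_add_odd {a b : ℂ} (ha : HasSum (fun k : ℤ => B (2 * k)) a)
    (hb : HasSum (fun k : ℤ => B (2 * k + 1)) b) : HasSum B (a + b) := by
  have hinj : Function.Injective fun k : ℤ => 2 * k := fun x y h => by simpa using h
  have hinj' : Function.Injective fun k : ℤ => 2 * k + 1 := fun x y h => by simpa using h
  refine (hinj.hasSum_range_iff.2 ha).add_isCompl ?_ (hinj'.hasSum_range_iff.2 hb)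
  have h1 : Set.range (fun k : ℤ => 2 * k) = {n | Even n} := by
    ext n; simp [even_iff_exists_two_mul]
  have h2 : Set.range (fun k : ℤ => 2 * k + 1) = {n | Odd n} := by
    ext n; simp [Odd]
  rw [h1, h2]
  exact Int.isCompl_even_odd

theorem tsum_int_even_add_odd (hB : Summable B) :
    ∑' k : ℤ, B (2 * k) + ∑' k : ℤ, B (2 * k + 1) = ∑' k, B k := by
  have hinj : Function.Injective fun k : ℤ => 2 * k := fun x y h => by simpa using h
  have hinj' : Function.Injective fun k : ℤ => 2 * k + 1 := fun x y h => by simpa using h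
  exact (hasSum_int_even_add_odd (hB.comp_injective hinj).hasSum
    (hB.comp_injective hinj').hasSum).tsum_eq.symm

theorem tsum_comp_even_sub (B : ℤ → ℂ) (s : ℤ) :
    ∑' k : ℤ, B (2 * s - 2 * k) = ∑' k : ℤ, B (2 * k) := by
  rw [← (Equiv.subLeft s).tsum_eq fun k => B (2 * k)]
  congr 1 with k
  simp only [Equiv.subLeft_apply]
  congr 1
  ring

theorem tsum_comp_odd_sub (B : ℤ → ℂ) (s : ℤ) :
    ∑' k : ℤ, B (2 * s + 1 - 2 * k) = ∑' k : ℤ, B (2 * k + 1) := by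
  rw [← (Equiv.subLeft s).tsum_eq fun k => B (2 * k + 1)]
  congr 1 with k
  simp only [Equiv.subLeft_apply]
  congr 1
  ring

theorem tsum_comp_add_two_mul (B : ℤ → ℂ) (a : ℤ) :
    ∑' k : ℤ, B (a + 2 * k) = ∑' k : ℤ, B (a - 2 * k) := by
  rw [← (Equiv.neg ℤ).tsum_eq fun k => B (a - 2 * k)]
  congr 1 with k
  simp only [Equiv.neg_apply]
  congr 1
  ring

end Parity

/-! ### Algebra of the filter coefficients -/

section Filter

variable {h : ℤ → ℂ}

theorem summable_mul_conj_shift {d e : ℤ → ℂ} (hd : Summable fun k => ‖d k‖)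
    (he : Summable fun k => ‖e k‖) (r : ℤ) :
    Summable fun j : ℤ => d j * conj (e (j + r)) := by
  obtain ⟨M, hM⟩ : ∃ M, ∀ k, ‖e k‖ ≤ M :=
    ⟨∑' k, ‖e k‖, fun k => he.le_tsum k fun _ _ => norm_nonneg _⟩
  refine Summable.of_norm_bounded (hd.mul_right M) fun j => ?_
  rw [norm_mul, RCLike.norm_conj]
  exact mul_le_mul_of_nonneg_left (hM _) (norm_nonneg _)

/-- Completeness relation of a pair of conjugate quadrature filters. -/
theorem tsum_filter_add_tsum_waveCoeff (hh : Summable fun k => ‖h k‖)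
    (horth : ∀ k : ℤ, ∑' l : ℤ, h (l + 2 * k) * conj (h l) = if k = 0 then 1 / 2 else 0)
    (l m : ℤ) :
    ∑' k : ℤ, h (l - 2 * k) * conj (h (m - 2 * k)) +
      ∑' k : ℤ, waveCoeff h (l - 2 * k) * conj (waveCoeff h (m - 2 * k)) =
    if l = m then 1 / 2 else 0 := by
  set B : ℤ → ℂ := fun j => h j * conj (h (j + (m - l))) with hBdef
  have hB : Summable B := summable_mul_conj_shift hh hh (m - l)
  have h1 : ∑' k : ℤ, h (l - 2 * k) * conj (h (m - 2 * k)) = ∑' k : ℤ, B (l - 2 * k) := by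
    congr 1 with k
    simp only [hBdef]
    congr 3
    ring
  have h2 : ∑' k : ℤ, waveCoeff h (l - 2 * k) * conj (waveCoeff h (m - 2 * k)) =
      (-1) ^ (l + m) * ∑' k : ℤ, B (1 - m - 2 * k) := by
    rw [← tsum_comp_add_two_mul B, ← tsum_mul_left]
    congr 1 with k
    simp only [hBdef, waveCoeff, map_mul, Complex.conj_conj]
    have hs : (-1 : ℂ) ^ (1 - (l - 2 * k)) * conj ((-1 : ℂ) ^ (1 - (m - 2 * k))) =
        (-1) ^ (l + m) := by
      have hc : conj ((-1 : ℂ) ^ (1 - (m - 2 * k))) = (-1) ^ (1 - (m - 2 * k)) := by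
        rw [map_zpow₀]; simp
      rw [hc, ← zpow_add₀ (by norm_num)]
      rw [show 1 - (l - 2 * k) + (1 - (m - 2 * k)) = (l + m) + 2 * (1 - l - m + 2 * k) by ring,
        zpow_add₀ (by norm_num), zpow_mul]
      simp
    rw [← hs, show 1 - m + 2 * k + (m - l) = 1 - (l - 2 * k) by ring,
      show 1 - m + 2 * k = 1 - (m - 2 * k) by ring]
    ring
  have htot : ∀ r : ℤ, m - l = 2 * r → ∑' j, B j = if l = m then 1 / 2 else 0 := by
    intro r hr
    have h3 := horth (-r)
    rw [← (Equiv.addRight (m - l)).tsum_eq] at h3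
    simp only [Equiv.coe_addRight] at h3
    have h4 : ∀ j : ℤ, j + (m - l) + 2 * -r = j := fun j => by omega
    simp only [h4] at h3
    rw [hBdef, h3]
    congr 1
    simp only [eq_iff_iff]
    omega
  rw [h1, h2]
  -- The first sum runs over the indices of `B` with the parity of `l`, the second over those with
  -- the parity of `1 - m`, with sign `(-1)^(l+m)`. If `l` and `m` have equal parity, the two
  -- classes are complementary and the full sum of `B` is given by orthogonality; otherwise the
  -- classes coincide and the signs cancel.
  rcases Int.even_or_odd' l with ⟨s, hs | hs⟩ <;> rcases Int.even_or_odd' m with ⟨t, ht | ht⟩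
  · rw [show 1 - m = 2 * (-t) + 1 by omega, hs, tsum_comp_even_sub, tsum_comp_odd_sub,
      (show Even (2 * s + m) from ⟨s + t, by omega⟩).neg_one_zpow, one_mul,
      tsum_int_even_add_odd hB, htot (t - s) (by omega), hs]
  · rw [show 1 - m = 2 * (-t) by omega, if_neg (by omega), hs, tsum_comp_even_sub,
      tsum_comp_even_sub, (show Odd (2 * s + m) from ⟨s + t, by omega⟩).neg_one_zpow]
    ring
  · rw [show 1 - m = 2 * (-t) + 1 by omega, if_neg (by omega), hs, tsum_comp_odd_sub,
      tsum_comp_odd_sub, (show Odd (2 * s + 1 + m) from ⟨s + t, by omega⟩).neg_one_zpow]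
    ring
  · rw [show 1 - m = 2 * (-t) by omega, hs, tsum_comp_odd_sub, tsum_comp_even_sub,
      (show Even (2 * s + 1 + m) from ⟨s + t + 1, by omega⟩).neg_one_zpow, one_mul, add_comm,
      tsum_int_even_add_odd hB, htot (t - s) (by omega), hs]

theorem tsum_comp_sub_two_mul_le (u : ℤ → ℝ≥0∞) (l : ℤ) :
    ∑' k : ℤ, u (l - 2 * k) ≤ ∑' k, u k :=
  ENNReal.tsum_comp_le_tsum_of_injective (fun x y hxy => by simpa using hxy) u

/-- Interchange of summations for products of filtered sequences. -/
theorem tsum_filtered_mul {d a b : ℤ → ℂ} (hd : Summable fun k => ‖d k‖)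
    (ha : Summable fun k => ‖a k‖) (hb : Summable fun k => ‖b k‖) :
    Summable (fun q : ℤ × ℤ => a q.1 * conj (b q.2) *
        ∑' k : ℤ, d (q.1 - 2 * k) * conj (d (q.2 - 2 * k))) ∧
    ∑' k : ℤ, (∑' l : ℤ, d (l - 2 * k) * a l) * conj (∑' l : ℤ, d (l - 2 * k) * b l) =
      ∑' q : ℤ × ℤ, a q.1 * conj (b q.2) *
        ∑' k : ℤ, d (q.1 - 2 * k) * conj (d (q.2 - 2 * k)) := by
  have hd' := tsum_enorm_ne_top_iff_summable_norm.2 hd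
  have ha' := tsum_enorm_ne_top_iff_summable_norm.2 ha
  have hb' := tsum_enorm_ne_top_iff_summable_norm.2 hb
  set F : (ℤ × ℤ) × ℤ → ℂ := fun q => a q.1.1 * conj (b q.1.2) *
    (d (q.1.1 - 2 * q.2) * conj (d (q.1.2 - 2 * q.2))) with hF
  have hFs : Summable F := by
    refine Summable.of_norm (tsum_enorm_ne_top_iff_summable_norm.1 ?_)
    rw [ENNReal.tsum_prod']
    have hterm : ∀ q : ℤ × ℤ, ∑' k : ℤ, ‖F (q, k)‖ₑ ≤
        ‖a q.1‖ₑ * ‖b q.2‖ₑ * ((∑' k, ‖d k‖ₑ) * ∑' k, ‖d k‖ₑ) := fun q => by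
      have h1 : ∀ k : ℤ, ‖F (q, k)‖ₑ ≤ ‖a q.1‖ₑ * ‖b q.2‖ₑ *
          (‖d (q.1 - 2 * k)‖ₑ * ∑' k, ‖d k‖ₑ) := fun k => by
        simp only [hF, enorm_mul, RCLike.enorm_conj]
        gcongr
        exact ENNReal.le_tsum _
      refine (ENNReal.tsum_le_tsum h1).trans ?_
      rw [ENNReal.tsum_mul_left, ENNReal.tsum_mul_right]
      refine mul_le_mul_right (mul_le_mul_left ?_ _) _
      exact tsum_comp_sub_two_mul_le (fun k => ‖d k‖ₑ) _
    refine ne_top_of_le_ne_top ?_ (ENNReal.tsum_le_tsum hterm)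
    rw [ENNReal.tsum_mul_right, ENNReal.tsum_prod']
    simp_rw [ENNReal.tsum_mul_left, ENNReal.tsum_mul_right]
    exact ENNReal.mul_ne_top (ENNReal.mul_ne_top ha' hb') (ENNReal.mul_ne_top hd' hd')
  have hFq : ∀ q : ℤ × ℤ, ∑' k : ℤ, F (q, k) = a q.1 * conj (b q.2) *
        ∑' k : ℤ, d (q.1 - 2 * k) * conj (d (q.2 - 2 * k)) := fun q => by
    simp only [hF, tsum_mul_left]
  have hfilt : ∀ {c : ℤ → ℂ}, (Summable fun k => ‖c k‖) → ∀ k : ℤ,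
      Summable fun l : ℤ => ‖d (l - 2 * k) * c l‖ := fun {c} hc k => by
    refine Summable.of_nonneg_of_le (fun _ => norm_nonneg _) (fun l => ?_)
      (hc.mul_left (∑' k, ‖d k‖))
    rw [norm_mul]
    gcongr
    exact hd.le_tsum (l - 2 * k) fun _ _ => norm_nonneg _
  constructor
  · have := hFs.prod
    simp_rw [hFq] at this
    exact this
  · have h1 : ∀ k : ℤ, (∑' l : ℤ, d (l - 2 * k) * a l) * conj (∑' l : ℤ, d (l - 2 * k) * b l) =
        ∑' q : ℤ × ℤ, F (q, k) := fun k => by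
      have hb2 : Summable fun l : ℤ => ‖conj (d (l - 2 * k) * b l)‖ := by
        simpa only [RCLike.norm_conj] using hfilt hb k
      rw [Complex.conj_tsum, tsum_mul_tsum_of_summable_norm (hfilt ha k) hb2]
      congr 1 with q
      simp only [hF, map_mul]
      ring
    simp_rw [h1, ← hFq]
    exact hFs.tsum_comm (f := fun q k => F (q, k))

/-- Perfect reconstruction for a pair of conjugate quadrature filters. -/
theorem tsum_filtered_add {a b : ℤ → ℂ} (hh : Summable fun k => ‖h k‖)
    (horth : ∀ k : ℤ, ∑' l : ℤ, h (l + 2 * k) * conj (h l) = if k = 0 then 1 / 2 else 0)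
    (ha : Summable fun k => ‖a k‖) (hb : Summable fun k => ‖b k‖) :
    ∑' k : ℤ, (∑' l : ℤ, h (l - 2 * k) * a l) * conj (∑' l : ℤ, h (l - 2 * k) * b l) +
      ∑' k : ℤ, (∑' l : ℤ, waveCoeff h (l - 2 * k) * a l) *
        conj (∑' l : ℤ, waveCoeff h (l - 2 * k) * b l) =
    1 / 2 * ∑' l : ℤ, a l * conj (b l) := by
  obtain ⟨hs1, he1⟩ := tsum_filtered_mul hh ha hb
  obtain ⟨hs2, he2⟩ := tsum_filtered_mul (summable_waveCoeff hh) ha hb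
  rw [he1, he2, ← hs1.tsum_add hs2]
  simp_rw [← mul_add, tsum_filter_add_tsum_waveCoeff hh horth]
  have hsupp : ∀ q : ℤ × ℤ, q ∉ Set.range (fun l : ℤ => (l, l)) →
      a q.1 * conj (b q.2) * (if q.1 = q.2 then (1 / 2 : ℂ) else 0) = 0 := fun q hq => by
    rw [if_neg, mul_zero]
    intro hq'
    exact hq ⟨q.1, by ext <;> simp [hq']⟩
  have hinj : Function.Injective fun l : ℤ => (l, l) := fun x y hxy => by simpa using hxy
  rw [← hinj.tsum_eq (Function.support_subset_iff'.2 hsupp), ← tsum_mul_left]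
  congr 1 with l
  simp only [if_true]
  ring

/-- The even and the odd coefficients of the filter both sum to `1/2`. -/
theorem tsum_even_odd_filter (hh : Summable fun k => ‖h k‖)
    (horth : ∀ k : ℤ, ∑' l : ℤ, h (l + 2 * k) * conj (h l) = if k = 0 then 1 / 2 else 0)
    (hone : ∑' k, h k = 1) :
    ∑' k : ℤ, h (2 * k) = 1 / 2 ∧ ∑' k : ℤ, h (2 * k + 1) = 1 / 2 := by
  set E := ∑' k : ℤ, h (2 * k) with hE
  set O := ∑' k : ℤ, h (2 * k + 1) with hO
  have hEO : E + O = 1 := by rw [← hone, tsum_int_even_add_odd hh.of_norm]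
  have hd' := tsum_enorm_ne_top_iff_summable_norm.2 hh
  have hFs : Summable fun q : ℤ × ℤ => h (q.2 + 2 * q.1) * conj (h q.2) := by
    refine Summable.of_norm (tsum_enorm_ne_top_iff_summable_norm.1 ?_)
    rw [ENNReal.tsum_prod', ENNReal.tsum_comm]
    have hterm : ∀ l : ℤ, ∑' k : ℤ, ‖h (l + 2 * k) * conj (h l)‖ₑ ≤ (∑' k, ‖h k‖ₑ) * ‖h l‖ₑ :=
      fun l => by
        simp only [enorm_mul, RCLike.enorm_conj, ENNReal.tsum_mul_right]
        refine mul_le_mul_left ?_ _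
        exact ENNReal.tsum_comp_le_tsum_of_injective (f := fun k : ℤ => l + 2 * k)
          (fun x y hxy => by simpa using hxy) (fun k => ‖h k‖ₑ)
    refine ne_top_of_le_ne_top ?_ (ENNReal.tsum_le_tsum hterm)
    rw [ENNReal.tsum_mul_left]
    exact ENNReal.mul_ne_top hd' hd'
  -- Summing the orthogonality relations over all `k` gives `|E|² + |O|² = 1/2`. With `E + O = 1`,
  -- the parallelogram identity yields `|E - O|² = 2 · 1/2 - 1 = 0`.
  have hsq : E * conj E + O * conj O = 1 / 2 := by
    have h1 : ∑' k : ℤ, ∑' l : ℤ, h (l + 2 * k) * conj (h l) = 1 / 2 := by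
      simp_rw [horth]
      exact tsum_ite_eq 0 _
    rw [← hFs.tsum_comm (f := fun k l => h (l + 2 * k) * conj (h l))] at h1
    simp_rw [tsum_mul_right] at h1
    have hsum : Summable fun l : ℤ => (∑' k : ℤ, h (l + 2 * k)) * conj (h l) := by
      have := hFs.prod_symm.prod
      simpa only [Prod.fst_swap, Prod.snd_swap, tsum_mul_right] using this
    rw [← tsum_int_even_add_odd hsum] at h1
    have he : ∀ l : ℤ, ∑' k : ℤ, h (2 * l + 2 * k) = E := fun l => by
      rw [tsum_comp_add_two_mul, tsum_comp_even_sub]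
    have ho : ∀ l : ℤ, ∑' k : ℤ, h (2 * l + 1 + 2 * k) = O := fun l => by
      rw [tsum_comp_add_two_mul, tsum_comp_odd_sub]
    simp_rw [he, ho, tsum_mul_left, ← Complex.conj_tsum] at h1
    exact h1
  have hdiff : (E - O) * conj (E - O) = 0 := by
    have h2 : (E + O) * conj (E + O) = 1 := by rw [hEO]; simp
    rw [map_add] at h2
    rw [map_sub]
    linear_combination 2 * hsq - h2
  have hEO' : E = O := by
    rw [Complex.mul_conj, Complex.ofReal_eq_zero, Complex.normSq_eq_zero] at hdiff
    exact sub_eq_zero.1 hdiff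
  rw [← hEO'] at hEO ⊢
  have : E = 1 / 2 := by linear_combination hEO / 2
  exact ⟨this, this⟩

end Filter

end SubGaussWavelet

namespace SubGaussWavelet

open scoped FourierTransform ComplexConjugate

/-! ### The reproducing kernels -/

/-- The kernel `∑_k g(x - k) conj g(y - k)`. -/
noncomputable def kernel (g : ℝ → ℂ) (x y : ℝ) : ℂ := ∑' k : ℤ, g (x - k) * conj (g (y - k))

section Kernel

variable {fw m₀ mw : ℝ → ℂ} {Φ : ℝ → ℝ}

theorem twoScale_sub_int (d : ℤ → ℂ) (g : ℝ → ℂ) (x : ℝ) (k : ℤ) :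
    twoScale d g (x - k) = 2 * ∑' l : ℤ, d (l - 2 * k) * g (2 * x - l) := by
  rw [twoScale, ← (Equiv.subRight (2 * k)).tsum_eq]
  congr 2 with l
  simp only [Equiv.subRight_apply]
  congr 2
  push_cast
  ring

theorem IsFWavelet.tsum_mul_conj_maskCoeff (hfw : IsFWavelet fw m₀) (hS : AssumptionS fw Φ)
    (hc : Continuous fw) (k : ℤ) :
    ∑' l : ℤ, maskCoeff fw (l + 2 * k) * conj (maskCoeff fw l) = if k = 0 then 1 / 2 else 0 :=
  (hfw.hasSum_maskCoeff hS hc k).tsum_eq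

/-- One step of the multiresolution decomposition, on the level of kernels. -/
theorem kernel_add_kernel (hfw : IsFWavelet fw m₀) (hmw : IsMWavelet fw m₀ mw)
    (hmc : Continuous mw) (hS : AssumptionS fw Φ) (hc : Continuous fw) (x y : ℝ) :
    kernel fw x y + kernel mw x y = 2 * kernel fw (2 * x) (2 * y) := by
  have h := tsum_filtered_add (summable_maskCoeff hS hc) (hfw.tsum_mul_conj_maskCoeff hS hc)
    (hS.summable_norm hc (2 * x)) (hS.summable_norm hc (2 * y))
  have hk : ∀ {d : ℤ → ℂ} {v : ℝ → ℂ}, (∀ x, v x = twoScale d fw x) → kernel v x y =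
      4 * ∑' k : ℤ, (∑' l : ℤ, d (l - 2 * k) * fw (2 * x - l)) *
        conj (∑' l : ℤ, d (l - 2 * k) * fw (2 * y - l)) := fun {d v} hv => by
    rw [kernel, ← tsum_mul_left]
    congr 1 with k
    rw [hv, hv, twoScale_sub_int, twoScale_sub_int, map_mul, map_ofNat]
    ring
  rw [hk (hfw.two_scale hS hc), hk (hmw.two_scale hfw hmc hS hc), ← mul_add, h, kernel]
  ring

theorem summable_translates_majorant {g : ℝ → ℂ} (hS : AssumptionS g Φ) (x : ℝ) :
    Summable fun k : ℤ => Φ |x - k| := by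
  have h := ENNReal.summable_toReal
    ((hS.tsum_majorant_le x).trans_lt ENNReal.ofReal_lt_top).ne
  simpa only [ENNReal.toReal_ofReal (hS.nonneg (abs_nonneg _))] using h

theorem continuousAt_tsum_translates {g : ℝ → ℂ} (hS : AssumptionS g Φ) (hc : Continuous g) :
    ContinuousAt (fun x : ℝ => ∑' k : ℤ, g (x - k)) 0 := by
  have hon : ContinuousOn (fun x : ℝ => ∑' k : ℤ, g (x - k)) (Set.Icc (-1) 1) := by
    -- For `x ∈ [-1, 1]` the point nearest to `k` is `1` if `k > 0` and `-1` if `k < 0`; the term `Φ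
    -- |0 - k|` serves `k = 0`.
    refine continuousOn_tsum (u := fun k : ℤ => Φ |1 - k| + Φ |-1 - k| + Φ |0 - k|)
      (fun k => by fun_prop)
      (((summable_translates_majorant hS 1).add (summable_translates_majorant hS (-1))).add
        (summable_translates_majorant hS 0)) fun k x hx => ?_
    have hmono : ∀ {u v : ℝ}, |u| ≤ |v| → Φ |v| ≤ Φ |u| := fun huv =>
      hS.antitoneOn (Set.mem_Ici.2 (abs_nonneg _)) (Set.mem_Ici.2 (abs_nonneg _)) huv
    have h1 := hS.nonneg (abs_nonneg ((1 : ℝ) - k))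
    have h2 := hS.nonneg (abs_nonneg ((-1 : ℝ) - k))
    have h3 := hS.nonneg (abs_nonneg ((0 : ℝ) - k))
    refine (hS.norm_le hc _).trans ?_
    rcases lt_trichotomy k 0 with hk | hk | hk
    · have hk' : (k : ℝ) ≤ -1 := by exact_mod_cast (by omega : k ≤ -1)
      have : Φ |x - k| ≤ Φ |-1 - (k : ℝ)| := hmono (by
        rw [abs_of_nonneg (by linarith), abs_of_nonneg (by linarith [hx.1])]
        linarith [hx.1])
      linarith
    · have : Φ |x - k| ≤ Φ |0 - (k : ℝ)| := hmono (by simp [hk])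
      linarith
    · have hk' : (1 : ℝ) ≤ k := by exact_mod_cast (by omega : 1 ≤ k)
      have : Φ |x - k| ≤ Φ |1 - (k : ℝ)| := hmono (by
        rw [abs_of_nonpos (by linarith), abs_of_nonpos (by linarith [hx.2])]
        linarith [hx.2])
      linarith
  exact hon.continuousAt (Icc_mem_nhds (by norm_num) (by norm_num))

/-- After inserting the two-scale relation and interchanging sums, `fw (2x - l)` has coefficient `2
∑_k h (l - 2k)`, which is 1 for either parity of `l`. -/
theorem IsFWavelet.tsum_translates_two_mul (hfw : IsFWavelet fw m₀) (hS : AssumptionS fw Φ)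
    (hc : Continuous fw) (x : ℝ) :
    ∑' k : ℤ, fw (x - k) = ∑' k : ℤ, fw (2 * x - k) := by
  have hsum := summable_maskCoeff hS hc
  obtain ⟨hE, hO⟩ := tsum_even_odd_filter hsum (hfw.tsum_mul_conj_maskCoeff hS hc)
    (hfw.tsum_maskCoeff hS hc)
  set h := maskCoeff fw with hh
  have hd' := tsum_enorm_ne_top_iff_summable_norm.2 hsum
  have ha' := tsum_enorm_ne_top_iff_summable_norm.2 (hS.summable_norm hc (2 * x))
  have hFs : Summable fun q : ℤ × ℤ => h (q.1 - 2 * q.2) * fw (2 * x - q.1) := by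
    refine Summable.of_norm (tsum_enorm_ne_top_iff_summable_norm.1 ?_)
    rw [ENNReal.tsum_prod']
    have hterm : ∀ l : ℤ, ∑' k : ℤ, ‖h (l - 2 * k) * fw (2 * x - l)‖ₑ ≤
        (∑' k, ‖h k‖ₑ) * ‖fw (2 * x - l)‖ₑ := fun l => by
      simp only [enorm_mul, ENNReal.tsum_mul_right]
      refine mul_le_mul_left ?_ _
      exact tsum_comp_sub_two_mul_le (fun k => ‖h k‖ₑ) l
    refine ne_top_of_le_ne_top ?_ (ENNReal.tsum_le_tsum hterm)
    rw [ENNReal.tsum_mul_left]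
    exact ENNReal.mul_ne_top hd' ha'
  have h1 : ∀ k : ℤ, fw (x - k) = 2 * ∑' l : ℤ, h (l - 2 * k) * fw (2 * x - l) := fun k => by
    rw [hfw.two_scale hS hc, twoScale_sub_int]
  have h2 : ∀ l : ℤ, ∑' k : ℤ, h (l - 2 * k) = 1 / 2 := fun l => by
    rcases Int.even_or_odd' l with ⟨s, hs | hs⟩
    · rw [hs, tsum_comp_even_sub, hE]
    · rw [hs, tsum_comp_odd_sub, hO]
  simp_rw [h1]
  rw [tsum_mul_left, hFs.tsum_comm (f := fun l k => h (l - 2 * k) * fw (2 * x - l))]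
  simp_rw [tsum_mul_right, h2]
  rw [tsum_mul_left]
  ring

/-- Invariance under `x ↦ 2x` moves any point to `x / 2^n`, and continuity at 0 gives the limit. -/
theorem IsFWavelet.tsum_translates_const (hfw : IsFWavelet fw m₀) (hS : AssumptionS fw Φ)
    (hc : Continuous fw) (x : ℝ) : ∑' k : ℤ, fw (x - k) = ∑' k : ℤ, fw (0 - k) := by
  set θ : ℝ → ℂ := fun x => ∑' k : ℤ, fw (x - k) with hθ
  have hcont : ContinuousAt θ 0 := continuousAt_tsum_translates hS hc
  have hstep : ∀ y, θ y = θ (2 * y) := hfw.tsum_translates_two_mul hS hc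
  have hn : ∀ n : ℕ, θ x = θ (x * (1 / 2) ^ n) := fun n => by
    induction n with
    | zero => simp
    | succ n ih =>
      rw [ih, hstep (x * (1 / 2) ^ (n + 1))]
      congr 1
      ring
  have hlim : Tendsto (fun n : ℕ => x * (1 / 2 : ℝ) ^ n) atTop (𝓝 0) := by
    simpa using (tendsto_pow_atTop_nhds_zero_of_lt_one (r := (1 / 2 : ℝ)) (by norm_num)
      (by norm_num)).const_mul x
  have h1 : Tendsto (fun n : ℕ => θ (x * (1 / 2) ^ n)) atTop (𝓝 (θ 0)) := hcont.tendsto.comp hlim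
  exact tendsto_nhds_unique (tendsto_const_nhds.congr hn) h1

/-- Let `θ` be the periodization of `fw`. Then `∫ fw * conj θ` equals 1 when integrated termwise, by
orthonormality, and equals `(∫ fw) * conj θ` because `θ` is constant. -/
theorem IsFWavelet.tsum_translates_mul_integral (hfw : IsFWavelet fw m₀) (hS : AssumptionS fw Φ)
    (hc : Continuous fw) (x : ℝ) : (∑' k : ℤ, fw (x - k)) * conj (∫ z, fw z) = 1 := by
  have hi := hS.integrable_self hc
  have h1 := integral_tsum (μ := (volume : Measure ℝ))
    (f := fun (k : ℤ) z => fw z * conj (fw (1 * z - k)))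
    (fun k => (hc.mul (Complex.continuous_conj.comp (hc.comp (by fun_prop)))).aestronglyMeasurable)
    (lintegral_mul_tsum_lt_top hc hi hS hc 1).ne
  simp only [one_mul, hfw.orthonormal hS hc, tsum_mul_left, ← Complex.conj_tsum,
    hfw.tsum_translates_const hS hc, tsum_ite_eq] at h1
  rw [integral_mul_const] at h1
  rw [hfw.tsum_translates_const hS hc x]
  have h2 := congrArg conj h1
  rw [map_mul, Complex.conj_conj, map_one] at h2
  rw [← h2, mul_comm]

theorem integrable_kernel_aux {g : ℝ → ℂ} (hS : AssumptionS g Φ) (hc : Continuous g)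
    (x : ℝ) : ∑' k : ℤ, ∫⁻ y : ℝ, ‖g (x - k) * conj (g (y - k))‖ₑ < ∞ := by
  have h : ∀ k : ℤ, ∫⁻ y : ℝ, ‖g (x - k) * conj (g (y - k))‖ₑ =
      ‖g (x - k)‖ₑ * ∫⁻ y, ‖g y‖ₑ := fun k => by
    simp only [enorm_mul, RCLike.enorm_conj]
    have hm := hc.measurable
    rw [lintegral_const_mul _ (by fun_prop),
      lintegral_sub_right_eq_self (fun y => ‖g y‖ₑ) (k : ℝ)]
  simp_rw [h]
  rw [ENNReal.tsum_mul_right]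
  exact ENNReal.mul_lt_top ((hS.tsum_enorm_le hc x).trans_lt ENNReal.ofReal_lt_top)
    (hS.integrable_self hc).2

/-- The kernel reproduces constants. -/
theorem IsFWavelet.integral_kernel (hfw : IsFWavelet fw m₀) (hS : AssumptionS fw Φ)
    (hc : Continuous fw) (x : ℝ) : ∫ y, kernel fw x y = 1 := by
  have h1 := integral_tsum (μ := (volume : Measure ℝ))
    (f := fun (k : ℤ) y => fw (x - k) * conj (fw (y - k)))
    (fun k => (continuous_const.mul (Complex.continuous_conj.comp
      (hc.comp (continuous_sub_right (k : ℝ))))).aestronglyMeasurable)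
    (integrable_kernel_aux hS hc x).ne
  simp only [kernel]
  rw [h1, ← hfw.tsum_translates_mul_integral hS hc x, ← tsum_mul_right]
  congr 1 with k
  rw [integral_const_mul, integral_conj, integral_sub_right_eq_self fw (k : ℝ)]

theorem enorm_kernel_le {g : ℝ → ℂ} (hS : AssumptionS g Φ) (hc : Continuous g) (x y : ℝ) :
    ‖kernel g x y‖ₑ ≤ ENNReal.ofReal (2 * constC Φ * Φ (|x - y| / 2)) := by
  refine le_trans ?_ (hS.tsum_kernel_le hc x y)
  refine enorm_tsum_le_tsum_enorm.trans_eq ?_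
  simp [enorm_mul]

end Kernel

end SubGaussWavelet

namespace SubGaussWavelet

open scoped ComplexConjugate

/-! ### Growth functions -/

/-- The growth condition on the function `c`, with respect to the majorant `Φ`. -/
structure GrowthCondition (c A : ℝ → ℝ) (x₀ : ℝ) (Φ : ℝ → ℝ) : Prop where
  even : ∀ x, c (-x) = c x
  mono : MonotoneOn c (Set.Ici 0)
  one_lt : 1 < c 0
  dilation : ∀ a, 0 < a → ∀ x, x₀ ≤ x → c (a * x) ≤ c x * A a
  integrable : Integrable fun x : ℝ => c x * Φ |x|

namespace GrowthCondition

variable {c A Φ : ℝ → ℝ} {x₀ : ℝ} {g : ℝ → ℂ}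

theorem abs_eq (hG : GrowthCondition c A x₀ Φ) (x : ℝ) : c |x| = c x := by
  rcases abs_choice x with h | h <;> rw [h]
  exact hG.even x

theorem le_of_abs_le (hG : GrowthCondition c A x₀ Φ) {x y : ℝ} (h : |x| ≤ |y|) : c x ≤ c y := by
  rw [← hG.abs_eq x, ← hG.abs_eq y]
  exact hG.mono (Set.mem_Ici.2 (abs_nonneg _)) (Set.mem_Ici.2 (abs_nonneg _)) h

theorem nonneg (hG : GrowthCondition c A x₀ Φ) (x : ℝ) : 0 ≤ c x :=
  (zero_le_one.trans hG.one_lt.le).trans (hG.le_of_abs_le (by simp))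

theorem measurable (hG : GrowthCondition c A x₀ Φ) : Measurable c := by
  have h1 : Monotone fun x => c (max x 0) := fun x y hxy =>
    hG.mono (Set.mem_Ici.2 (le_max_right _ _)) (Set.mem_Ici.2 (le_max_right _ _))
      (max_le_max_right 0 hxy)
  have h2 : c = (fun x => c (max x 0)) ∘ fun x => |x| := by
    ext x
    simp [hG.abs_eq]
  rw [h2]
  exact h1.measurable.comp measurable_norm

/-- Separates a base point from a displacement using only monotonicity in `|x|`: `|t + u|` is at
most twice the larger modulus. -/
theorem add_le (hG : GrowthCondition c A x₀ Φ) (t u : ℝ) : c (t + u) ≤ c (2 * t) + c (2 * u) := by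
  have h1 := hG.nonneg (2 * t)
  have h2 := hG.nonneg (2 * u)
  have h3 := abs_add_le t u
  rcases le_total |t| |u| with h | h
  · have : c (t + u) ≤ c (2 * u) := hG.le_of_abs_le (by rw [abs_mul, abs_two]; linarith)
    linarith
  · have : c (t + u) ≤ c (2 * t) := hG.le_of_abs_le (by rw [abs_mul, abs_two]; linarith)
    linarith

/-- A majorant for kernel times curve: the kernel decays like `Φ (|u| / 2)`, the curve grows like `c
(2u)`. With `u = 2v` one needs `Φ |v| c (4v)`: the dilation condition with factor 4 covers `|v| ≥
x₀`, and monotonicity bounds `c (4v)` by a constant elsewhere. -/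
theorem integrable_dilated (hG : GrowthCondition c A x₀ Φ) (hS : AssumptionS g Φ) (b : ℝ) :
    Integrable fun u : ℝ => Φ (|u| / 2) * (b + c (2 * u)) := by
  have h1 : Integrable fun v : ℝ => Φ |v| * c (4 * v) := by
    refine Integrable.mono' ((hG.integrable.mul_const |A 4|).add
      (hS.integrable.mul_const (c (4 * x₀)))) ?_ (Eventually.of_forall fun v => ?_)
    · exact hS.integrable.1.mul
        (hG.measurable.comp (measurable_const_mul 4)).aestronglyMeasurable
    · have hΦ := hS.nonneg (abs_nonneg v)
      have hc1 := hG.nonneg v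
      have hc4 := hG.nonneg (4 * v)
      have hc0 := hG.nonneg (4 * x₀)
      rw [Real.norm_of_nonneg (by positivity)]
      simp only [Pi.add_apply]
      have hA := abs_nonneg (A 4)
      rcases le_total x₀ |v| with h | h
      · have h2 := hG.dilation 4 (by norm_num) |v| h
        have h3 : c (4 * |v|) = c (4 * v) := by
          rw [← hG.abs_eq (4 * v), abs_mul]; norm_num
        rw [h3, hG.abs_eq] at h2
        have h4 : c v * A 4 ≤ c v * |A 4| := by gcongr; exact le_abs_self _
        calc Φ |v| * c (4 * v) ≤ Φ |v| * (c v * |A 4|) := by gcongr; exact h2.trans h4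
          _ = c v * Φ |v| * |A 4| := by ring
          _ ≤ _ := le_add_of_nonneg_right (by positivity)
      · have h2 : c (4 * v) ≤ c (4 * x₀) := hG.le_of_abs_le (by
          rw [abs_mul, abs_mul]
          exact mul_le_mul_of_nonneg_left (h.trans (le_abs_self _)) (abs_nonneg _))
        calc Φ |v| * c (4 * v) ≤ Φ |v| * c (4 * x₀) := by gcongr
          _ ≤ _ := le_add_of_nonneg_left (by positivity)
  have h2 := ((hS.integrable.mul_const b).add h1).comp_div (two_ne_zero' ℝ)
  refine h2.congr (Eventually.of_forall fun u => ?_)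
  simp only [Pi.add_apply]
  rw [abs_div, abs_two, show 4 * (u / 2) = 2 * u by ring]
  ring

end GrowthCondition

/-! ### Wavelet expansions of vector-valued functions -/

section Series

theorem enorm_hasSum_sub_sum_le {ι E : Type*} [DecidableEq ι] [NormedAddCommGroup E]
    {f : ι → E} {a : E} (hf : HasSum f a) (s : Finset ι) :
    ‖∑ i ∈ s, f i - a‖ₑ ≤ ∑' i, if i ∈ s then 0 else ‖f i‖ₑ := by
  have h1 : HasSum (fun i => if i ∈ s then f i else 0) (∑ i ∈ s, f i) := by
    have := hasSum_sum_of_ne_finset_zero (f := fun i => if i ∈ s then f i else 0) (s := s)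
      (L := .unconditional ι)
      (fun b hb => if_neg hb)
    rwa [Finset.sum_congr rfl fun i hi => if_pos hi] at this
  have h2 := hf.sub h1
  rw [← enorm_neg, neg_sub, ← h2.tsum_eq]
  refine enorm_tsum_le_tsum_enorm.trans (ENNReal.tsum_le_tsum fun i => ?_)
  split_ifs <;> simp

theorem hasSum_integral_of_tsum_lintegral {α ι E : Type*} [MeasurableSpace α] {μ : Measure α}
    [Countable ι] [NormedAddCommGroup E] [NormedSpace ℝ E] [CompleteSpace E] {F : ι → α → E}
    (hF : ∀ i, AEStronglyMeasurable (F i) μ) (h : ∑' i, ∫⁻ a, ‖F i a‖ₑ ∂μ ≠ ∞) :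
    HasSum (fun i => ∫ a, F i a ∂μ) (∫ a, ∑' i, F i a ∂μ) := by
  rw [integral_tsum hF h]
  refine (Summable.of_norm (tsum_enorm_ne_top_iff_summable_norm.1 ?_)).hasSum
  exact ne_top_of_le_ne_top h
    (ENNReal.tsum_le_tsum fun i => enorm_integral_le_lintegral_enorm _)

theorem one_le_two_pow_real (j : ℕ) : (1 : ℝ) ≤ 2 ^ j := one_le_pow₀ one_le_two

theorem lintegral_kernel_level_lt_top {E : Type*} [NormedAddCommGroup E] {c A Φ : ℝ → ℝ}
    {x₀ : ℝ} {g : ℝ → ℂ} {Z : ℝ → E} (hG : GrowthCondition c A x₀ Φ)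
    (hS : AssumptionS g Φ) (hZ : ∀ s, ‖Z s‖ ≤ c s) (j : ℕ) (t : ℝ) :
    ∫⁻ s : ℝ, 2 ^ j * ENNReal.ofReal (2 * constC Φ * Φ (|2 ^ j * t - 2 ^ j * s| / 2)) * ‖Z s‖ₑ <
      ∞ := by
  have hC := hS.constC_nonneg
  have hI := (hG.integrable_dilated hS (c (2 * t))).comp_sub_right t
  have hb : ∀ s : ℝ, 2 ^ j * ENNReal.ofReal (2 * constC Φ * Φ (|2 ^ j * t - 2 ^ j * s| / 2)) *
      ‖Z s‖ₑ ≤ (2 ^ j * ENNReal.ofReal (2 * constC Φ)) *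
        ‖Φ (|s - t| / 2) * (c (2 * t) + c (2 * (s - t)))‖ₑ := fun s => by
    -- Only finiteness is needed, so the faster decay at level `j` is discarded.
    have h1 : Φ (|2 ^ j * t - 2 ^ j * s| / 2) ≤ Φ (|s - t| / 2) := by
      refine hS.antitoneOn (Set.mem_Ici.2 (by positivity)) (Set.mem_Ici.2 (by positivity)) ?_
      rw [← mul_sub, abs_mul, abs_of_nonneg (by positivity : (0 : ℝ) ≤ 2 ^ j), abs_sub_comm t s]
      gcongr
      exact le_mul_of_one_le_left (abs_nonneg _) (one_le_two_pow_real j)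
    have h2 : ‖Z s‖ ≤ c (2 * t) + c (2 * (s - t)) := by
      have := hG.add_le t (s - t)
      rw [add_sub_cancel] at this
      exact (hZ s).trans this
    have hΦ := hS.nonneg (show 0 ≤ |s - t| / 2 by positivity)
    have hc1 := hG.nonneg (2 * t)
    have hc2 := hG.nonneg (2 * (s - t))
    rw [Real.enorm_of_nonneg (by positivity), ENNReal.ofReal_mul (by positivity),
      ENNReal.ofReal_mul hΦ, ← ofReal_norm (Z s)]
    calc _ ≤ 2 ^ j * (ENNReal.ofReal (2 * constC Φ) * ENNReal.ofReal (Φ (|s - t| / 2))) *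
          ENNReal.ofReal (c (2 * t) + c (2 * (s - t))) := by gcongr
      _ = _ := by ring
  refine (lintegral_mono hb).trans_lt ?_
  rw [lintegral_const_mul' _ _ (ENNReal.mul_ne_top (by simp) ENNReal.ofReal_ne_top)]
  exact ENNReal.mul_lt_top (ENNReal.mul_lt_top (by simp) ENNReal.ofReal_lt_top) hI.2

end Series

section Expansion

variable {E : Type*} [NormedAddCommGroup E] [NormedSpace ℂ E]
  {c A Φ Φm : ℝ → ℝ} {x₀ : ℝ} {g fw mw m₀ : ℝ → ℂ} {Z : ℝ → E}

theorem dilate_mul_conj (g : ℝ → ℂ) (j : ℕ) (k : ℤ) (t s : ℝ) :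
    dilate g j k t * conj (dilate g j k s) =
      2 ^ j * (g (2 ^ j * t - k) * conj (g (2 ^ j * s - k))) := by
  have h : (((2 : ℝ) ^ ((j : ℝ) / 2) : ℝ) : ℂ) * (((2 : ℝ) ^ ((j : ℝ) / 2) : ℝ) : ℂ) = 2 ^ j := by
    rw [← Complex.ofReal_mul, ← Real.rpow_add two_pos, add_halves, Real.rpow_natCast]
    push_cast
    rfl
  simp only [dilate, map_mul, Complex.conj_ofReal]
  rw [← h]
  ring

theorem continuous_dilate (hg : Continuous g) (j : ℕ) (k : ℤ) : Continuous (dilate g j k) := by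
  unfold dilate
  fun_prop

theorem measurable_kernel (hg : Continuous g) (x : ℝ) : Measurable (kernel g x) :=
  Measurable.tsum fun k => ((continuous_const.mul (Complex.continuous_conj.comp
    (hg.comp (continuous_sub_right (k : ℝ))))).measurable)

theorem norm_kernel_le (hS : AssumptionS g Φ) (hg : Continuous g) (x y : ℝ) :
    ‖kernel g x y‖ ≤ 2 * constC Φ * Φ (|x - y| / 2) := by
  have hC := hS.constC_nonneg
  have hΦ := hS.nonneg (show 0 ≤ |x - y| / 2 by positivity)
  have h := enorm_kernel_le hS hg x y
  rwa [← ofReal_norm, ENNReal.ofReal_le_ofReal_iff (by positivity)] at h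

/-- The integral of `Z` against the kernel at level `j`. -/
noncomputable def levelProj (g : ℝ → ℂ) (Z : ℝ → E) (j : ℕ) (t : ℝ) : E :=
  ∫ s : ℝ, ((2 : ℂ) ^ j * kernel g (2 ^ j * t) (2 ^ j * s)) • Z s

theorem integrable_kernel_level (hG : GrowthCondition c A x₀ Φ) (hS : AssumptionS g Φ)
    (hg : Continuous g) (hZc : Continuous Z) (hZ : ∀ s, ‖Z s‖ ≤ c s) (j : ℕ) (t : ℝ) :
    Integrable fun s : ℝ => ((2 : ℂ) ^ j * kernel g (2 ^ j * t) (2 ^ j * s)) • Z s := by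
  refine ⟨?_, (lintegral_mono fun s => ?_).trans_lt
    (lintegral_kernel_level_lt_top hG hS hZ j t)⟩
  · exact (((measurable_kernel hg _).comp (measurable_const_mul _)).const_mul
      _).aestronglyMeasurable.smul hZc.aestronglyMeasurable
  · rw [enorm_smul, enorm_mul]
    gcongr
    · rw [← ofReal_norm]; simp
    · exact enorm_kernel_le hS hg _ _

/-- One step of the multiresolution decomposition. -/
theorem levelProj_succ (hfw : IsFWavelet fw m₀) (hmw : IsMWavelet fw m₀ mw)
    (hSf : AssumptionS fw Φ) (hfc : Continuous fw) (hSm : AssumptionS mw Φm)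
    (hmc : Continuous mw) (hGf : GrowthCondition c A x₀ Φ) (hGm : GrowthCondition c A x₀ Φm)
    (hZc : Continuous Z) (hZ : ∀ s, ‖Z s‖ ≤ c s) (j : ℕ) (t : ℝ) :
    levelProj fw Z (j + 1) t = levelProj fw Z j t + levelProj mw Z j t := by
  simp only [levelProj]
  rw [← integral_add (integrable_kernel_level hGf hSf hfc hZc hZ j t)
    (integrable_kernel_level hGm hSm hmc hZc hZ j t)]
  congr 1 with s
  rw [← add_smul, ← mul_add, kernel_add_kernel hfw hmw hmc hSf hfc, pow_succ (2 : ℂ),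
    pow_succ' (2 : ℝ), mul_assoc (2 : ℝ), mul_assoc (2 : ℝ), mul_assoc (2 ^ j : ℂ)]

theorem levelProj_eq_add_sum (hfw : IsFWavelet fw m₀) (hmw : IsMWavelet fw m₀ mw)
    (hSf : AssumptionS fw Φ) (hfc : Continuous fw) (hSm : AssumptionS mw Φm)
    (hmc : Continuous mw) (hGf : GrowthCondition c A x₀ Φ) (hGm : GrowthCondition c A x₀ Φm)
    (hZc : Continuous Z) (hZ : ∀ s, ‖Z s‖ ≤ c s) (n : ℕ) (t : ℝ) :
    levelProj fw Z n t = levelProj fw Z 0 t + ∑ j ∈ Finset.range n, levelProj mw Z j t := by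
  induction n with
  | zero => simp
  | succ n ih =>
    rw [levelProj_succ hfw hmw hSf hfc hSm hmc hGf hGm hZc hZ, ih, Finset.sum_range_succ,
      add_assoc]

variable [CompleteSpace E]

/-- The level-`j` wavelet series is the integral against the level-`j` kernel. -/
theorem hasSum_levelProj (hG : GrowthCondition c A x₀ Φ) (hS : AssumptionS g Φ)
    (hg : Continuous g) (hZc : Continuous Z) (hZ : ∀ s, ‖Z s‖ ≤ c s) (j : ℕ) (t : ℝ) :
    HasSum (fun k : ℤ => dilate g j k t • ∫ s : ℝ, conj (dilate g j k s) • Z s)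
      (levelProj g Z j t) := by
  have hm : ∀ k : ℤ, AEStronglyMeasurable
      (fun s : ℝ => (dilate g j k t * conj (dilate g j k s)) • Z s) volume := fun k =>
    ((continuous_const.mul (Complex.continuous_conj.comp (continuous_dilate hg j k))).smul
      hZc).aestronglyMeasurable
  have hfin : ∑' k : ℤ, ∫⁻ s : ℝ, ‖(dilate g j k t * conj (dilate g j k s)) • Z s‖ₑ < ∞ := by
    rw [← lintegral_tsum fun k => (hm k).enorm]
    refine (lintegral_mono fun s => ?_).trans_lt (lintegral_kernel_level_lt_top hG hS hZ j t)
    simp only [enorm_smul, dilate_mul_conj, enorm_mul, RCLike.enorm_conj]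
    rw [ENNReal.tsum_mul_right, ENNReal.tsum_mul_left]
    gcongr
    · rw [← ofReal_norm]; simp
    · exact hS.tsum_kernel_le hg _ _
  have hs := hasSum_integral_of_tsum_lintegral hm hfin.ne
  have hInt : ∫ s : ℝ, ∑' k : ℤ, (dilate g j k t * conj (dilate g j k s)) • Z s =
      levelProj g Z j t := by
    rw [levelProj]
    congr 1 with s
    have hk : Summable fun k : ℤ => dilate g j k t * conj (dilate g j k s) := by
      simp_rw [dilate_mul_conj]
      refine Summable.mul_left _ (Summable.of_norm (tsum_enorm_ne_top_iff_summable_norm.1 ?_))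
      simp only [enorm_mul, RCLike.enorm_conj]
      exact ((hS.tsum_kernel_le hg _ _).trans_lt ENNReal.ofReal_lt_top).ne
    rw [hk.tsum_smul_const]
    simp_rw [dilate_mul_conj]
    rw [tsum_mul_left, kernel]
  rw [hInt] at hs
  refine hs.congr_fun fun k => ?_
  simp_rw [mul_smul]
  rw [integral_smul]

/-- The projections converge pointwise. -/
theorem tendsto_levelProj (hfw : IsFWavelet fw m₀) (hS : AssumptionS fw Φ)
    (hc : Continuous fw) (hG : GrowthCondition c A x₀ Φ) (hZc : Continuous Z)
    (hZ : ∀ s, ‖Z s‖ ≤ c s) (t : ℝ) :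
    Tendsto (fun n => levelProj fw Z n t) atTop (𝓝 (Z t)) := by
  have hC := hS.constC_nonneg
  -- The substitution `s = t + 2^{-n} u` makes the kernel bound independent of `n`. As the kernel
  -- has integral 1, the integral of `F n` is the error of the projection, and dominated convergence
  -- with continuity of `Z` at `t` sends it to 0.
  set F : ℕ → ℝ → E := fun n u =>
    kernel fw (2 ^ n * t) (2 ^ n * t + u) • (Z (t + (1 / 2) ^ n * u) - Z t) with hF
  have hKb : ∀ (n : ℕ) (u : ℝ), ‖kernel fw (2 ^ n * t) (2 ^ n * t + u)‖ ≤
      2 * constC Φ * Φ (|u| / 2) := fun n u => by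
    have := norm_kernel_le hS hc (2 ^ n * t) (2 ^ n * t + u)
    rwa [show 2 ^ n * t - (2 ^ n * t + u) = -u by ring, abs_neg] at this
  have hKm : ∀ n : ℕ, Measurable fun u : ℝ => kernel fw (2 ^ n * t) (2 ^ n * t + u) := fun n =>
    (measurable_kernel hc _).comp (measurable_const_add _)
  have hFm : ∀ n, AEStronglyMeasurable (F n) volume := fun n =>
    (hKm n).aestronglyMeasurable.smul
      (by fun_prop : Continuous fun u : ℝ => Z (t + (1 / 2) ^ n * u) - Z t).aestronglyMeasurable
  have hZb : ∀ (n : ℕ) (u : ℝ), ‖Z (t + (1 / 2) ^ n * u)‖ ≤ c (2 * t) + c (2 * u) := fun n u => by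
    refine (hZ _).trans ((hG.add_le _ _).trans ?_)
    gcongr
    refine hG.le_of_abs_le ?_
    rw [abs_mul, abs_mul, abs_mul, abs_of_nonneg (by positivity : (0 : ℝ) ≤ (1 / 2) ^ n)]
    gcongr
    exact mul_le_of_le_one_left (abs_nonneg _) (pow_le_one₀ (by norm_num) (by norm_num))
  have hbd := (hG.integrable_dilated hS (c (2 * t) + c t)).const_mul (2 * constC Φ)
  have hFb : ∀ (n : ℕ) (u : ℝ), ‖F n u‖ ≤
      2 * constC Φ * (Φ (|u| / 2) * (c (2 * t) + c t + c (2 * u))) := fun n u => by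
    have hΦ := hS.nonneg (show 0 ≤ |u| / 2 by positivity)
    rw [hF, norm_smul]
    calc _ ≤ 2 * constC Φ * Φ (|u| / 2) * (c (2 * t) + c (2 * u) + c t) := by
          gcongr
          · exact hKb n u
          · exact (norm_sub_le _ _).trans (add_le_add (hZb n u) (hZ t))
      _ = _ := by ring
  have hlim : Tendsto (fun n => ∫ u, F n u) atTop (𝓝 (∫ _ : ℝ, (0 : E))) := by
    refine tendsto_integral_of_dominated_convergence _ hFm hbd
      (fun n => Eventually.of_forall (hFb n)) (Eventually.of_forall fun u => ?_)
    have h0 : Tendsto (fun n : ℕ => t + (1 / 2 : ℝ) ^ n * u) atTop (𝓝 t) := by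
      simpa using ((tendsto_pow_atTop_nhds_zero_of_lt_one (r := (1 / 2 : ℝ)) (by norm_num)
        (by norm_num)).mul_const u).const_add t
    have h1 : Tendsto (fun n : ℕ => ‖Z (t + (1 / 2) ^ n * u) - Z t‖) atTop (𝓝 0) :=
      tendsto_iff_norm_sub_tendsto_zero.1 ((hZc.tendsto t).comp h0)
    have h2 := h1.const_mul (2 * constC Φ * Φ (|u| / 2))
    rw [mul_zero] at h2
    refine squeeze_zero_norm (fun n => ?_) h2
    have hΦ := hS.nonneg (show 0 ≤ |u| / 2 by positivity)
    rw [hF, norm_smul]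
    gcongr
    exact hKb n u
  rw [integral_zero] at hlim
  have hKi : ∀ n : ℕ, Integrable fun u : ℝ => kernel fw (2 ^ n * t) (2 ^ n * t + u) := fun n => by
    refine ((hS.integrable.comp_div (two_ne_zero' ℝ)).const_mul (2 * constC Φ)).mono'
      (hKm n).aestronglyMeasurable (Eventually.of_forall fun u => ?_)
    rw [abs_div, abs_two]
    exact hKb n u
  have hKZ : ∀ n : ℕ, Integrable fun u : ℝ =>
      kernel fw (2 ^ n * t) (2 ^ n * t + u) • Z (t + (1 / 2) ^ n * u) := fun n => by
    refine ((hG.integrable_dilated hS (c (2 * t))).const_mul (2 * constC Φ)).mono'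
      ((hKm n).aestronglyMeasurable.smul (by fun_prop : Continuous fun u : ℝ =>
        Z (t + (1 / 2) ^ n * u)).aestronglyMeasurable) (Eventually.of_forall fun u => ?_)
    have hΦ := hS.nonneg (show 0 ≤ |u| / 2 by positivity)
    rw [norm_smul, ← mul_assoc]
    gcongr
    · exact hKb n u
    · exact hZb n u
  have hchange : ∀ n : ℕ, levelProj fw Z n t =
      ∫ u : ℝ, kernel fw (2 ^ n * t) (2 ^ n * t + u) • Z (t + (1 / 2) ^ n * u) := fun n => by
    have h2 : (2 : ℝ) ^ n ≠ 0 := by positivity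
    have h3 := Measure.integral_comp_mul_left (fun u : ℝ =>
      kernel fw (2 ^ n * t) (2 ^ n * t + u) • Z (t + (1 / 2) ^ n * u)) (2 ^ n)
    have h4 := integral_sub_right_eq_self (μ := (volume : Measure ℝ)) (fun s : ℝ =>
      kernel fw (2 ^ n * t) (2 ^ n * t + 2 ^ n * s) • Z (t + (1 / 2) ^ n * (2 ^ n * s))) t
    rw [h3, abs_of_nonneg (by positivity), eq_inv_smul_iff₀ h2] at h4
    rw [← h4, levelProj, ← integral_smul]
    congr 1 with s
    rw [← Complex.coe_smul, smul_smul]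
    push_cast
    congr 2
    · congr 1
      ring_nf
    · rw [one_div, inv_pow, inv_mul_cancel_left₀ h2]
      ring
  have hFint : ∀ n, ∫ u, F n u = levelProj fw Z n t - Z t := fun n => by
    simp only [hF, smul_sub]
    rw [integral_sub (hKZ n) ((hKi n).smul_const _), ← hchange, integral_smul_const,
      integral_add_left_eq_self (fun y => kernel fw (2 ^ n * t) y), hfw.integral_kernel hS hc,
      one_smul]
  simp_rw [hFint] at hlim
  exact tendsto_sub_nhds_zero_iff.1 hlim

theorem enorm_dilate (g : ℝ → ℂ) (j : ℕ) (k : ℤ) (t : ℝ) :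
    ‖dilate g j k t‖ₑ = ENNReal.ofReal ((2 : ℝ) ^ ((j : ℝ) / 2)) * ‖g (2 ^ j * t - k)‖ₑ := by
  rw [dilate, enorm_mul]
  congr 1
  rw [← ofReal_norm, Complex.norm_real, Real.norm_of_nonneg (by positivity)]

/-- Error bound for one truncated level. -/
theorem enorm_level_error_le (hG : GrowthCondition c A x₀ Φ) (hS : AssumptionS g Φ)
    (hg : Continuous g) (hZc : Continuous Z) (hZ : ∀ s, ‖Z s‖ ≤ c s) (j : ℕ) (t : ℝ)
    (s : Finset ℤ) {w : ℝ≥0∞}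
    (hw : ∑' k : ℤ, (if k ∈ s then 0 else ‖g (2 ^ j * t - k)‖ₑ) ≤ w) :
    ‖∑ k ∈ s, dilate g j k t • (∫ r : ℝ, conj (dilate g j k r) • Z r) - levelProj g Z j t‖ₑ ≤
      (⨆ k : ℤ, ‖∫ r : ℝ, conj (dilate g j k r) • Z r‖ₑ) *
        (ENNReal.ofReal ((2 : ℝ) ^ ((j : ℝ) / 2)) * w) := by
  refine (enorm_hasSum_sub_sum_le (hasSum_levelProj hG hS hg hZc hZ j t) s).trans ?_
  set S := ⨆ k : ℤ, ‖∫ r : ℝ, conj (dilate g j k r) • Z r‖ₑ with hSdef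
  have h1 : ∀ k : ℤ, (if k ∈ s then 0 else
      ‖dilate g j k t • ∫ r : ℝ, conj (dilate g j k r) • Z r‖ₑ) ≤
      S * (ENNReal.ofReal ((2 : ℝ) ^ ((j : ℝ) / 2)) *
        (if k ∈ s then 0 else ‖g (2 ^ j * t - k)‖ₑ)) := fun k => by
    split_ifs
    · simp
    · rw [enorm_smul, enorm_dilate, mul_comm]
      gcongr
      exact le_iSup (fun k : ℤ => ‖∫ r : ℝ, conj (dilate g j k r) • Z r‖ₑ) k
  refine (ENNReal.tsum_le_tsum h1).trans ?_
  rw [ENNReal.tsum_mul_left, ENNReal.tsum_mul_left]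
  gcongr

/-- Error bound for the truncated wavelet expansion. -/
theorem enorm_expansion_error_le (hfw : IsFWavelet fw m₀) (hmw : IsMWavelet fw m₀ mw)
    (hSf : AssumptionS fw Φ) (hfc : Continuous fw) (hSm : AssumptionS mw Φm)
    (hmc : Continuous mw) (hGf : GrowthCondition c A x₀ Φ) (hGm : GrowthCondition c A x₀ Φm)
    (hZc : Continuous Z) (hZ : ∀ s, ‖Z s‖ ≤ c s) (t : ℝ) (n : ℕ) (s₀ : Finset ℤ)
    (s : ℕ → Finset ℤ) {w₀ : ℝ≥0∞} {w : ℕ → ℝ≥0∞}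
    (hw₀ : ∑' k : ℤ, (if k ∈ s₀ then 0 else ‖fw (t - k)‖ₑ) ≤ w₀)
    (hw : ∀ j < n, ∑' k : ℤ, (if k ∈ s j then 0 else ‖mw (2 ^ j * t - k)‖ₑ) ≤ w j)
    (hw' : ∀ j, n ≤ j → ∑' k : ℤ, ‖mw (2 ^ j * t - k)‖ₑ ≤ w j) :
    ‖(∑ k ∈ s₀, dilate fw 0 k t • (∫ r : ℝ, conj (dilate fw 0 k r) • Z r) +
        ∑ j ∈ Finset.range n, ∑ k ∈ s j,
          dilate mw j k t • (∫ r : ℝ, conj (dilate mw j k r) • Z r)) - Z t‖ₑ ≤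
      (⨆ k : ℤ, ‖∫ r : ℝ, conj (dilate fw 0 k r) • Z r‖ₑ) * w₀ +
        ∑' j : ℕ, (⨆ k : ℤ, ‖∫ r : ℝ, conj (dilate mw j k r) • Z r‖ₑ) *
          (ENNReal.ofReal ((2 : ℝ) ^ ((j : ℝ) / 2)) * w j) := by
  -- Levels from `n` on are treated as truncated to the empty set, so that the same finite sum can
  -- be compared with the projection at any level `N ≥ n`.
  set s' : ℕ → Finset ℤ := fun j => if j < n then s j else ∅ with hs'
  set q : ℕ → E := fun j => ∑ k ∈ s' j,
    dilate mw j k t • (∫ r : ℝ, conj (dilate mw j k r) • Z r) with hq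
  set q₀ : E := ∑ k ∈ s₀, dilate fw 0 k t • (∫ r : ℝ, conj (dilate fw 0 k r) • Z r) with hq₀
  have hqn : ∑ j ∈ Finset.range n, ∑ k ∈ s j,
      dilate mw j k t • (∫ r : ℝ, conj (dilate mw j k r) • Z r) = ∑ j ∈ Finset.range n, q j :=
    Finset.sum_congr rfl fun j hj => by
      simp only [hq, hs', if_pos (Finset.mem_range.1 hj)]
  have hqN : ∀ N, n ≤ N → ∑ j ∈ Finset.range N, q j = ∑ j ∈ Finset.range n, q j := fun N hN => by
    symm
    refine Finset.sum_subset (Finset.range_subset_range.2 hN) fun j _ hj => ?_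
    rw [Finset.mem_range] at hj
    simp only [hq, hs', if_neg hj, Finset.sum_empty]
  have hlim : Tendsto (fun N => ‖(q₀ + ∑ j ∈ Finset.range n, q j) - levelProj fw Z N t‖ₑ) atTop
      (𝓝 ‖(q₀ + ∑ j ∈ Finset.range n, q j) - Z t‖ₑ) :=
    ((tendsto_levelProj hfw hSf hfc hGf hZc hZ t).const_sub _).enorm
  rw [hqn]
  -- The bound is uniform in `N ≥ n`, and the projections converge to `Z t`.
  refine le_of_tendsto hlim ?_
  filter_upwards [eventually_ge_atTop n] with N hN
  rw [levelProj_eq_add_sum hfw hmw hSf hfc hSm hmc hGf hGm hZc hZ N t, ← hqN N hN,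
    add_sub_add_comm, ← Finset.sum_sub_distrib]
  refine (enorm_add_le _ _).trans (add_le_add ?_ ?_)
  · have := enorm_level_error_le hGf hSf hfc hZc hZ 0 t s₀ (w := w₀) (by simpa using hw₀)
    simpa using this
  · refine (enorm_sum_le _ _).trans (le_trans (Finset.sum_le_sum fun j _ => ?_)
      (ENNReal.sum_le_tsum (Finset.range N)))
    refine enorm_level_error_le hGm hSm hmc hZc hZ j t (s' j) ?_
    by_cases hj : j < n
    · simpa only [hs', if_pos hj] using hw j hj
    · simpa only [hs', if_neg hj, Finset.notMem_empty, if_false] using hw' j (not_lt.1 hj)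

end Expansion

end SubGaussWavelet

namespace SubGaussWavelet

/-! ### Exponential moments of `φ`-sub-Gaussian families -/

namespace IsNFunction

variable {φ : ℝ → ℝ}

theorem nonneg (hφ : IsNFunction φ) (x : ℝ) : 0 ≤ φ x := by
  have h := hφ.convex.2 (Set.mem_univ x) (Set.mem_univ (-x))
    (show (0 : ℝ) ≤ 1 / 2 by norm_num) (show (0 : ℝ) ≤ 1 / 2 by norm_num) (by norm_num)
  simp only [smul_eq_mul, mul_neg, add_neg_cancel, hφ.zero, hφ.even] at h
  linarith

theorem abs_eq (hφ : IsNFunction φ) (x : ℝ) : φ |x| = φ x := by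
  rcases abs_choice x with h | h <;> rw [h]
  exact hφ.even x

theorem le_of_abs_le (hφ : IsNFunction φ) {x y : ℝ} (h : |x| ≤ |y|) : φ x ≤ φ y := by
  rw [← hφ.abs_eq x, ← hφ.abs_eq y]
  rcases (abs_nonneg x).eq_or_lt with h0 | h0
  · rw [← h0, hφ.zero]; exact hφ.nonneg _
  · exact hφ.strictMono.monotoneOn (Set.mem_Ioi.2 h0) (Set.mem_Ioi.2 (h0.trans_le h)) h

end IsNFunction

section ExpMoment

variable {Ω : Type*} [MeasurableSpace Ω] {P : Measure Ω} {φ : ℝ → ℝ} {ξ η : Ω → ℝ}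

theorem ExpMomentBound.mono (hφ : IsNFunction φ) {a b : ℝ} (h : ExpMomentBound φ P ξ a)
    (hab : |a| ≤ |b|) : ExpMomentBound φ P ξ b := fun l =>
  (h l).trans (ENNReal.ofReal_le_ofReal (Real.exp_le_exp.2 (hφ.le_of_abs_le (by
    rw [abs_mul, abs_mul]; gcongr))))

theorem expMomentBound_zero [IsProbabilityMeasure P] (hφ : IsNFunction φ) :
    ExpMomentBound φ P (fun _ => 0) 0 := fun l => by simp [hφ.zero]

theorem ExpMomentBound.const_mul (a : ℝ) {r : ℝ} (h : ExpMomentBound φ P ξ r) :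
    ExpMomentBound φ P (fun ω => a * ξ ω) (r * a) := fun l => by
  have := h (a * l)
  rw [← mul_assoc] at this
  refine le_trans (le_of_eq ?_) this
  congr 1 with ω
  congr 2
  ring

/-- The inequality `e^{l(ξ+η)} ≤ (e^{2lξ} + e^{2lη}) / 2` suffices: the constant is crude, but only
the existence of some bound will matter. -/
theorem ExpMomentBound.add (hφ : IsNFunction φ) {r q : ℝ} (hξ : ExpMomentBound φ P ξ r)
    (hη : ExpMomentBound φ P η q) (hm : AEMeasurable ξ P) :
    ExpMomentBound φ P (fun ω => ξ ω + η ω) (2 * (|r| + |q|)) := fun l => by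
  have hr : φ (r * (2 * l)) ≤ φ (2 * (|r| + |q|) * l) := hφ.le_of_abs_le (by
    simp only [abs_mul, abs_two, abs_of_nonneg (show 0 ≤ |r| + |q| by positivity)]
    nlinarith [abs_nonneg r, abs_nonneg q, abs_nonneg l, mul_nonneg (abs_nonneg q) (abs_nonneg l)])
  have hq : φ (q * (2 * l)) ≤ φ (2 * (|r| + |q|) * l) := hφ.le_of_abs_le (by
    simp only [abs_mul, abs_two, abs_of_nonneg (show 0 ≤ |r| + |q| by positivity)]
    nlinarith [abs_nonneg r, abs_nonneg q, abs_nonneg l, mul_nonneg (abs_nonneg r) (abs_nonneg l)])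
  have hpt : ∀ ω, ENNReal.ofReal (Real.exp (l * (ξ ω + η ω))) ≤
      ENNReal.ofReal (1 / 2) * ENNReal.ofReal (Real.exp (2 * l * ξ ω)) +
        ENNReal.ofReal (1 / 2) * ENNReal.ofReal (Real.exp (2 * l * η ω)) := fun ω => by
    rw [← ENNReal.ofReal_mul (by norm_num), ← ENNReal.ofReal_mul (by norm_num),
      ← ENNReal.ofReal_add (by positivity) (by positivity)]
    refine ENNReal.ofReal_le_ofReal ?_
    have h1 : Real.exp (2 * l * ξ ω) = Real.exp (l * ξ ω) ^ 2 := by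
      rw [← Real.exp_nat_mul]; congr 1; push_cast; ring
    have h2 : Real.exp (2 * l * η ω) = Real.exp (l * η ω) ^ 2 := by
      rw [← Real.exp_nat_mul]; congr 1; push_cast; ring
    rw [h1, h2, mul_add, Real.exp_add]
    nlinarith [sq_nonneg (Real.exp (l * ξ ω) - Real.exp (l * η ω))]
  refine (lintegral_mono hpt).trans ?_
  have hm' : AEMeasurable (fun ω =>
      ENNReal.ofReal (1 / 2) * ENNReal.ofReal (Real.exp (2 * l * ξ ω))) P := by fun_prop
  rw [lintegral_add_left' hm', lintegral_const_mul' _ _ ENNReal.ofReal_ne_top,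
    lintegral_const_mul' _ _ ENNReal.ofReal_ne_top]
  calc _ ≤ ENNReal.ofReal (1 / 2) * ENNReal.ofReal (Real.exp (φ (2 * (|r| + |q|) * l))) +
        ENNReal.ofReal (1 / 2) * ENNReal.ofReal (Real.exp (φ (2 * (|r| + |q|) * l))) := by
        refine add_le_add (mul_le_mul_right ?_ _) (mul_le_mul_right ?_ _)
        · exact (hξ (2 * l)).trans (ENNReal.ofReal_le_ofReal (Real.exp_le_exp.2 hr))
        · exact (hη (2 * l)).trans (ENNReal.ofReal_le_ofReal (Real.exp_le_exp.2 hq))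
    _ = _ := by
        rw [← add_mul, ← ENNReal.ofReal_add (by norm_num) (by norm_num)]
        norm_num

/-- Guarantees that the set in `subNorm` is nonempty for linear combinations. Otherwise its `sInf`
would be the default value 0, and a bound on `subNorm` would carry no information. -/
theorem exists_expMomentBound_sum [IsProbabilityMeasure P] (hφ : IsNFunction φ) {ι : Type*}
    {X : ι → Ω → ℝ} (hX : ∀ i, IsSub φ P (X i)) (s : Finset ι) (a : ι → ℝ) :
    ∃ r : ℝ, 0 ≤ r ∧ ExpMomentBound φ P (fun ω => ∑ i ∈ s, a i * X i ω) r := by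
  classical
  induction s using Finset.induction_on with
  | empty => exact ⟨0, le_rfl, by simpa using expMomentBound_zero hφ⟩
  | insert i s hi ih =>
    obtain ⟨r, -, hr⟩ := ih
    obtain ⟨hInt, -, q, -, hq⟩ := hX i
    refine ⟨2 * (|q * a i| + |r|), by positivity, ?_⟩
    simp_rw [Finset.sum_insert hi]
    exact (hq.const_mul (a i)).add hφ hr (hInt.aemeasurable.const_mul (a i))

/-- Every `b' > b` is admissible by definition of the infimum, and continuity of `φ` lets `b'`
decrease to `b`. -/
theorem expMomentBound_of_subNorm_le (hφ : IsNFunction φ)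
    (hex : ∃ r : ℝ, 0 ≤ r ∧ ExpMomentBound φ P ξ r) {b : ℝ} (hb : subNorm φ P ξ ≤ b) :
    ExpMomentBound φ P ξ b := fun l => by
  have hev : ∀ᶠ b' in 𝓝[>] b, ∫⁻ ω, ENNReal.ofReal (Real.exp (l * ξ ω)) ∂P ≤
      ENNReal.ofReal (Real.exp (φ (b' * l))) := by
    filter_upwards [self_mem_nhdsWithin] with b' hb'
    obtain ⟨a, ⟨ha0, ha⟩, hab⟩ := exists_lt_of_csInf_lt hex (hb.trans_lt hb')
    exact (ha.mono hφ (by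
      rw [abs_of_nonneg ha0, abs_of_nonneg (ha0.trans hab.le)]; exact hab.le)) l
  have hcont : Continuous fun b' : ℝ => ENNReal.ofReal (Real.exp (φ (b' * l))) :=
    ENNReal.continuous_ofReal.comp (Real.continuous_exp.comp
      (hφ.continuous.comp (continuous_mul_const l)))
  exact ge_of_tendsto ((hcont.tendsto b).mono_left nhdsWithin_le_nhds) hev

theorem ExpMomentBound.lintegral_cosh_le (hφ : IsNFunction φ) (hm : AEMeasurable ξ P) {b : ℝ}
    (h : ExpMomentBound φ P ξ b) (l : ℝ) :
    ∫⁻ ω, ENNReal.ofReal (Real.cosh (l * ξ ω)) ∂P ≤ ENNReal.ofReal (Real.exp (φ (b * l))) := by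
  have hpt : ∀ ω, ENNReal.ofReal (Real.cosh (l * ξ ω)) =
      ENNReal.ofReal (1 / 2) * ENNReal.ofReal (Real.exp (l * ξ ω)) +
        ENNReal.ofReal (1 / 2) * ENNReal.ofReal (Real.exp (-l * ξ ω)) := fun ω => by
    rw [← ENNReal.ofReal_mul (by norm_num), ← ENNReal.ofReal_mul (by norm_num),
      ← ENNReal.ofReal_add (by positivity) (by positivity), Real.cosh_eq, neg_mul]
    congr 1
    ring
  simp_rw [hpt]
  have hm' : AEMeasurable (fun ω =>
      ENNReal.ofReal (1 / 2) * ENNReal.ofReal (Real.exp (l * ξ ω))) P := by fun_prop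
  rw [lintegral_add_left' hm', lintegral_const_mul' _ _ ENNReal.ofReal_ne_top,
    lintegral_const_mul' _ _ ENNReal.ofReal_ne_top]
  have h2 := h (-l)
  rw [mul_neg, hφ.even] at h2
  calc _ ≤ ENNReal.ofReal (1 / 2) * ENNReal.ofReal (Real.exp (φ (b * l))) +
        ENNReal.ofReal (1 / 2) * ENNReal.ofReal (Real.exp (φ (b * l))) :=
        add_le_add (mul_le_mul_right (h l) _) (mul_le_mul_right h2 _)
    _ = _ := by
        rw [← add_mul, ← ENNReal.ofReal_add (by norm_num) (by norm_num)]
        norm_num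

end ExpMoment

/-- Convexity of `x ↦ cosh √x`, written for sums of two squares. -/
theorem cosh_sqrt_add_le {α β : ℝ} (hα : 0 < α) (hβ : 0 < β) (hαβ : α + β = 1) (u v : ℝ) :
    Real.cosh (Real.sqrt (u ^ 2 + v ^ 2)) ≤
      α * Real.cosh (u / Real.sqrt α) + β * Real.cosh (v / Real.sqrt β) := by
  have h0 := Real.hasSum_cosh (Real.sqrt (u ^ 2 + v ^ 2))
  have h1 := ((Real.hasSum_cosh (u / Real.sqrt α)).mul_left α).add
    ((Real.hasSum_cosh (v / Real.sqrt β)).mul_left β)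
  -- Power series are compared termwise: the `n`-th term is convexity of `x ↦ x^n` at `u²/α` and
  -- `v²/β` with weights `α`, `β`.
  refine hasSum_le (fun n => ?_) h0 h1
  rw [← mul_div_assoc, ← mul_div_assoc, ← add_div]
  gcongr
  rw [pow_mul, pow_mul, pow_mul, Real.sq_sqrt (by positivity), div_pow u (Real.sqrt α) 2,
    div_pow v (Real.sqrt β) 2, Real.sq_sqrt hα.le, Real.sq_sqrt hβ.le]
  have hconv := (convexOn_pow (𝕜 := ℝ) n).2 (Set.mem_Ici.2 (show 0 ≤ u ^ 2 / α by positivity))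
    (Set.mem_Ici.2 (show 0 ≤ v ^ 2 / β by positivity)) hα.le hβ.le hαβ
  simp only [smul_eq_mul] at hconv
  rwa [mul_div_cancel₀ _ hα.ne', mul_div_cancel₀ _ hβ.ne'] at hconv

section SquareIntegrable

variable {Ω : Type*} [MeasurableSpace Ω] {P : Measure Ω}

theorem memLp_ofReal {ξ : Ω → ℝ} (h : MemLp ξ 2 P) : MemLp (fun ω => (ξ ω : ℂ)) 2 P :=
  h.ofReal

theorem toL2_coeFn {ξ : Ω → ℝ} (h : MemLp ξ 2 P) : toL2 P ξ =ᵐ[P] fun ω => (ξ ω : ℂ) := by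
  rw [toL2, dif_pos (memLp_ofReal h)]
  exact MemLp.coeFn_toLp _

theorem norm_sq_eq_integral (Z : Lp ℂ 2 P) : ‖Z‖ ^ 2 = ∫ ω, ‖Z ω‖ ^ 2 ∂P := by
  have h := L2.inner_def (𝕜 := ℂ) Z Z
  rw [inner_self_eq_norm_sq_to_K] at h
  simp_rw [inner_self_eq_norm_sq_to_K] at h
  have h2 : (((‖Z‖ ^ 2 : ℝ)) : ℂ) = ((∫ ω, ‖Z ω‖ ^ 2 ∂P : ℝ) : ℂ) := by
    rw [← integral_complex_ofReal]
    push_cast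
    simpa using h
  exact_mod_cast h2

end SquareIntegrable

/-! ### From real linear combinations of the process to its closed complex span. -/

section Span

variable {Ω : Type*} [MeasurableSpace Ω] {P : Measure Ω} [IsProbabilityMeasure P]
  {φ : ℝ → ℝ} {ι : Type*} {X : ι → Ω → ℝ} {C : ℝ}

theorem IsStrictlySub.lintegral_cosh_le (hφ : IsNFunction φ) (hX : IsStrictlySub φ P X C)
    (s : Finset ι) (a : ι → ℝ) {σ : ℝ} (hσ0 : 0 ≤ σ)
    (hσ : ∫ ω, (∑ i ∈ s, a i * X i ω) ^ 2 ∂P ≤ σ ^ 2) (l : ℝ) :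
    ∫⁻ ω, ENNReal.ofReal (Real.cosh (l * ∑ i ∈ s, a i * X i ω)) ∂P ≤
      ENNReal.ofReal (Real.exp (φ (C * σ * l))) := by
  have hm : AEMeasurable (fun ω => ∑ i ∈ s, a i * X i ω) P :=
    Finset.aemeasurable_fun_sum _ fun i _ => (hX.1.1 i).1.aemeasurable.const_mul _
  refine (expMomentBound_of_subNorm_le hφ (exists_expMomentBound_sum hφ hX.1.1 s a)
    ((hX.2.2 s a).trans ?_)).lintegral_cosh_le hφ hm l
  have := hX.2.1
  gcongr
  exact (Real.sqrt_le_sqrt hσ).trans_eq (Real.sqrt_sq hσ0)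

/-- The weights in `cosh_sqrt_add_le` are chosen proportional to the second moments of real and
imaginary part. Both rescaled parts then have the same parameter `C * σ`, so the complex case has
the constant of the real one. -/
theorem IsStrictlySub.lintegral_cosh_complex_le (hφ : IsNFunction φ)
    (hX : IsStrictlySub φ P X C) (s : Finset ι) (a b : ι → ℝ) {σ : ℝ} (hσ0 : 0 < σ)
    (hσ : ∫ ω, (∑ i ∈ s, a i * X i ω) ^ 2 ∂P + ∫ ω, (∑ i ∈ s, b i * X i ω) ^ 2 ∂P < σ ^ 2)
    (l : ℝ) :
    ∫⁻ ω, ENNReal.ofReal (Real.cosh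
        (l * Real.sqrt ((∑ i ∈ s, a i * X i ω) ^ 2 + (∑ i ∈ s, b i * X i ω) ^ 2))) ∂P ≤
      ENNReal.ofReal (Real.exp (φ (C * σ * l))) := by
  set U : Ω → ℝ := fun ω => ∑ i ∈ s, a i * X i ω with hU
  set V : Ω → ℝ := fun ω => ∑ i ∈ s, b i * X i ω with hV
  have hmU : AEMeasurable U P :=
    Finset.aemeasurable_fun_sum _ fun i _ => (hX.1.1 i).1.aemeasurable.const_mul _
  set u := ∫ ω, U ω ^ 2 ∂P with hu
  set v := ∫ ω, V ω ^ 2 ∂P with hv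
  have hu0 : 0 ≤ u := integral_nonneg fun _ => by positivity
  have hv0 : 0 ≤ v := integral_nonneg fun _ => by positivity
  -- The slack in the strict inequality is shared equally: the weights stay positive even if one
  -- part vanishes, and they add up to 1.
  set δ := (σ ^ 2 - u - v) / 2 with hδ
  have hδ0 : 0 < δ := by rw [hδ]; linarith
  set α := (u + δ) / σ ^ 2 with hα
  set β := (v + δ) / σ ^ 2 with hβ
  have hα0 : 0 < α := by positivity
  have hβ0 : 0 < β := by positivity
  have hαβ : α + β = 1 := by
    rw [hα, hβ, hδ]; field_simp; ring
  have hsα := Real.sqrt_pos.2 hα0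
  have hsβ := Real.sqrt_pos.2 hβ0
  have hboundU : u ≤ (Real.sqrt α * σ) ^ 2 := by
    rw [mul_pow, Real.sq_sqrt hα0.le, hα, div_mul_cancel₀ _ (by positivity)]; linarith
  have hboundV : v ≤ (Real.sqrt β * σ) ^ 2 := by
    rw [mul_pow, Real.sq_sqrt hβ0.le, hβ, div_mul_cancel₀ _ (by positivity)]; linarith
  have hintU := hX.lintegral_cosh_le hφ s a (σ := Real.sqrt α * σ) (by positivity) hboundU
    (l / Real.sqrt α)
  have hintV := hX.lintegral_cosh_le hφ s b (σ := Real.sqrt β * σ) (by positivity) hboundV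
    (l / Real.sqrt β)
  rw [show C * (Real.sqrt α * σ) * (l / Real.sqrt α) = C * σ * l by field_simp] at hintU
  rw [show C * (Real.sqrt β * σ) * (l / Real.sqrt β) = C * σ * l by field_simp] at hintV
  have hpt : ∀ ω, ENNReal.ofReal (Real.cosh (l * Real.sqrt (U ω ^ 2 + V ω ^ 2))) ≤
      ENNReal.ofReal α * ENNReal.ofReal (Real.cosh (l / Real.sqrt α * U ω)) +
        ENNReal.ofReal β * ENNReal.ofReal (Real.cosh (l / Real.sqrt β * V ω)) := fun ω => by
    rw [← ENNReal.ofReal_mul hα0.le, ← ENNReal.ofReal_mul hβ0.le,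
      ← ENNReal.ofReal_add (by positivity) (by positivity)]
    refine ENNReal.ofReal_le_ofReal ?_
    have h1 := cosh_sqrt_add_le hα0 hβ0 hαβ (l * U ω) (l * V ω)
    have h2 : Real.cosh (l * Real.sqrt (U ω ^ 2 + V ω ^ 2)) =
        Real.cosh (Real.sqrt ((l * U ω) ^ 2 + (l * V ω) ^ 2)) := by
      rw [mul_pow, mul_pow, ← mul_add, Real.sqrt_mul (sq_nonneg l), Real.sqrt_sq_eq_abs,
        ← Real.cosh_abs, abs_mul, abs_of_nonneg (Real.sqrt_nonneg _)]
    rw [h2, show l / Real.sqrt α * U ω = l * U ω / Real.sqrt α by ring,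
      show l / Real.sqrt β * V ω = l * V ω / Real.sqrt β by ring]
    exact h1
  refine (lintegral_mono hpt).trans ?_
  have hm' : AEMeasurable (fun ω =>
      ENNReal.ofReal α * ENNReal.ofReal (Real.cosh (l / Real.sqrt α * U ω))) P := by fun_prop
  rw [lintegral_add_left' hm', lintegral_const_mul' _ _ ENNReal.ofReal_ne_top,
    lintegral_const_mul' _ _ ENNReal.ofReal_ne_top]
  calc _ ≤ ENNReal.ofReal α * ENNReal.ofReal (Real.exp (φ (C * σ * l))) +
        ENNReal.ofReal β * ENNReal.ofReal (Real.exp (φ (C * σ * l))) :=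
        add_le_add (mul_le_mul_right hintU _) (mul_le_mul_right hintV _)
    _ = _ := by
        rw [← add_mul, ← ENNReal.ofReal_add hα0.le hβ0.le, hαβ, ENNReal.ofReal_one, one_mul]

/-- The exponential moment bound on the closed complex span of the process. -/
theorem IsStrictlySub.lintegral_cosh_closure_le (hφ : IsNFunction φ)
    (hX : IsStrictlySub φ P X C) (hX2 : ∀ i, MemLp (X i) 2 P) {Z : Lp ℂ 2 P}
    (hZ : Z ∈ (Submodule.span ℂ (Set.range fun i => toL2 P (X i))).topologicalClosure)
    {σ : ℝ} (hσ : ‖Z‖ < σ) (l : ℝ) :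
    ∫⁻ ω, ENNReal.ofReal (Real.cosh (l * ‖Z ω‖)) ∂P ≤
      ENNReal.ofReal (Real.exp (φ (C * σ * l))) := by
  have hspan : ∀ W ∈ Submodule.span ℂ (Set.range fun i => toL2 P (X i)), ‖W‖ < σ →
      ∫⁻ ω, ENNReal.ofReal (Real.cosh (l * ‖W ω‖)) ∂P ≤
        ENNReal.ofReal (Real.exp (φ (C * σ * l))) := by
    intro W hW hWσ
    obtain ⟨z, rfl⟩ := (Finsupp.mem_span_range_iff_exists_finsupp).1 hW
    set W : Lp ℂ 2 P := z.sum fun i a => a • toL2 P (X i) with hWdef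
    have hWω : W =ᵐ[P] fun ω => ∑ i ∈ z.support, z i * (X i ω : ℂ) := by
      have h1 : W = ∑ i ∈ z.support, z i • toL2 P (X i) := rfl
      have h2 : ∀ᵐ ω ∂P, ∀ i ∈ z.support, (z i • toL2 P (X i) : Lp ℂ 2 P) ω =
          z i * (X i ω : ℂ) := by
        refine (ae_ball_iff z.support.countable_toSet).2 fun i _ => ?_
        filter_upwards [Lp.coeFn_smul (z i) (toL2 P (X i)), toL2_coeFn (hX2 i)] with ω h3 h4
        rw [h3, Pi.smul_apply, h4, smul_eq_mul]
      rw [h1]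
      filter_upwards [h2, Lp.coeFn_fun_finsetSum z.support fun i => z i • toL2 P (X i)] with ω h3 h4
      rw [h4]
      exact Finset.sum_congr rfl fun i hi => h3 i hi
    set a : ι → ℝ := fun i => (z i).re with ha
    set b : ι → ℝ := fun i => (z i).im with hb
    have hnorm : ∀ ω, ‖∑ i ∈ z.support, z i * (X i ω : ℂ)‖ =
        Real.sqrt ((∑ i ∈ z.support, a i * X i ω) ^ 2 + (∑ i ∈ z.support, b i * X i ω) ^ 2) := by
      intro ω
      rw [Complex.norm_eq_sqrt_sq_add_sq]
      simp [ha, hb]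
    have hsq : ∀ e : ι → ℝ, Integrable (fun ω => (∑ i ∈ z.support, e i * X i ω) ^ 2) P := by
      intro e
      have : MemLp (fun ω => ∑ i ∈ z.support, e i * X i ω) 2 P :=
        memLp_finsetSum _ fun i _ => (hX2 i).const_mul (e i)
      exact this.integrable_sq
    have hσW : ∫ ω, (∑ i ∈ z.support, a i * X i ω) ^ 2 ∂P +
        ∫ ω, (∑ i ∈ z.support, b i * X i ω) ^ 2 ∂P < σ ^ 2 := by
      rw [← integral_add (hsq a) (hsq b)]
      have h3 : ∫ ω, (∑ i ∈ z.support, a i * X i ω) ^ 2 + (∑ i ∈ z.support, b i * X i ω) ^ 2 ∂P =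
          ‖W‖ ^ 2 := by
        rw [norm_sq_eq_integral]
        refine integral_congr_ae (hWω.mono fun ω hω => ?_)
        simp only [hω, hnorm]
        rw [Real.sq_sqrt (by positivity)]
      rw [h3]
      exact pow_lt_pow_left₀ hWσ (norm_nonneg _) two_ne_zero
    have hfin := hX.lintegral_cosh_complex_le hφ z.support a b ((norm_nonneg _).trans_lt hWσ) hσW l
    refine le_trans (le_of_eq (lintegral_congr_ae (hWω.mono fun ω hω => ?_))) hfin
    simp only [hω, hnorm]
  -- Passage to the closure: convergence in `L_2` gives an a.e. convergent subsequence, and Fatou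
  -- preserves the bound.
  obtain ⟨W, hWmem, hWlim⟩ := mem_closure_iff_seq_limit.1 hZ
  have hmeas := tendstoInMeasure_of_tendsto_Lp hWlim
  obtain ⟨ns, hns, hae⟩ := hmeas.exists_seq_tendsto_ae
  have hev : ∀ᶠ n in atTop, ∫⁻ ω, ENNReal.ofReal (Real.cosh (l * ‖W (ns n) ω‖)) ∂P ≤
      ENNReal.ofReal (Real.exp (φ (C * σ * l))) := by
    have h1 : ∀ᶠ n in atTop, ‖W n‖ < σ := (hWlim.norm).eventually_lt_const hσ
    filter_upwards [hns.tendsto_atTop.eventually h1] with n hn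
    exact hspan _ (hWmem _) hn
  have hcont : Continuous fun y : ℂ => ENNReal.ofReal (Real.cosh (l * ‖y‖)) :=
    ENNReal.continuous_ofReal.comp (Real.continuous_cosh.comp (by fun_prop))
  calc ∫⁻ ω, ENNReal.ofReal (Real.cosh (l * ‖Z ω‖)) ∂P
      = ∫⁻ ω, liminf (fun n => ENNReal.ofReal (Real.cosh (l * ‖W (ns n) ω‖))) atTop ∂P := by
        refine lintegral_congr_ae (hae.mono fun ω hω => ?_)
        exact (((hcont.tendsto _).comp hω).liminf_eq).symm
    _ ≤ liminf (fun n => ∫⁻ ω, ENNReal.ofReal (Real.cosh (l * ‖W (ns n) ω‖)) ∂P) atTop :=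
        lintegral_liminf_le' fun n => hcont.measurable.comp_aemeasurable
          (Lp.aestronglyMeasurable (W (ns n))).aemeasurable
    _ ≤ ENNReal.ofReal (Real.exp (φ (C * σ * l))) :=
        liminf_le_of_frequently_le' hev.frequently

end Span

end SubGaussWavelet

namespace SubGaussWavelet

open scoped ComplexConjugate

/-! ### Moment and deviation bounds -/

/-- `y^s e^{-ly}` is largest at `y = s/l`, with value `(s/l)^s e^{-s}`; here this follows from `1 +
z ≤ e^z`. The factor 2 comes from `e^{ly} ≤ 2 cosh(ly)`. -/
theorem rpow_le_mul_cosh {y s l : ℝ} (hy : 0 ≤ y) (hs : 0 < s) (hl : 0 < l) :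
    y ^ s ≤ 2 * ((s / l) ^ s * Real.exp (-s)) * Real.cosh (l * y) := by
  have h1 : y ≤ s / l * Real.exp (l * y / s - 1) := by
    have h2 := Real.add_one_le_exp (l * y / s - 1)
    rw [sub_add_cancel] at h2
    calc y = s / l * (l * y / s) := by field_simp
      _ ≤ _ := by gcongr
  have h3 : Real.exp (l * y) ≤ 2 * Real.cosh (l * y) := by
    rw [Real.cosh_eq]; linarith [Real.exp_pos (-(l * y))]
  calc y ^ s ≤ (s / l * Real.exp (l * y / s - 1)) ^ s := Real.rpow_le_rpow hy h1 hs.le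
    _ = (s / l) ^ s * Real.exp (-s) * Real.exp (l * y) := by
        rw [Real.mul_rpow (by positivity) (by positivity), ← Real.exp_mul, mul_assoc,
          ← Real.exp_add]
        congr 2
        field_simp
        ring
    _ ≤ (s / l) ^ s * Real.exp (-s) * (2 * Real.cosh (l * y)) := by gcongr
    _ = _ := by ring

section Moments

variable {Ω : Type*} [MeasurableSpace Ω] {P : Measure Ω} [IsProbabilityMeasure P]
  {φ : ℝ → ℝ} {ι : Type*} {X : ι → Ω → ℝ} {C : ℝ}

theorem IsStrictlySub.lintegral_rpow_le (hφ : IsNFunction φ)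
    (hX : IsStrictlySub φ P X C) (hX2 : ∀ i, MemLp (X i) 2 P) {Z : Lp ℂ 2 P}
    (hZ : Z ∈ (Submodule.span ℂ (Set.range fun i => toL2 P (X i))).topologicalClosure)
    {σ : ℝ} (hσ0 : 0 < σ) (hσ : ‖Z‖ ≤ σ) {s a : ℝ} (hs : 0 < s) (ha : 0 < a) :
    ∫⁻ ω, ‖Z ω‖ₑ ^ s ∂P ≤
      ENNReal.ofReal (2 * ((s * (C * σ) / a) ^ s * Real.exp (-s)) * Real.exp (φ a)) := by
  have hC := hX.2.1
  -- With this `l` the exponent `φ (C * σ * l)` becomes `φ a`. The bound for strict inequality `‖Z‖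
  -- < b` is extended to `‖Z‖ ≤ σ` by letting `b` decrease to `σ`.
  set l := a / (C * σ) with hl
  have hl0 : 0 < l := by positivity
  have hcosh : ∫⁻ ω, ENNReal.ofReal (Real.cosh (l * ‖Z ω‖)) ∂P ≤
      ENNReal.ofReal (Real.exp (φ a)) := by
    have hcont : Continuous fun b : ℝ => ENNReal.ofReal (Real.exp (φ (C * b * l))) :=
      ENNReal.continuous_ofReal.comp (Real.continuous_exp.comp
        (hφ.continuous.comp (by fun_prop)))
    have hev : ∀ᶠ b in 𝓝[>] σ, ∫⁻ ω, ENNReal.ofReal (Real.cosh (l * ‖Z ω‖)) ∂P ≤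
        ENNReal.ofReal (Real.exp (φ (C * b * l))) := by
      filter_upwards [self_mem_nhdsWithin] with b hb
      exact hX.lintegral_cosh_closure_le hφ hX2 hZ (hσ.trans_lt hb) l
    have := ge_of_tendsto ((hcont.tendsto σ).mono_left nhdsWithin_le_nhds) hev
    rwa [show C * σ * l = a by rw [hl]; field_simp] at this
  have hpt : ∀ ω, ‖Z ω‖ₑ ^ s ≤ ENNReal.ofReal (2 * ((s / l) ^ s * Real.exp (-s))) *
      ENNReal.ofReal (Real.cosh (l * ‖Z ω‖)) := fun ω => by
    rw [← ENNReal.ofReal_mul (by positivity), ← ofReal_norm,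
      ENNReal.ofReal_rpow_of_nonneg (norm_nonneg _) hs.le]
    exact ENNReal.ofReal_le_ofReal (rpow_le_mul_cosh (norm_nonneg _) hs hl0)
  refine (lintegral_mono hpt).trans ?_
  rw [lintegral_const_mul' _ _ ENNReal.ofReal_ne_top,
    show s * (C * σ) / a = s / l by rw [hl]; field_simp]
  refine (mul_le_mul_right hcosh _).trans_eq ?_
  rw [← ENNReal.ofReal_mul (by positivity)]

/-- Markov's inequality for the `L_p([0,T])` norm of a process with bounded moments. -/
theorem measure_lt_lintegral_rpow_le {Y : ℝ → Ω → ℂ} (hY : Measurable (Function.uncurry Y))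
    {p s T ε : ℝ} (hp : 0 < p) (hps : p ≤ s) (hε : 0 < ε) {M : ℝ≥0∞}
    (hM : ∀ t ∈ Set.Icc 0 T, ∫⁻ ω, ‖Y t ω‖ₑ ^ s ∂P ≤ M) :
    P {ω | ENNReal.ofReal ε < ∫⁻ t in Set.Icc 0 T, ‖Y t ω‖ₑ ^ p} ≤
      ENNReal.ofReal T ^ (s / p) * M / ENNReal.ofReal ε ^ (s / p) := by
  have hs : 0 < s := hp.trans_le hps
  have hYt : ∀ ω, Measurable fun t => Y t ω := fun ω => hY.comp measurable_prodMk_right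
  have hYs : ∀ r : ℝ, Measurable fun q : Ω × ℝ => ‖Y q.2 q.1‖ₑ ^ r := fun r =>
    ((hY.comp measurable_swap).enorm).pow_const r
  set L : Ω → ℝ≥0∞ := fun ω => ∫⁻ t in Set.Icc 0 T, ‖Y t ω‖ₑ ^ p with hL
  have hLm : Measurable L := (hYs p).lintegral_prod_right' (ν := volume.restrict (Set.Icc 0 T))
  have hvol : (volume.restrict (Set.Icc 0 T)) Set.univ = ENNReal.ofReal T := by simp
  -- Jensen on `[0,T]` for the power `s / p ≥ 1`, so that Fubini reduces the expectation to
  -- pointwise moments of order `s`.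
  have hjensen : ∀ ω, L ω ^ (s / p) ≤
      ENNReal.ofReal T ^ (s / p - 1) * ∫⁻ t in Set.Icc 0 T, ‖Y t ω‖ₑ ^ s := fun ω => by
    have h1 := eLpNorm'_le_eLpNorm'_mul_rpow_measure_univ (μ := volume.restrict (Set.Icc 0 T))
      hp hps (hYt ω).aestronglyMeasurable
    rw [hvol, eLpNorm', eLpNorm'] at h1
    have h2 := ENNReal.rpow_le_rpow h1 hs.le
    rw [ENNReal.mul_rpow_of_nonneg _ _ hs.le, ← ENNReal.rpow_mul, ← ENNReal.rpow_mul,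
      ← ENNReal.rpow_mul, one_div_mul_cancel hs.ne', ENNReal.rpow_one,
      show 1 / p * s = s / p by ring,
      show (1 / p - 1 / s) * s = s / p - 1 by field_simp] at h2
    rw [mul_comm]
    exact h2
  have hexp : ∫⁻ ω, L ω ^ (s / p) ∂P ≤ ENNReal.ofReal T ^ (s / p) * M := by
    calc ∫⁻ ω, L ω ^ (s / p) ∂P
        ≤ ∫⁻ ω, ENNReal.ofReal T ^ (s / p - 1) * (∫⁻ t in Set.Icc 0 T, ‖Y t ω‖ₑ ^ s) ∂P :=
          lintegral_mono hjensen
      _ = ENNReal.ofReal T ^ (s / p - 1) * ∫⁻ ω, (∫⁻ t in Set.Icc 0 T, ‖Y t ω‖ₑ ^ s) ∂P :=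
          lintegral_const_mul _ ((hYs s).lintegral_prod_right'
            (ν := volume.restrict (Set.Icc 0 T)))
      _ = ENNReal.ofReal T ^ (s / p - 1) * ∫⁻ t in Set.Icc 0 T, ∫⁻ ω, ‖Y t ω‖ₑ ^ s ∂P := by
          rw [lintegral_lintegral_swap (hYs s).aemeasurable]
      _ ≤ ENNReal.ofReal T ^ (s / p - 1) * ∫⁻ _ in Set.Icc 0 T, M := by
          refine mul_le_mul_right ?_ _
          exact setLIntegral_mono' measurableSet_Icc hM
      _ = ENNReal.ofReal T ^ (s / p) * M := by
          rw [setLIntegral_const, Real.volume_Icc, sub_zero, mul_comm M, ← mul_assoc]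
          congr 1
          conv_lhs => rw [← ENNReal.rpow_one (ENNReal.ofReal T)]
          rw [ENNReal.rpow_one, mul_comm]
          have h1 : (0 : ℝ) ≤ s / p - 1 := by
            rw [sub_nonneg, le_div_iff₀ hp]; linarith
          conv_rhs => rw [show s / p = 1 + (s / p - 1) by ring,
            ENNReal.rpow_add_of_nonneg _ _ zero_le_one h1, ENNReal.rpow_one]
  have hε' : ENNReal.ofReal ε ^ (s / p) ≠ 0 := by
    simp [ENNReal.rpow_eq_zero_iff, hε]
  have hε'' : ENNReal.ofReal ε ^ (s / p) ≠ ∞ :=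
    ENNReal.rpow_ne_top_of_nonneg (by positivity) ENNReal.ofReal_ne_top
  calc P {ω | ENNReal.ofReal ε < L ω}
      ≤ P {ω | ENNReal.ofReal ε ^ (s / p) ≤ L ω ^ (s / p)} :=
        measure_mono fun ω hω => ENNReal.rpow_le_rpow (le_of_lt hω) (by positivity)
    _ ≤ (∫⁻ ω, L ω ^ (s / p) ∂P) / ENNReal.ofReal ε ^ (s / p) :=
        meas_ge_le_lintegral_div (hLm.pow_const _).aemeasurable hε' hε''
    _ ≤ _ := by gcongr

end Moments

/-! ### Optimization of the exponential bound -/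

section Optimization

variable {φ f : ℝ → ℝ}

theorem IsDensity.nonneg (hf : IsDensity φ f) {x : ℝ} (hx : 0 ≤ x) : 0 ≤ f x := by
  rw [← hf.zero]
  exact hf.monotoneOn (Set.mem_Ici.2 le_rfl) (Set.mem_Ici.2 hx) hx

theorem IsDensity.intervalIntegrable (hf : IsDensity φ f) {a b : ℝ} (ha : 0 ≤ a) (hb : 0 ≤ b) :
    IntervalIntegrable f volume a b :=
  MonotoneOn.intervalIntegrable (hf.monotoneOn.mono fun _ hx =>
    Set.mem_Ici.2 ((le_inf ha hb).trans hx.1))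

/-- If `f b ≤ x`, then on `[-b, b]` the function `y ↦ x y - φ y` is bounded by its value at `b`. -/
theorem IsDensity.mul_sub_le (hf : IsDensity φ f) {x b y : ℝ} (hx : 0 ≤ x) (hb : f b ≤ x)
    (hy : |y| ≤ b) : x * y - φ y ≤ x * b - φ b := by
  have hb0 : 0 ≤ b := (abs_nonneg y).trans hy
  have h1 : φ b - φ y = ∫ v in |y|..b, f v := by
    rw [hf.integral_eq, hf.integral_eq y, abs_of_nonneg hb0,
      intervalIntegral.integral_interval_sub_left (hf.intervalIntegrable le_rfl hb0)
        (hf.intervalIntegrable le_rfl (abs_nonneg y))]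
  have h2 : ∫ v in |y|..b, f v ≤ ∫ _ in |y|..b, x := by
    refine intervalIntegral.integral_mono_on hy
      (hf.intervalIntegrable (abs_nonneg y) hb0) (by simp) fun v hv => ?_
    exact (hf.monotoneOn (Set.mem_Ici.2 ((abs_nonneg y).trans hv.1)) (Set.mem_Ici.2 hb0)
      hv.2).trans hb
  rw [intervalIntegral.integral_const, smul_eq_mul] at h2
  have h3 : x * y ≤ x * |y| := mul_le_mul_of_nonneg_left (le_abs_self y) hx
  nlinarith

/-- A family of exponential bounds, for all sufficiently large parameters, yields the bound by the
Young–Fenchel transform. -/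
theorem le_exp_neg_youngFenchel (hf : IsDensity φ f) {x b : ℝ} (hx : 0 < x)
    (hfb : f b ≤ x) {q : ℝ≥0∞}
    (hq : ∀ a, b ≤ a → q ≤ ENNReal.ofReal (2 * Real.exp (-(x * a - φ a)))) :
    q ≤ ENNReal.ofReal (2 * Real.exp (-youngFenchel φ x)) := by
  have hall : ∀ y, q ≤ ENNReal.ofReal (2 * Real.exp (-(x * y - φ y))) := fun y => by
    rcases le_total |y| b with h | h
    · refine (hq b le_rfl).trans (ENNReal.ofReal_le_ofReal ?_)
      have := hf.mul_sub_le hx.le hfb h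
      gcongr
    · refine (hq |y| h).trans (ENNReal.ofReal_le_ofReal ?_)
      have h3 : x * y ≤ x * |y| := mul_le_mul_of_nonneg_left (le_abs_self y) hx.le
      have h4 : φ |y| = φ y := by rw [hf.integral_eq, abs_abs, ← hf.integral_eq]
      rw [h4]
      gcongr
  have hqt : q ≠ ∞ := ne_top_of_le_ne_top ENNReal.ofReal_ne_top (hall 0)
  rcases eq_or_ne q 0 with h0 | h0
  · rw [h0]; exact zero_le
  have hqr : 0 < q.toReal := ENNReal.toReal_pos h0 hqt
  -- Each bound says that `x y - φ y ≤ log (2 / q)`, so the supremum satisfies it too, whether or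
  -- not it is attained.
  have hsup : youngFenchel φ x ≤ Real.log (2 / q.toReal) := by
    refine ciSup_le fun y => ?_
    have h1 := ENNReal.toReal_mono ENNReal.ofReal_ne_top (hall y)
    rw [ENNReal.toReal_ofReal (by positivity)] at h1
    rw [Real.le_log_iff_exp_le (by positivity), le_div_iff₀ hqr]
    calc Real.exp (x * y - φ y) * q.toReal
        ≤ Real.exp (x * y - φ y) * (2 * Real.exp (-(x * y - φ y))) := by gcongr
      _ = 2 := by rw [mul_left_comm, ← Real.exp_add]; simp
  rw [← ENNReal.ofReal_toReal hqt]
  refine ENNReal.ofReal_le_ofReal ?_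
  calc q.toReal = 2 * Real.exp (-Real.log (2 / q.toReal)) := by
        rw [Real.exp_neg, Real.exp_log (by positivity)]; field_simp
    _ ≤ _ := by gcongr

end Optimization

end SubGaussWavelet

namespace SubGaussWavelet

open scoped ComplexConjugate

/-! ### The process as a curve in `L_2(Ω)` -/

section Curve

variable {Ω : Type*} [MeasurableSpace Ω] {P : Measure Ω} {X : ℝ → Ω → ℝ}

theorem norm_toL2_sq {ξ : Ω → ℝ} (h : MemLp ξ 2 P) : ‖toL2 P ξ‖ ^ 2 = ∫ ω, ξ ω ^ 2 ∂P := by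
  rw [norm_sq_eq_integral]
  refine integral_congr_ae ((toL2_coeFn h).mono fun ω hω => ?_)
  simp [hω]

theorem norm_toL2_le {c : ℝ → ℝ} (hX2 : ∀ t, MemLp (X t) 2 P)
    (hRc : ∀ t, Real.sqrt |cov P X t t| ≤ c t) (t : ℝ) : ‖toL2 P (X t)‖ ≤ c t := by
  refine le_trans (le_of_eq ?_) (hRc t)
  have h : cov P X t t = ‖toL2 P (X t)‖ ^ 2 := by
    rw [norm_toL2_sq (hX2 t), cov]
    congr 1 with ω
    ring
  rw [h, abs_of_nonneg (by positivity), Real.sqrt_sq (norm_nonneg _)]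

theorem norm_toL2_sub_sq (hX2 : ∀ t, MemLp (X t) 2 P) (t s : ℝ) :
    ‖toL2 P (X t) - toL2 P (X s)‖ ^ 2 = cov P X t t - 2 * cov P X t s + cov P X s s := by
  have hInt : ∀ a b, Integrable (fun ω => X a ω * X b ω) P := fun a b =>
    (hX2 a).integrable_mul (hX2 b)
  have hd : Integrable (fun ω => X t ω * X t ω - 2 * (X t ω * X s ω)) P :=
    (hInt t t).sub ((hInt t s).const_mul 2)
  rw [norm_sq_eq_integral, cov, cov, cov, ← integral_const_mul,
    ← integral_sub (hInt t t) ((hInt t s).const_mul 2), ← integral_add hd (hInt s s)]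
  refine integral_congr_ae ?_
  filter_upwards [Lp.coeFn_sub (toL2 P (X t)) (toL2 P (X s)), toL2_coeFn (hX2 t),
    toL2_coeFn (hX2 s)] with ω h1 h2 h3
  rw [h1, Pi.sub_apply, h2, h3, ← Complex.ofReal_sub, Complex.norm_real, Real.norm_eq_abs, sq_abs]
  ring

/-- The squared distance of two values of the curve is `R(t,t) - 2R(t,s) + R(s,s)`, which tends to 0
as `t → s`. -/
theorem continuous_toL2 (hX2 : ∀ t, MemLp (X t) 2 P)
    (hR : Continuous fun q : ℝ × ℝ => cov P X q.1 q.2) : Continuous fun t => toL2 P (X t) := by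
  refine continuous_iff_continuousAt.2 fun s => tendsto_iff_norm_sub_tendsto_zero.2 ?_
  have h1 : Continuous fun t => cov P X t t - 2 * cov P X t s + cov P X s s :=
    ((hR.comp (continuous_id.prodMk continuous_id)).sub (continuous_const.mul
      (hR.comp (continuous_id.prodMk continuous_const)))).add continuous_const
  have h2 := (Real.continuous_sqrt.comp h1).tendsto s
  have h3 : (Real.sqrt ∘ fun t => cov P X t t - 2 * cov P X t s + cov P X s s) =
      fun t => ‖toL2 P (X t) - toL2 P (X s)‖ := by
    ext t
    rw [Function.comp_apply, ← norm_toL2_sub_sq hX2, Real.sqrt_sq (norm_nonneg _)]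
  rw [h3] at h2
  simpa using h2

/-- The closed span of the process in `L_2(Ω)`. -/
noncomputable def closedSpan (P : Measure Ω) (X : ℝ → Ω → ℝ) : Submodule ℂ (Lp ℂ 2 P) :=
  (Submodule.span ℂ (Set.range fun t => toL2 P (X t))).topologicalClosure

theorem toL2_mem_closedSpan (t : ℝ) : toL2 P (X t) ∈ closedSpan P X :=
  Submodule.le_topologicalClosure _ (Submodule.subset_span ⟨t, rfl⟩)

/-- A closed subspace is its double orthogonal complement, and inner products commute with the
integral. For a non-integrable function the default value 0 also lies in the subspace. -/
theorem integral_mem_closedSpan {v : ℝ → Lp ℂ 2 P} (hv : ∀ t, v t ∈ closedSpan P X) :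
    ∫ t, v t ∈ closedSpan P X := by
  by_cases hi : Integrable v
  · have hcl : IsClosed (closedSpan P X : Set (Lp ℂ 2 P)) := Submodule.isClosed_topologicalClosure _
    have : CompleteSpace (closedSpan P X) := hcl.completeSpace_coe
    rw [← Submodule.orthogonal_orthogonal (closedSpan P X), Submodule.mem_orthogonal]
    intro u hu
    rw [← integral_inner hi]
    refine (integral_congr_ae (Eventually.of_forall fun t => ?_)).trans (integral_zero ℝ ℂ)
    exact (Submodule.mem_orthogonal' _ _).1 hu _ (hv t)
  · rw [integral_undef hi]
    exact Submodule.zero_mem _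

theorem coeff_mem_closedSpan (g : ℝ → ℂ) : coeff P X g ∈ closedSpan P X :=
  integral_mem_closedSpan fun t => Submodule.smul_mem _ _ (toL2_mem_closedSpan t)

/-- The approximation error as an element of `L_2(Ω)`. -/
noncomputable def errorL2 (P : Measure Ω) (X : ℝ → Ω → ℝ) (fw mw : ℝ → ℂ) (n k0 : ℕ) (k : ℕ → ℕ)
    (t : ℝ) : Lp ℂ 2 P :=
  (∑ i ∈ Finset.Icc (-(k0 : ℤ)) (k0 : ℤ), dilate fw 0 i t • xi P X fw i +
    ∑ j ∈ Finset.range n, ∑ i ∈ Finset.Icc (-(k j : ℤ)) (k j : ℤ),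
      dilate mw j i t • eta P X mw j i) - toL2 P (X t)

variable {fw mw : ℝ → ℂ}

theorem errorL2_mem_closedSpan (n k0 : ℕ) (k : ℕ → ℕ) (t : ℝ) :
    errorL2 P X fw mw n k0 k t ∈ closedSpan P X := by
  refine Submodule.sub_mem _ (Submodule.add_mem _ ?_ ?_) (toL2_mem_closedSpan t)
  · exact Submodule.sum_mem _ fun i _ => Submodule.smul_mem _ _ (coeff_mem_closedSpan _)
  · exact Submodule.sum_mem _ fun j _ => Submodule.sum_mem _ fun i _ =>
      Submodule.smul_mem _ _ (coeff_mem_closedSpan _)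

theorem coeFn_sum_smul (s : Finset ℤ) (a : ℤ → ℂ) (v : ℤ → Lp ℂ 2 P) :
    (∑ i ∈ s, a i • v i : Lp ℂ 2 P) =ᵐ[P] fun ω => ∑ i ∈ s, v i ω * a i := by
  have h1 : ∀ᵐ ω ∂P, ∀ i : ℤ, (a i • v i : Lp ℂ 2 P) ω = v i ω * a i :=
    ae_all_iff.2 fun i => (Lp.coeFn_smul (a i) (v i)).mono fun ω hω => by
      rw [hω, Pi.smul_apply, smul_eq_mul, mul_comm]
  filter_upwards [h1, Lp.coeFn_fun_finsetSum s fun i => a i • v i] with ω h2 h3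
  rw [h3]
  exact Finset.sum_congr rfl fun i _ => h2 i

/-- Links the Hilbert space error with the trajectories of `approx`, which use fixed representatives
of the coefficients. The exceptional null set may depend on `t`; this is harmless, since only
moments at fixed `t` are used. -/
theorem errorL2_coeFn (hX2 : ∀ t, MemLp (X t) 2 P) (n k0 : ℕ) (k : ℕ → ℕ) (t : ℝ) :
    errorL2 P X fw mw n k0 k t =ᵐ[P] fun ω => approx P X fw mw n k0 k t ω - (X t ω : ℂ) := by
  have h2 : ∀ᵐ ω ∂P, ∀ j : ℕ, (∑ i ∈ Finset.Icc (-(k j : ℤ)) (k j : ℤ),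
      dilate mw j i t • eta P X mw j i : Lp ℂ 2 P) ω =
      ∑ i ∈ Finset.Icc (-(k j : ℤ)) (k j : ℤ), eta P X mw j i ω * dilate mw j i t :=
    ae_all_iff.2 fun j => coeFn_sum_smul _ _ _
  rw [errorL2]
  filter_upwards [Lp.coeFn_sub (∑ i ∈ Finset.Icc (-(k0 : ℤ)) (k0 : ℤ),
      dilate fw 0 i t • xi P X fw i + ∑ j ∈ Finset.range n,
      ∑ i ∈ Finset.Icc (-(k j : ℤ)) (k j : ℤ), dilate mw j i t • eta P X mw j i) (toL2 P (X t)),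
    Lp.coeFn_add (∑ i ∈ Finset.Icc (-(k0 : ℤ)) (k0 : ℤ), dilate fw 0 i t • xi P X fw i)
      (∑ j ∈ Finset.range n, ∑ i ∈ Finset.Icc (-(k j : ℤ)) (k j : ℤ),
        dilate mw j i t • eta P X mw j i),
    coeFn_sum_smul (P := P) (Finset.Icc (-(k0 : ℤ)) (k0 : ℤ)) (fun i => dilate fw 0 i t)
      (fun i => xi P X fw i),
    Lp.coeFn_fun_finsetSum (Finset.range n) fun j => ∑ i ∈ Finset.Icc (-(k j : ℤ)) (k j : ℤ),
        dilate mw j i t • eta P X mw j i, h2, toL2_coeFn (hX2 t)] with ω e1 e2 e3 e4 e5 e6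
  rw [e1, Pi.sub_apply, e2, Pi.add_apply, e3, e4, e6, approx]
  simp_rw [e5]

theorem measurable_approx (hfc : Continuous fw) (hmc : Continuous mw) (n k0 : ℕ) (k : ℕ → ℕ) :
    Measurable (Function.uncurry (approx P X fw mw n k0 k)) := by
  have hterm : ∀ {g : ℝ → ℂ}, Continuous g → ∀ (j : ℕ) (i : ℤ) (v : Lp ℂ 2 P),
      Measurable fun q : ℝ × Ω => v q.2 * dilate g j i q.1 := fun hg j i v =>
    ((Lp.stronglyMeasurable v).measurable.comp measurable_snd).mul
      ((continuous_dilate hg j i).measurable.comp measurable_fst)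
  unfold approx Function.uncurry
  refine Measurable.add ?_ ?_
  · exact Finset.measurable_fun_sum _ fun i _ => hterm hfc 0 i _
  · exact Finset.measurable_fun_sum _ fun j _ => Finset.measurable_fun_sum _ fun i _ =>
      hterm hmc j i _

theorem continuous_approx (hfc : Continuous fw) (hmc : Continuous mw) (n k0 : ℕ) (k : ℕ → ℕ)
    (ω : Ω) : Continuous fun t => approx P X fw mw n k0 k t ω := by
  unfold approx
  refine Continuous.add ?_ ?_
  · exact continuous_finsetSum _ fun i _ => continuous_const.mul (continuous_dilate hfc 0 i)
  · exact continuous_finsetSum _ fun j _ => continuous_finsetSum _ fun i _ =>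
      continuous_const.mul (continuous_dilate hmc j i)

theorem inLp_approx (hfc : Continuous fw) (hmc : Continuous mw) (p T : ℝ) (n k0 : ℕ)
    (k : ℕ → ℕ) : InLp P (approx P X fw mw n k0 k) p T := by
  refine Eventually.of_forall fun ω => ?_
  have hc := continuous_approx (P := P) (X := X) hfc hmc n k0 k ω
  obtain ⟨B, hB⟩ := (isCompact_Icc (a := (0 : ℝ)) (b := T)).exists_bound_of_continuousOn
    hc.continuousOn
  exact MemLp.of_bound hc.aestronglyMeasurable B
    ((ae_restrict_iff' measurableSet_Icc).2 (Eventually.of_forall hB))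

variable [IsProbabilityMeasure P] {φ : ℝ → ℝ} {C : ℝ}

/-- Deviation bound for the `L_p` error in terms of a uniform bound of the mean-square error. -/
theorem IsStrictlySub.measure_lpError_le (hφ : IsNFunction φ) (hX : IsStrictlySub φ P X C)
    (hX2 : ∀ t, MemLp (X t) 2 P) (hXm : Measurable (Function.uncurry X))
    (hfc : Continuous fw) (hmc : Continuous mw) {p T σ s a ε : ℝ} (hp : 0 < p) (hps : p ≤ s)
    (hσ0 : 0 < σ) (ha : 0 < a) (hε : 0 < ε) (n k0 : ℕ) (k : ℕ → ℕ)
    (hσ : ∀ t ∈ Set.Icc 0 T, ‖errorL2 P X fw mw n k0 k t‖ ≤ σ) :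
    P {ω | ENNReal.ofReal ε < lpError P X fw mw p T n k0 k ω} ≤
      ENNReal.ofReal T ^ (s / p) * ENNReal.ofReal
        (2 * ((s * (C * σ) / a) ^ s * Real.exp (-s)) * Real.exp (φ a)) /
          ENNReal.ofReal ε ^ (s / p) := by
  have hYm : Measurable (Function.uncurry fun t ω =>
      approx P X fw mw n k0 k t ω - (X t ω : ℂ)) :=
    (measurable_approx hfc hmc n k0 k).sub (Complex.measurable_ofReal.comp hXm)
  refine measure_lt_lintegral_rpow_le hYm hp hps hε fun t ht => ?_
  refine le_trans (le_of_eq (lintegral_congr_ae ((errorL2_coeFn (fw := fw) (mw := mw)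
    hX2 n k0 k t).mono fun ω hω => ?_))) (hX.lintegral_rpow_le hφ hX2
      (errorL2_mem_closedSpan (fw := fw) (mw := mw) n k0 k t) hσ0 (hσ t ht) (hp.trans_le hps) ha)
  simp only [hω]

theorem measure_lpError_eq_zero (hX2 : ∀ t, MemLp (X t) 2 P)
    (hXm : Measurable (Function.uncurry X)) (hfc : Continuous fw) (hmc : Continuous mw)
    {p T ε : ℝ} (hp : 0 < p) (hε : 0 < ε) (n k0 : ℕ) (k : ℕ → ℕ)
    (hσ : ∀ t ∈ Set.Icc 0 T, errorL2 P X fw mw n k0 k t = 0) :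
    P {ω | ENNReal.ofReal ε < lpError P X fw mw p T n k0 k ω} = 0 := by
  have hYm : Measurable (Function.uncurry fun t ω =>
      approx P X fw mw n k0 k t ω - (X t ω : ℂ)) :=
    (measurable_approx hfc hmc n k0 k).sub (Complex.measurable_ofReal.comp hXm)
  have h := measure_lt_lintegral_rpow_le (P := P) hYm hp le_rfl hε (M := 0) (T := T)
    fun t ht => by
      rw [nonpos_iff_eq_zero]
      refine (lintegral_congr_ae ?_).trans lintegral_zero
      filter_upwards [errorL2_coeFn (fw := fw) (mw := mw) hX2 n k0 k t, Lp.coeFn_zero ℂ 2 P]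
        with ω h1 h2
      rw [hσ t ht, h2] at h1
      rw [← h1]
      simp [hp]
  rw [mul_zero, ENNReal.zero_div] at h
  exact nonpos_iff_eq_zero.1 h

/-- The `p`-th moments are bounded on `[0,T]` by the moment estimate with `s = p`, `a = 1`; Fubini
then makes the trajectory integral finite almost surely. -/
theorem IsStrictlySub.inLp (hφ : IsNFunction φ) (hX : IsStrictlySub φ P X C)
    (hX2 : ∀ t, MemLp (X t) 2 P) (hXm : Measurable (Function.uncurry X)) {p T σ : ℝ}
    (hp : 0 < p) (hσ0 : 0 < σ) (hσ : ∀ t ∈ Set.Icc 0 T, ‖toL2 P (X t)‖ ≤ σ) :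
    InLp P (fun t ω => (X t ω : ℂ)) p T := by
  have hYm : Measurable (Function.uncurry fun t ω => (X t ω : ℂ)) :=
    Complex.measurable_ofReal.comp hXm
  have hYs : Measurable fun q : Ω × ℝ => ‖(X q.2 q.1 : ℂ)‖ₑ ^ p :=
    ((hYm.comp measurable_swap).enorm).pow_const p
  have hfin : ∫⁻ ω, (∫⁻ t in Set.Icc 0 T, ‖(X t ω : ℂ)‖ₑ ^ p) ∂P ≠ ∞ := by
    rw [lintegral_lintegral_swap hYs.aemeasurable]
    refine ne_top_of_le_ne_top ?_ (setLIntegral_mono' (g := fun _ => ENNReal.ofReal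
      (2 * ((p * (C * σ) / 1) ^ p * Real.exp (-p)) * Real.exp (φ 1))) measurableSet_Icc
      fun t ht => ?_)
    · rw [setLIntegral_const]
      exact ENNReal.mul_ne_top ENNReal.ofReal_ne_top (by simp)
    · refine le_trans (le_of_eq (lintegral_congr_ae ((toL2_coeFn (hX2 t)).mono
        fun ω hω => ?_))) (hX.lintegral_rpow_le hφ hX2 (toL2_mem_closedSpan t) hσ0 (hσ t ht) hp
          one_pos)
      simp only [hω]
  have hae := ae_lt_top (hYs.lintegral_prod_right' (ν := volume.restrict (Set.Icc 0 T))) hfin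
  filter_upwards [hae] with ω hω
  refine ⟨(hYm.comp measurable_prodMk_right).aestronglyMeasurable, ?_⟩
  rw [eLpNorm_lt_top_iff_lintegral_rpow_enorm_lt_top (by simpa using hp) ENNReal.ofReal_ne_top,
    ENNReal.toReal_ofReal hp.le]
  exact hω

end Curve

end SubGaussWavelet

namespace SubGaussWavelet

/-! ### Weights of the levels -/

section Weights

variable {g : ℝ → ℂ} {Φ : ℝ → ℝ}

theorem AssumptionS.tailC_le_constC (hS : AssumptionS g Φ) {S : ℝ} (hS0 : 0 ≤ S) {K : ℕ}
    (hK : S + 1 ≤ K) : tailC Φ S K ≤ constC Φ := by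
  have h1 := hS.setIntegral_Ioi_anti (a := 0) (b := (K : ℝ) - S - 1) le_rfl (by linarith)
  have h2 := hS.setIntegral_Ioi_anti (a := 0) (b := (K : ℝ) - 1) le_rfl (by linarith)
  have h3 := hS.setIntegral_Ioi_zero_le
  have h4 := hS.nonneg le_rfl
  have h5 := hS.setIntegral_Ioi_nonneg (a := 1 / 2) (by norm_num)
  unfold tailC constC
  linarith

open Classical in
/-- The bound of the tail of the sum of translates over `[0, S]`: the tail constant when it is
meaningful, the bound of the full sum otherwise. -/
noncomputable def tailWeight (Φ : ℝ → ℝ) (S : ℝ) (K : ℕ) : ℝ≥0∞ :=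
  if S + 1 ≤ K then ENNReal.ofReal (tailC Φ S K) else ENNReal.ofReal (constC Φ)

theorem AssumptionS.tsum_compl_le (hS : AssumptionS g Φ) (hg : Continuous g) (x : ℝ)
    (s : Finset ℤ) :
    ∑' k : ℤ, (if k ∈ s then 0 else ‖g (x - k)‖ₑ) ≤ ENNReal.ofReal (constC Φ) :=
  (ENNReal.tsum_le_tsum fun k => by split_ifs <;> simp).trans (hS.tsum_enorm_le hg x)

theorem AssumptionS.tsum_compl_le_tailWeight (hS : AssumptionS g Φ) (hg : Continuous g) {x S : ℝ}
    (hx0 : 0 ≤ x) (hxS : x ≤ S) (K : ℕ) :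
    ∑' k : ℤ, (if k ∈ Finset.Icc (-(K : ℤ)) K then 0 else ‖g (x - k)‖ₑ) ≤ tailWeight Φ S K := by
  unfold tailWeight
  split_ifs with h
  · exact hS.tsum_tail_enorm_le hg hx0 hxS h
  · exact hS.tsum_compl_le hg x _

theorem AssumptionS.tailWeight_le (hS : AssumptionS g Φ) {S : ℝ} (hS0 : 0 ≤ S) (K : ℕ) :
    tailWeight Φ S K ≤ ENNReal.ofReal (constC Φ) := by
  unfold tailWeight
  split_ifs with h
  · exact ENNReal.ofReal_le_ofReal (hS.tailC_le_constC hS0 h)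
  · exact le_rfl

theorem AssumptionS.tendsto_tailWeight (hS : AssumptionS g Φ) (S : ℝ) :
    Tendsto (tailWeight Φ S) atTop (𝓝 0) := by
  have h := ENNReal.tendsto_ofReal (hS.tendsto_tailC S)
  rw [ENNReal.ofReal_zero] at h
  refine h.congr' ?_
  filter_upwards [(tendsto_natCast_atTop_atTop (R := ℝ)).eventually_ge_atTop (S + 1)] with K hK
  rw [tailWeight, if_pos hK]

end Weights

/-- The case `S = ∞` is not excluded: finiteness of `S * D` then forces `D = 0`, and all the
products vanish because `∞ * 0 = 0`. -/
theorem tendsto_mul_zero_of_dominated {S D : ℝ≥0∞} {w : ℕ → ℝ≥0∞} (hfin : S * D ≠ ∞)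
    (hle : ∀ n, w n ≤ D) (hw : Tendsto w atTop (𝓝 0)) :
    Tendsto (fun n => S * w n) atTop (𝓝 0) := by
  by_cases hS : S = ∞
  · have hD : D = 0 := by
      by_contra h
      exact hfin (by rw [hS, ENNReal.top_mul h])
    have h0 : ∀ n, S * w n = 0 := fun n => by
      rw [nonpos_iff_eq_zero.1 ((hle n).trans hD.le), mul_zero]
    simp only [h0]
    exact tendsto_const_nhds
  · simpa using ENNReal.Tendsto.const_mul hw (Or.inr hS)

theorem tendsto_tsum_zero_of_dominated {F : ℕ → ℕ → ℝ≥0∞} {D : ℕ → ℝ≥0∞} (hD : ∑' j, D j ≠ ∞)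
    (hle : ∀ n j, F n j ≤ D j) (hF : ∀ j, Tendsto (fun n => F n j) atTop (𝓝 0)) :
    Tendsto (fun n => ∑' j, F n j) atTop (𝓝 0) := by
  have h := tendsto_lintegral_of_dominated_convergence (μ := Measure.count) (f := fun _ : ℕ => 0)
    (F := F) D (fun n => measurable_from_top) (fun n => Eventually.of_forall (hle n))
    (by rwa [lintegral_count]) (Eventually.of_forall hF)
  simpa [lintegral_count] using h

/-! ### Deviation bounds for the approximants -/

section Error

variable {Ω : Type*} [MeasurableSpace Ω] {P : Measure Ω} {X : ℝ → Ω → ℝ} {fw mw m₀ : ℝ → ℂ}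
  {Φf Φm c A : ℝ → ℝ} {x₀ : ℝ}

/-- The bound of the mean-square error that corresponds to level weights `w₀, w 0, w 1, …`. -/
noncomputable def errorBound (P : Measure Ω) (X : ℝ → Ω → ℝ) (fw mw : ℝ → ℂ) (w₀ : ℝ≥0∞)
    (w : ℕ → ℝ≥0∞) : ℝ≥0∞ :=
  supXi P X fw * w₀ +
    ∑' j : ℕ, supEta P X mw j * (ENNReal.ofReal ((2 : ℝ) ^ ((j : ℝ) / 2)) * w j)

theorem enorm_errorL2_le (hfw : IsFWavelet fw m₀) (hmw : IsMWavelet fw m₀ mw)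
    (hSf : AssumptionS fw Φf) (hfc : Continuous fw) (hSm : AssumptionS mw Φm)
    (hmc : Continuous mw) (hGf : GrowthCondition c A x₀ Φf) (hGm : GrowthCondition c A x₀ Φm)
    (hX2 : ∀ t, MemLp (X t) 2 P) (hR : Continuous fun q : ℝ × ℝ => cov P X q.1 q.2)
    (hRc : ∀ t, Real.sqrt |cov P X t t| ≤ c t) (t : ℝ) (n k0 : ℕ) (k : ℕ → ℕ)
    {w₀ : ℝ≥0∞} {w : ℕ → ℝ≥0∞}
    (hw₀ : ∑' i : ℤ, (if i ∈ Finset.Icc (-(k0 : ℤ)) k0 then 0 else ‖fw (t - i)‖ₑ) ≤ w₀)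
    (hw : ∀ j < n, ∑' i : ℤ, (if i ∈ Finset.Icc (-(k j : ℤ)) (k j) then 0 else
      ‖mw (2 ^ j * t - i)‖ₑ) ≤ w j)
    (hw' : ∀ j, n ≤ j → ENNReal.ofReal (constC Φm) ≤ w j) :
    ‖errorL2 P X fw mw n k0 k t‖ₑ ≤ errorBound P X fw mw w₀ w := by
  have h := enorm_expansion_error_le hfw hmw hSf hfc hSm hmc hGf hGm (continuous_toL2 hX2 hR)
    (norm_toL2_le hX2 hRc) t n (Finset.Icc (-(k0 : ℤ)) k0)
    (fun j => Finset.Icc (-(k j : ℤ)) (k j)) hw₀ hw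
    fun j hj => (hSm.tsum_enorm_le hmc _).trans (hw' j hj)
  unfold errorBound supXi supEta
  simp only [← Lp.enorm_def]
  exact h

theorem ofReal_two_rpow_mul (j : ℕ) (r : ℝ) :
    ENNReal.ofReal ((2 : ℝ) ^ ((j : ℝ) / 2) * r) =
      ENNReal.ofReal ((2 : ℝ) ^ ((j : ℝ) / 2)) * ENNReal.ofReal r :=
  ENNReal.ofReal_mul (by positivity)

theorem errorBound_mono {w₀ w₀' : ℝ≥0∞} {w w' : ℕ → ℝ≥0∞} (h₀ : w₀ ≤ w₀') (h : ∀ j, w j ≤ w' j) :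
    errorBound P X fw mw w₀ w ≤ errorBound P X fw mw w₀' w' := by
  unfold errorBound
  gcongr with j
  exact h j

/-- The mean-square error bounds tend to zero with the weights. -/
theorem tendsto_errorBound {D₀ D : ℝ≥0∞} (hfin : errorBound P X fw mw D₀ (fun _ => D) ≠ ∞)
    {w₀ : ℕ → ℝ≥0∞} {w : ℕ → ℕ → ℝ≥0∞} (hle₀ : ∀ n, w₀ n ≤ D₀) (hle : ∀ n j, w n j ≤ D)
    (hw₀ : Tendsto w₀ atTop (𝓝 0)) (hw : ∀ j, Tendsto (fun n => w n j) atTop (𝓝 0)) :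
    Tendsto (fun n => errorBound P X fw mw (w₀ n) (w n)) atTop (𝓝 0) := by
  unfold errorBound at hfin ⊢
  rw [ENNReal.add_ne_top] at hfin
  rw [← add_zero (0 : ℝ≥0∞)]
  refine (tendsto_mul_zero_of_dominated hfin.1 hle₀ hw₀).add
    (tendsto_tsum_zero_of_dominated hfin.2 (fun n j => ?_) fun j => ?_)
  · gcongr
    exact hle n j
  · simp only [← mul_assoc]
    refine tendsto_mul_zero_of_dominated (D := D) ?_ (fun n => hle n j) (hw j)
    rw [mul_assoc]
    exact ENNReal.ne_top_of_tsum_ne_top hfin.2 j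

/-- The error bound for weights that change at level `J`, as a finite sum and a remainder. -/
theorem errorBound_split (J : ℕ) (w₀ D : ℝ) (v : ℕ → ℝ) :
    errorBound P X fw mw (ENNReal.ofReal w₀)
        (fun j => if j < J then ENNReal.ofReal (v j) else ENNReal.ofReal D) =
      supXi P X fw * ENNReal.ofReal w₀ +
        ∑ j ∈ Finset.range J, supEta P X mw j *
          ENNReal.ofReal ((2 : ℝ) ^ ((j : ℝ) / 2) * v j) +
        ∑' j : {j : ℕ // J ≤ j}, supEta P X mw j *
          ENNReal.ofReal ((2 : ℝ) ^ ((j : ℝ) / 2) * D) := by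
  have h1 : ∑' j : {j : ℕ // J ≤ j}, supEta P X mw j *
      ENNReal.ofReal ((2 : ℝ) ^ ((j : ℝ) / 2) * D) = ∑' j : ℕ, (Set.Ici J).indicator (fun j =>
        supEta P X mw j * ENNReal.ofReal ((2 : ℝ) ^ ((j : ℝ) / 2) * D)) j :=
    tsum_subtype (Set.Ici J) fun j : ℕ =>
      supEta P X mw j * ENNReal.ofReal ((2 : ℝ) ^ ((j : ℝ) / 2) * D)
  have h2 : ∑ j ∈ Finset.range J, supEta P X mw j *
      ENNReal.ofReal ((2 : ℝ) ^ ((j : ℝ) / 2) * v j) = ∑' j : ℕ, if j < J then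
        supEta P X mw j * ENNReal.ofReal ((2 : ℝ) ^ ((j : ℝ) / 2) * v j) else 0 := by
    rw [tsum_eq_sum (s := Finset.range J) fun j hj => if_neg (by simpa using hj)]
    exact Finset.sum_congr rfl fun j hj => (if_pos (Finset.mem_range.1 hj)).symm
  rw [h1, h2, add_assoc, ← ENNReal.tsum_add, errorBound]
  congr 2 with j
  by_cases hj : j < J
  · simp [hj, ofReal_two_rpow_mul]
  · simp [hj, not_lt.1 hj, ofReal_two_rpow_mul]

variable [IsProbabilityMeasure P] {φ f : ℝ → ℝ} {C : ℝ}

/-- The exponential bound, for a process whose mean-square error is at most `σ`. -/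
theorem IsStrictlySub.measure_lpError_le_exp (hφ : IsNFunction φ) (hf : IsDensity φ f)
    (hX : IsStrictlySub φ P X C) (hX2 : ∀ t, MemLp (X t) 2 P)
    (hXm : Measurable (Function.uncurry X)) (hfc : Continuous fw) (hmc : Continuous mw)
    {p T σ ε cn : ℝ} (hp : 0 < p) (hT : 0 < T) (hσ0 : 0 < σ) (hε : 0 < ε) (n k0 : ℕ) (k : ℕ → ℕ)
    (hσ : ∀ t ∈ Set.Icc 0 T, ‖errorL2 P X fw mw n k0 k t‖ ≤ σ) (hcn : cn = C ^ p * T * σ ^ p)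
    (hcond : cn * f (p * (cn / ε) ^ (1 / p)) ^ p < ε) :
    P {ω | ENNReal.ofReal ε < lpError P X fw mw p T n k0 k ω} ≤
      ENNReal.ofReal (2 * Real.exp (-youngFenchel φ ((ε / cn) ^ (1 / p)))) := by
  have hC : 0 < C := hX.2.1
  have hcn0 : 0 < cn := by rw [hcn]; positivity
  set x : ℝ := (ε / cn) ^ (1 / p) with hx
  have hx0 : 0 < x := by positivity
  have hxp : x ^ p = ε / cn := by
    rw [hx, ← Real.rpow_mul (by positivity), one_div_mul_cancel hp.ne', Real.rpow_one]
  have hxi : (cn / ε) ^ (1 / p) = x⁻¹ := by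
    rw [hx, ← Real.inv_rpow (by positivity), inv_div]
  rw [hxi] at hcond
  have hb0 : 0 < p * x⁻¹ := by positivity
  -- The condition on `ε`, divided by `cn`, is `f(p/x)^p < x^p`.
  have hfb : f (p * x⁻¹) ≤ x := by
    have h : f (p * x⁻¹) ^ p < x ^ p := by
      rw [hxp, lt_div_iff₀ hcn0, mul_comm]
      exact hcond
    exact ((Real.rpow_lt_rpow_iff (hf.nonneg hb0.le) hx0.le hp).1 h).le
  refine le_exp_neg_youngFenchel hf hx0 hfb fun a ha => ?_
  have ha0 : 0 < a := hb0.trans_le ha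
  -- The moment order is taken to be `s = x * a`; it is admissible exactly because `a ≥ p / x`.
  have hps : p ≤ x * a := by
    calc p = x * (p * x⁻¹) := by field_simp
      _ ≤ x * a := by gcongr
  refine (hX.measure_lpError_le hφ hX2 hXm hfc hmc hp hps hσ0 ha0 hε n k0 k hσ).trans
    (le_of_eq ?_)
  -- For this order, `(xCσ)^p = ε/T` by the choice of `x`, so the powers of `T` and `ε` cancel and
  -- `2 exp(φ a - x a)` remains.
  have hq : (x * a * (C * σ) / a) ^ (x * a) = (ε / T) ^ (x * a / p) := by
    have h1 : x * a * (C * σ) / a = x * (C * σ) := by field_simp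
    have h2 : (x * (C * σ)) ^ p = ε / T := by
      rw [Real.mul_rpow hx0.le (by positivity), Real.mul_rpow hC.le hσ0.le, hxp, hcn]
      field_simp
    rw [h1, ← h2, ← Real.rpow_mul (by positivity), mul_div_cancel₀ _ hp.ne']
  rw [ENNReal.ofReal_rpow_of_pos hT, ENNReal.ofReal_rpow_of_pos hε,
    ← ENNReal.ofReal_mul (by positivity), ← ENNReal.ofReal_div_of_pos (by positivity), hq,
    Real.div_rpow hε.le hT.le, neg_sub, Real.exp_sub, Real.exp_neg]
  congr 1
  have h1 : 0 < T ^ (x * a / p) := by positivity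
  have h2 : 0 < ε ^ (x * a / p) := by positivity
  field_simp

/-- If the mean-square errors tend to zero uniformly, then so do the `L_p` errors, in
probability. -/
theorem IsStrictlySub.tendsto_measure_lpError (hφ : IsNFunction φ)
    (hX : IsStrictlySub φ P X C) (hX2 : ∀ t, MemLp (X t) 2 P)
    (hXm : Measurable (Function.uncurry X)) (hfc : Continuous fw) (hmc : Continuous mw)
    {p T ε : ℝ} (hp : 0 < p) (hε : 0 < ε) (k0 : ℕ → ℕ) (k : ℕ → ℕ → ℕ) {b : ℕ → ℝ≥0∞}
    (hb : Tendsto b atTop (𝓝 0)) (hbfin : ∀ n, b n ≠ ∞)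
    (hσ : ∀ n, ∀ t ∈ Set.Icc 0 T, ‖errorL2 P X fw mw n (k0 n) (k n) t‖ₑ ≤ b n) :
    Tendsto (fun n => P {ω | ENNReal.ofReal ε < lpError P X fw mw p T n (k0 n) (k n) ω ^ (1 / p)})
      atTop (𝓝 0) := by
  -- The added null sequence keeps `σ n` positive, as the moment bound requires, even when the error
  -- bound is 0.
  set σ : ℕ → ℝ := fun n => (b n).toReal + 1 / ((n : ℝ) + 1) with hσdef
  have hσ0 : ∀ n, 0 < σ n := fun n => by positivity
  have hσlim : Tendsto σ atTop (𝓝 0) := by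
    have h := ((ENNReal.continuousAt_toReal ENNReal.zero_ne_top).tendsto.comp hb).add
      (tendsto_one_div_add_atTop_nhds_zero_nat (𝕜 := ℝ))
    simpa [hσdef] using h
  have hσle : ∀ n, ∀ t ∈ Set.Icc 0 T, ‖errorL2 P X fw mw n (k0 n) (k n) t‖ ≤ σ n :=
    fun n t ht => by
      have h := ENNReal.toReal_mono (hbfin n) (hσ n t ht)
      rw [toReal_enorm] at h
      exact h.trans (le_add_of_nonneg_right (by positivity))
  have hset : ∀ n, {ω | ENNReal.ofReal ε < lpError P X fw mw p T n (k0 n) (k n) ω ^ (1 / p)} =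
      {ω | ENNReal.ofReal (ε ^ p) < lpError P X fw mw p T n (k0 n) (k n) ω} := fun n => by
    ext ω
    rw [Set.mem_ofPred_eq, Set.mem_ofPred_eq, one_div, ENNReal.lt_rpow_inv_iff hp,
      ENNReal.ofReal_rpow_of_pos hε]
  have hεp : 0 < ε ^ p := by positivity
  simp only [hset]
  -- With `s = p` and `a = 1` the deviation bound is a constant multiple of `σ n ^ p`.
  refine tendsto_of_tendsto_of_tendsto_of_le_of_le tendsto_const_nhds ?_ (fun n => bot_le)
    fun n => hX.measure_lpError_le hφ hX2 hXm hfc hmc hp le_rfl (hσ0 n) one_pos hεp n (k0 n) (k n)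
      (hσle n)
  have hcont : Continuous fun r : ℝ =>
      2 * ((p * (C * r) / 1) ^ p * Real.exp (-p)) * Real.exp (φ 1) :=
    (continuous_const.mul (((by fun_prop : Continuous fun r : ℝ => p * (C * r) / 1).rpow_const
      fun _ => Or.inr hp.le).mul continuous_const)).mul continuous_const
  have h1 := ENNReal.tendsto_ofReal ((hcont.tendsto 0).comp hσlim)
  have h0 : 2 * ((p * (C * 0) / 1) ^ p * Real.exp (-p)) * Real.exp (φ 1) = 0 := by
    simp [Real.zero_rpow hp.ne']
  rw [h0, ENNReal.ofReal_zero] at h1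
  have hTtop : ENNReal.ofReal T ^ (p / p) ≠ ∞ :=
    ENNReal.rpow_ne_top_of_nonneg (by positivity) ENNReal.ofReal_ne_top
  have hε0 : ENNReal.ofReal (ε ^ p) ^ (p / p) ≠ 0 := by
    rw [div_self hp.ne', ENNReal.rpow_one]
    simpa using hεp
  have h2 := ENNReal.Tendsto.div_const (ENNReal.Tendsto.const_mul h1 (Or.inr hTtop)) (Or.inr hε0)
  simpa using h2

end Error

theorem levelJ_le (T : ℝ) (n : ℕ) (k : ℕ → ℕ) : levelJ T n k ≤ n :=
  Nat.sInf_le (Or.inl rfl)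

theorem le_of_lt_levelJ {T : ℝ} {n j : ℕ} {k : ℕ → ℕ} (h : j < levelJ T n k) :
    2 ^ j * T + 1 ≤ (k j : ℝ) :=
  not_lt.1 fun hlt => Nat.notMem_of_lt_sInf h (Or.inr hlt)

end SubGaussWavelet

/-! ### The theorem. -/

open SubGaussWavelet in
theorem mainTheorem2
    {Ω : Type*} [MeasurableSpace Ω] (P : Measure Ω) [IsProbabilityMeasure P]
    -- the N-function and its density
    (φ f : ℝ → ℝ) (hφ : AssumptionQ φ) (hf : IsDensity φ f)
    -- the strictly φ-sub-Gaussian process with determinative constant `CX`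
    (X : ℝ → Ω → ℝ) (hXmeas : Measurable (Function.uncurry X))
    (CX : ℝ) (hX : IsStrictlySub φ P X CX)
    (hX2 : ∀ t, MemLp (X t) 2 P)
    (hR : Continuous (fun q : ℝ × ℝ => cov P X q.1 q.2))
    -- the wavelets
    (fw mw m₀ : ℝ → ℂ) (hfw : IsFWavelet fw m₀) (hmw : IsMWavelet fw m₀ mw)
    (hfw_cont : Continuous fw) (hmw_cont : Continuous mw)
    (Φf Φm : ℝ → ℝ) (hSf : AssumptionS fw Φf) (hSm : AssumptionS mw Φm)
    -- the growth function
    (c A : ℝ → ℝ) (x₀ : ℝ)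
    (hc_even : ∀ x, c (-x) = c x) (hc_mono : MonotoneOn c (Set.Ici 0)) (hc_zero : 1 < c 0)
    (hA : ∀ a, 0 < a → 0 < A a) (hcA : ∀ a, 0 < a → ∀ x, x₀ ≤ x → c (a * x) ≤ c x * A a)
    (hcΦf : Integrable (fun x : ℝ => c x * Φf |x|)) (hcΦm : Integrable (fun x : ℝ => c x * Φm |x|))
    (hRc : ∀ t, Real.sqrt |cov P X t t| ≤ c t)
    -- the interval, the exponent, and the integrability conditions
    (T : ℝ) (hT : 0 < T) (p : ℝ) (hp : 1 ≤ p)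
    (hXp : IntegrableOn (fun t => (∫ ω, X t ω ^ 2 ∂P) ^ (p / 2)) (Set.Icc 0 T))
    (hsum : supXi P X fw * ENNReal.ofReal (constC Φf) +
      ∑' j : ℕ, supEta P X mw j * ENNReal.ofReal ((2 : ℝ) ^ ((j : ℝ) / 2) * constC Φm) < ∞) :
    -- `X` and its approximants are in `L_p([0,T])`
    InLp P (fun t ω => (X t ω : ℂ)) p T ∧
    (∀ (n k0 : ℕ) (k : ℕ → ℕ), InLp P (approx P X fw mw n k0 k) p T) ∧
    -- convergence in probability in `L_p([0,T])` as `k_n → ∞`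
    (∀ (k0 : ℕ → ℕ) (k : ℕ → ℕ → ℕ), Tendsto k0 atTop atTop →
      (∀ j, Tendsto (fun n => k n j) atTop atTop) →
      ∀ ε : ℝ, 0 < ε →
        Tendsto (fun n => P {ω | ENNReal.ofReal ε <
          lpError P X fw mw p T n (k0 n) (k n) ω ^ (1 / p)}) atTop (𝓝 0)) ∧
    -- the exponential bound, where the right-hand side is read as `0` if `c_n^∞ = 0`
    (∀ (n k0 : ℕ) (k : ℕ → ℕ), T + 1 ≤ (k0 : ℝ) →
      ∀ cn : ℝ, cn = cInfty P X fw mw Φf Φm CX p T n k0 k →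
      ∀ ε : ℝ, 0 < ε → cn * f (p * (cn / ε) ^ (1 / p)) ^ p < ε →
        (0 < cn → P {ω | ENNReal.ofReal ε < lpError P X fw mw p T n k0 k ω} ≤
          ENNReal.ofReal (2 * Real.exp (-youngFenchel φ ((ε / cn) ^ (1 / p))))) ∧
        (cn = 0 → P {ω | ENNReal.ofReal ε < lpError P X fw mw p T n k0 k ω} = 0)) := by

  have hp0 : 0 < p := one_pos.trans_le hp
  have hGf : GrowthCondition c A x₀ Φf := ⟨hc_even, hc_mono, hc_zero, hcA, hcΦf⟩
  have hGm : GrowthCondition c A x₀ Φm := ⟨hc_even, hc_mono, hc_zero, hcA, hcΦm⟩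
  have hfin : errorBound P X fw mw (ENNReal.ofReal (constC Φf))
      (fun _ => ENNReal.ofReal (constC Φm)) ≠ ∞ := by
    simpa only [errorBound, ← ofReal_two_rpow_mul] using hsum.ne
  have hdil : ∀ j : ℕ, ∀ t ∈ Set.Icc 0 T, 0 ≤ 2 ^ j * t ∧ 2 ^ j * t ≤ 2 ^ j * T := fun j t ht =>
    ⟨mul_nonneg (by positivity) ht.1, mul_le_mul_of_nonneg_left ht.2 (by positivity)⟩
  refine ⟨?_, fun n k0 k => inLp_approx hfw_cont hmw_cont p T n k0 k, ?_, ?_⟩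
  · refine hX.inLp hφ.1 hX2 hXmeas hp0 (σ := c T) ?_ fun t ht => ?_
    · exact (one_pos.trans hc_zero).trans_le (hc_mono Set.self_mem_Ici hT.le hT.le)
    · exact (norm_toL2_le hX2 hRc t).trans (hc_mono ht.1 hT.le ht.2)
  · intro k0 k hk0 hk ε hε
    -- Each level has its own weight, which for fixed `j` tends to 0 and never exceeds `constC Φm`;
    -- the summability hypothesis is therefore the domination over levels.
    set w : ℕ → ℕ → ℝ≥0∞ := fun n j => if j < n then tailWeight Φm (2 ^ j * T) (k n j) else
      ENNReal.ofReal (constC Φm) with hw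
    have hwle : ∀ n j, w n j ≤ ENNReal.ofReal (constC Φm) := fun n j => by
      simp only [hw]
      split_ifs
      · exact hSm.tailWeight_le (by positivity) _
      · exact le_rfl
    have hw₀le : ∀ n, tailWeight Φf T (k0 n) ≤ ENNReal.ofReal (constC Φf) := fun n =>
      hSf.tailWeight_le hT.le _
    refine hX.tendsto_measure_lpError hφ.1 hX2 hXmeas hfw_cont hmw_cont hp0 hε k0 k
      (b := fun n => errorBound P X fw mw (tailWeight Φf T (k0 n)) (w n))
      (tendsto_errorBound hfin hw₀le hwle ((hSf.tendsto_tailWeight T).comp hk0) fun j => ?_)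
      (fun n => ne_top_of_le_ne_top hfin (errorBound_mono (hw₀le n) (hwle n)))
      fun n t ht => enorm_errorL2_le hfw hmw hSf hfw_cont hSm hmw_cont hGf hGm hX2 hR hRc t n
        (k0 n) (k n) (hSf.tsum_compl_le_tailWeight hfw_cont ht.1 ht.2 _) (fun j hj => ?_)
        fun j hj => ?_
    · refine ((hSm.tendsto_tailWeight (2 ^ j * T)).comp (hk j)).congr' ?_
      filter_upwards [eventually_gt_atTop j] with n hn
      simp only [hw, if_pos hn, Function.comp_apply]
    · simp only [hw, if_pos hj]
      exact hSm.tsum_compl_le_tailWeight hmw_cont (hdil j t ht).1 (hdil j t ht).2 _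
    · simp only [hw, if_neg hj.not_gt, le_refl]
  · intro n k0 k hk0 cn hcn ε hε hcond
    set w : ℕ → ℝ≥0∞ := fun j => if j < levelJ T n k then
      ENNReal.ofReal (tailC Φm (2 ^ j * T) (k j)) else ENNReal.ofReal (constC Φm) with hw
    set b : ℝ≥0∞ := errorBound P X fw mw (ENNReal.ofReal (tailC Φf T k0)) w with hb
    have hbfin : b ≠ ∞ := by
      refine ne_top_of_le_ne_top hfin (errorBound_mono
        (ENNReal.ofReal_le_ofReal (hSf.tailC_le_constC hT.le hk0)) fun j => ?_)
      simp only [hw]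
      split_ifs with hj
      · exact ENNReal.ofReal_le_ofReal
          (hSm.tailC_le_constC (by positivity) (le_of_lt_levelJ hj))
      · exact le_rfl
    have herr : ∀ t ∈ Set.Icc 0 T, ‖errorL2 P X fw mw n k0 k t‖ ≤ b.toReal := fun t ht => by
      rw [← toReal_enorm]
      refine ENNReal.toReal_mono hbfin (enorm_errorL2_le hfw hmw hSf hfw_cont hSm hmw_cont hGf hGm
        hX2 hR hRc t n k0 k (hSf.tsum_tail_enorm_le hfw_cont ht.1 ht.2 hk0) (fun j _ => ?_)
        fun j hj => ?_)
      · simp only [hw]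
        -- Levels between `levelJ` and `n` are charged with the full constant even if their
        -- truncation would permit the tail constant, as in the definition of `cInfty`.
        split_ifs with hj
        · exact hSm.tsum_tail_enorm_le hmw_cont (hdil j t ht).1 (hdil j t ht).2
            (le_of_lt_levelJ hj)
        · exact hSm.tsum_compl_le hmw_cont _ _
      · simp only [hw, if_neg ((levelJ_le T n k).trans hj).not_gt, le_refl]
    have hcn' : cn = CX ^ p * T * b.toReal ^ p := by
      rw [hcn, cInfty, hb, hw, errorBound_split]
    have hCX : 0 < CX := hX.2.1
    -- Since `CX` and `T` are positive, `cn = 0` precisely when the mean-square bound vanishes; in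
    -- that case the error is 0 in `L_2(Ω)` at each `t`.
    rcases (ENNReal.toReal_nonneg (a := b)).eq_or_lt with h0 | hpos
    · rw [← h0, Real.zero_rpow hp0.ne', mul_zero] at hcn'
      refine ⟨fun h => absurd hcn' h.ne', fun _ => ?_⟩
      refine measure_lpError_eq_zero hX2 hXmeas hfw_cont hmw_cont hp0 hε n k0 k fun t ht => ?_
      exact norm_le_zero_iff.1 (h0 ▸ herr t ht)
    · refine ⟨fun _ => hX.measure_lpError_le_exp hφ.1 hf hX2 hXmeas hfw_cont hmw_cont hp0 hT hpos
        hε n k0 k herr hcn' hcond, fun h => absurd (hcn'.symm.trans h) ?_⟩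
      positivity
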